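/- Let $\nu>0$. For $y\in\mathbf R^3$ and $t>0$ put $K(y,t)=(2\pi t)^{-3/2}e^{-|y|^2/(2t)}$, and for $y\ne 0$ put $e_y=y/|y|$, $\mathbf P_y=I-e_ye_y^t$, $$\mathbf b_1(y;u,v)=(u\cdot e_y)\mathbf P_yv+(v\cdot e_y)\mathbf P_yu,\qquad \mathbf b_2(y;u,v)=\mathbf b_1(y;u,v)+\big(u\cdot(I-3e_ye_y^t)v\big)e_y .$$ Let $u_0:\mathbf R^3\to\mathbf R^3$ be locally integrable with $\nabla\cdot u_0=0$ in the sense of distributions, let $g:\mathbf R^3\times(0,\infty)\to\mathbf R^3$ be locally integrable, and let $u:\mathbf R^3\times(0,\infty)\to\mathbf R^3$ be locally square integrable. Suppose that for almost every $(x,t)\in\mathbf R^3\times(0,\infty)$ $$\begin{aligned}u(x,t)={}&\int_{\mathbf R^3}u_0(x-y)K(y,2\nu t)\,dy\\&+\int_0^t\!\int_{\mathbf R^3}\Big\{\frac{|z|}{4\nu s}K(z,2\nu s)\,\mathbf b_1\big(z;u(x-z,t-s),u(x-z,t-s)\big)\\&\quad+\Big(\frac1{|z|}K(z,2\nu s)-\frac3{4\pi|z|^4}\int_{|y|\le|z|}K(y,2\nu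 s)\,dy\Big)\mathbf b_2\big(z;u(x-z,t-s),u(x-z,t-s)\big)\\&\quad+\Big(K(z,2\nu s)\mathbf P_z-\frac1{4\pi|z|^3}(I-3e_ze_z^t)\int_{|y|\le|z|}K(y,2\nu s)\,dy\Big)g(x-z,t-s)\Big\}\,dz\,ds,\end{aligned}$$ where the initial-data integral, the integral of the sum of the $\mathbf b_1$ and $\mathbf b_2$ terms, and the integral of the $g$ term converge absolutely. Then $u$ is a weak solution of the Navier–Stokes equations with initial velocity $u_0$: in the sense of distributions on $\mathbf R^3\times(0,\infty)$ one has $\nabla\cdot u=0$, and there is a distribution $p$ on $\mathbf R^3\times(0,\infty)$ with $$\frac{\partial u}{\partial t}+\nabla\cdot(u\otimes u)=\nu\Delta u-\nabla p+g ;$$ moreover, for every $\varphi\in C_0^\infty(\mathbf R^3)$, $\int u(x,t)\varphi(x)\,dx\to\int u_0(x)\varphi(x)\,dx$ as $t\downarrow0$ along almost every $t$. If in addition $\int_0^\infty\!\int_{\mathbf R^3}(1+|x|+t)^{-N}\big(|u(x,t)|^2+|g(x,t)|\big)\,dx\,dt<\infty$ for some $N$, then $u$ is a tempered distribution on $\mathbf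 R^3\times(0,\infty)$ (the restriction of a tempered distribution on $\mathbf R^4$), and $p$ can be chosen to be one too. -/

import Mathlib

open MeasureTheory Set Filter Topology TopologicalSpace
open scoped Distributions SchwartzMap LineDeriv RealInnerProductSpace

noncomputable section

namespace NavierStokes

/-- Physical space `ℝ³` with its Euclidean norm. -/
abbrev E3 : Type := EuclideanSpace ℝ (Fin 3)

/-- Points `(x, t)`. All fields below are functions of `(x, t)`; only their values at `t > 0` are
ever used. -/
abbrev SpaceTime : Type := E3 × ℝ

/-- The open set `ℝ³ × (0, ∞)`. -/
def halfSpace : Opens SpaceTime := ⟨univ ×ˢ Ioi 0, isOpen_univ.prod isOpen_Ioi⟩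

/-- The unit vector of the `i`-th spatial direction in space-time. -/
def spaceDir (i : Fin 3) : SpaceTime := (EuclideanSpace.single i 1, 0)

/-- The unit vector of the time direction in space-time. -/
def timeDir : SpaceTime := (0, 1)

/-! ### The integral equation -/

/-- Transition density `K(y, t)` of three-dimensional Brownian motion. -/
def K (y : E3) (t : ℝ) : ℝ :=
  (2 * Real.pi * t) ^ (-(3 / 2) : ℝ) * Real.exp (-‖y‖ ^ 2 / (2 * t))

/-- The mass `∫_{|y| ≤ r} K(y, t) dy`. -/
def ballMass (r t : ℝ) : ℝ := ∫ y in Metric.closedBall (0 : E3) r, K y t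

/-- The unit vector `e_y = y / |y|` (for `y ≠ 0`). -/
def unitVec (y : E3) : E3 := ‖y‖⁻¹ • y

/-- `P_y v = (I - e_y e_yᵗ) v`. -/
def perp (y v : E3) : E3 := v - ⟪unitVec y, v⟫ • unitVec y

/-- `(I - 3 e_y e_yᵗ) v`. -/
def reflThree (y v : E3) : E3 := v - (3 * ⟪unitVec y, v⟫) • unitVec y

def b₁ (y u v : E3) : E3 := ⟪u, unitVec y⟫ • perp y v + ⟪v, unitVec y⟫ • perp y u

def b₂ (y u v : E3) : E3 := b₁ y u v + ⟪u, reflThree y v⟫ • unitVec y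

/-- The quadratic part of the integrand: the two `b₁` and `b₂` terms, evaluated at lag `(z, s)`
and velocity `w = u (x - z, t - s)`. -/
def nonlinearTerm (ν : ℝ) (z : E3) (s : ℝ) (w : E3) : E3 :=
  (‖z‖ / (4 * ν * s) * K z (2 * ν * s)) • b₁ z w w +
    (1 / ‖z‖ * K z (2 * ν * s) - 3 / (4 * Real.pi * ‖z‖ ^ 4) * ballMass ‖z‖ (2 * ν * s)) •
      b₂ z w w

/-- The forcing part of the integrand: the explicit kernel of the Leray-projected heat semigroup
at lag `(z, s)`, applied to `f = g (x - z, t - s)`. -/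
def forcingTerm (ν : ℝ) (z : E3) (s : ℝ) (f : E3) : E3 :=
  K z (2 * ν * s) • perp z f -
    (1 / (4 * Real.pi * ‖z‖ ^ 3) * ballMass ‖z‖ (2 * ν * s)) • reflThree z f

/-- The integral equation holds at the point `(x, t)`: the initial-data, nonlinear and forcing
integrals converge absolutely there and `u (x, t)` is their sum. -/
structure IntegralEquationAt (ν : ℝ) (u₀ : E3 → E3) (g u : SpaceTime → E3) (x : E3) (t : ℝ) :
    Prop where
  integrable_initial : Integrable fun y : E3 => K y (2 * ν * t) • u₀ (x - y)
  integrable_nonlinear :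
    IntegrableOn (fun q : SpaceTime => nonlinearTerm ν q.1 q.2 (u (x - q.1, t - q.2)))
      (univ ×ˢ Ioo 0 t)
  integrable_forcing :
    IntegrableOn (fun q : SpaceTime => forcingTerm ν q.1 q.2 (g (x - q.1, t - q.2)))
      (univ ×ˢ Ioo 0 t)
  eq : u (x, t) = (∫ y : E3, K y (2 * ν * t) • u₀ (x - y)) +
    ∫ s in (0 : ℝ)..t, ∫ z : E3,
      (nonlinearTerm ν z s (u (x - z, t - s)) + forcingTerm ν z s (g (x - z, t - s)))

/-! ### Weak solutions -/

/-- `u` is locally square integrable on `ℝ³ × (0, ∞)`. -/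
def LocallySquareIntegrable (u : SpaceTime → E3) : Prop :=
  ∀ C : Set SpaceTime, IsCompact C → C ⊆ halfSpace → MemLp u 2 (volume.restrict C)

/-- `∇ · u₀ = 0` in the sense of distributions on `ℝ³`. -/
def DivergenceFree₀ (u₀ : E3 → E3) : Prop :=
  ∀ φ : 𝓓((⊤ : Opens E3), ℝ),
    ∑ i : Fin 3, ∫ x : E3, u₀ x i * (∂_{EuclideanSpace.single i (1 : ℝ)} φ) x = 0

/-- `∇ · u = 0` in the sense of distributions on `ℝ³ × (0, ∞)`. -/
def DivergenceFree (u : SpaceTime → E3) : Prop :=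
  ∀ φ : 𝓓(halfSpace, ℝ), ∑ i : Fin 3, ∫ q : SpaceTime, u q i * (∂_{spaceDir i} φ) q = 0

/-- `∂u/∂t + ∇ · (u ⊗ u) = ν Δu - ∇p + g` in the sense of distributions on `ℝ³ × (0, ∞)`. For
divergence-free `u` the term `u · ∇u` is by definition `∇ · (u ⊗ u)`. -/
def MomentumEquation (ν : ℝ) (g u : SpaceTime → E3) (p : 𝓓'(halfSpace, ℝ)) : Prop :=
  ∀ (i : Fin 3) (φ : 𝓓(halfSpace, ℝ)),
    -(∫ q : SpaceTime, u q i * (∂_{timeDir} φ) q) -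
        ∑ j : Fin 3, ∫ q : SpaceTime, u q i * u q j * (∂_{spaceDir j} φ) q =
      ν * (∑ j : Fin 3, ∫ q : SpaceTime, u q i * (∂_{spaceDir j} (∂_{spaceDir j} φ)) q) +
        p (∂_{spaceDir i} φ) + ∫ q : SpaceTime, g q i * φ q

/-- `u (·, t) → u₀` in the sense of distributions on `ℝ³` as `t ↓ 0`. As `u` is only determined
almost everywhere, the limit is taken along almost every `t`. -/
def HasInitialVelocity (u₀ : E3 → E3) (u : SpaceTime → E3) : Prop :=
  ∀ (i : Fin 3) (φ : 𝓓((⊤ : Opens E3), ℝ)),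
    Tendsto (fun t : ℝ => ∫ x : E3, u (x, t) i * φ x) (𝓝[>] 0 ⊓ ae volume)
      (𝓝 (∫ x : E3, u₀ x i * φ x))

/-- A functional on test functions on `ℝ³ × (0, ∞)` is a tempered distribution on
`ℝ³ × (0, ∞)`: it is the restriction of a continuous linear functional on Schwartz space. -/
def IsTempered (L : 𝓓(halfSpace, ℝ) → ℝ) : Prop :=
  ∃ S : 𝓢(SpaceTime, ℝ) →L[ℝ] ℝ, ∀ φ : 𝓓(halfSpace, ℝ),
    S (φ.hasCompactSupport.toSchwartzMap φ.contDiff) = L φ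

/-- Weak solutions in the sense of distributions: the pressure is an arbitrary distribution on
`ℝ³ × (0, ∞)`. -/
structure IsDistributionalSolution (ν : ℝ) (u₀ : E3 → E3) (g u : SpaceTime → E3) : Prop where
  locallySquareIntegrable : LocallySquareIntegrable u
  divergenceFree : DivergenceFree u
  momentum : ∃ p : 𝓓'(halfSpace, ℝ), MomentumEquation ν g u p
  initial : HasInitialVelocity u₀ u

/-- Weak solutions in the class of tempered distributions: velocity and pressure are tempered
distributions on `ℝ³ × (0, ∞)`. -/
structure IsWeakSolution (ν : ℝ) (u₀ : E3 → E3) (g u : SpaceTime → E3) : Prop where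
  tempered : ∀ i : Fin 3, IsTempered fun φ => ∫ q : SpaceTime, u q i * φ q
  locallySquareIntegrable : LocallySquareIntegrable u
  divergenceFree : DivergenceFree u
  momentum : ∃ p : 𝓓'(halfSpace, ℝ), IsTempered p ∧ MomentumEquation ν g u p
  initial : HasInitialVelocity u₀ u

/-- `f` grows at most polynomially in the mean on `ℝ³ × (0, ∞)`. -/
def PolynomialGrowth (f : SpaceTime → ℝ) : Prop :=
  ∃ N : ℕ, IntegrableOn (fun q => f q / (1 + ‖q‖) ^ N) (halfSpace : Set SpaceTime)

end NavierStokes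

end

noncomputable section

open scoped ContDiff

namespace NavierStokes

/-! ### The heat kernel and its moments in time -/

/-! The forcing kernel is Oseen's tensor K(z, 2νs) I + ν ∫_s^∞ D²K(z, 2ντ) dτ. It is the kernel of
the heat semigroup followed by the projection onto divergence-free fields, because ν ∫_s^∞ K(·, 2ντ)
dτ inverts -Δ on K(·, 2νs). Ball masses occur in it because the substitution ρ = |z| √(s/τ) turns
them into time integrals of the heat kernel (`ballMass_eq_moment`). The quadratic kernel is minus
the derivative of Oseen's tensor in the direction w, applied to w (`inner_forcingTerm_eq`,
`inner_nonlinearTerm_eq`). The integral equation is therefore Duhamel's formula for the projected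
equation.

Let Φ be a divergence-free test field and L = -∂ₜ - νΔ. When LΦ is integrated against a Duhamel
potential, observation point first, the Hessian part of the kernel drops out because LΦ is
divergence-free, and the heat kernel part returns Φ at the source point
(`integral_backwardHeat_mul_K`). This is the momentum equation tested against divergence-free fields
(`sum_integral_velocity_mul_backwardHeat`). Incompressibility holds because both kernels annihilate
gradients (`sum_integral_fderiv_mul_forcing`) and the caloric extension inherits it from u₀.

Fubini needs more than convergence at individual points. Outside a parabola the kernels are bounded
below by multiples of |w|²/|z|⁴ and |w|/|z|³ (`exists_kernel_lower_bound`), so absolute convergence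
at two distant points forces |u|² (1+|x|)⁻⁴ and |g| (1+|x|)⁻³ to be integrable on every slab 0 < t <
T (`integrableOn_weight_of_good_points`). The matching upper bounds in terms of the parabolic
distance then justify Fubini (`AdmissibleSource.integrable_duhamelIntegrand`). The initial velocity
is integrable against every Gaussian because the equation holds at arbitrarily late times.

For the initial condition, Oseen's tensor paired with a fixed C² function of compact support is
bounded uniformly in the lag (`exists_bound_integral_mul_forcing`). The potentials at time t are
thus controlled by an integral over the slab of height t, which tends to zero.

The pressure comes from an explicit form of de Rham's theorem. Averaging and integrating along
coordinate lines gives a continuous linear map ψ ↦ V on Schwartz space, with div V equal to ψ minus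
its triple average, that preserves supports in boxes. The pressure of ψ is the momentum functional
at V. For ψ = ∂ⱼφ the triple average vanishes and V - φ eⱼ is divergence-free, hence p(∂ⱼφ) is the
momentum of φ in the direction j (`pressure_lineDeriv`). Since ψ ↦ V is continuous on Schwartz
space, the same formula is tempered as soon as |u|² and |g| grow polynomially in the mean. -/

/-- The inverse variance `1 / (2 ν τ)` of the heat kernel at time `τ`. -/
def invVar (ν τ : ℝ) : ℝ := (2 * ν * τ)⁻¹

lemma invVar_pos {ν τ : ℝ} (hν : 0 < ν) (hτ : 0 < τ) : 0 < invVar ν τ := by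
  unfold invVar; positivity

lemma invVar_anti {ν s τ : ℝ} (hν : 0 < ν) (hs : 0 < s) (h : s ≤ τ) : invVar ν τ ≤ invVar ν s := by
  unfold invVar; gcongr

lemma hasDerivAt_invVar {ν τ : ℝ} (hν : 0 < ν) (hτ : 0 < τ) :
    HasDerivAt (invVar ν) (-2 * ν * invVar ν τ ^ 2) τ := by
  have h := ((hasDerivAt_id τ).const_mul (2 * ν)).inv (by simp; constructor <;> positivity)
  refine HasDerivAt.congr_deriv h ?_
  simp only [id_eq, invVar]
  field_simp

lemma K_eq {ν τ : ℝ} (hν : 0 < ν) (hτ : 0 < τ) (z : E3) :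
    K z (2 * ν * τ) = (2 * Real.pi) ^ (-(3 / 2) : ℝ) * invVar ν τ ^ (3 / 2 : ℝ) *
      Real.exp (-(invVar ν τ * ‖z‖ ^ 2 / 2)) := by
  unfold K invVar
  rw [Real.mul_rpow (by positivity) (by positivity), Real.rpow_neg (x := 2 * ν * τ) (by positivity),
    ← Real.inv_rpow (by positivity)]
  congr 2
  field_simp

lemma K_nonneg (z : E3) {t : ℝ} (ht : 0 ≤ t) : 0 ≤ K z t := by
  unfold K; positivity

lemma K_le {ν τ : ℝ} (hν : 0 < ν) (hτ : 0 < τ) (z : E3) :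
    K z (2 * ν * τ) ≤ (2 * Real.pi) ^ (-(3 / 2) : ℝ) * invVar ν τ ^ (3 / 2 : ℝ) := by
  rw [K_eq hν hτ]
  have := invVar_pos hν hτ
  refine mul_le_of_le_one_right (by positivity) ?_
  rw [Real.exp_le_one_iff]
  have : 0 ≤ invVar ν τ * ‖z‖ ^ 2 / 2 := by positivity
  linarith

/-- This is the heat equation: by `sum_heatD2_single` the right-hand side is ν times the spatial
Laplacian. -/
lemma hasDerivAt_K_time {ν τ : ℝ} (hν : 0 < ν) (hτ : 0 < τ) (z : E3) :
    HasDerivAt (fun τ => K z (2 * ν * τ))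
      (ν * (invVar ν τ ^ 2 * ‖z‖ ^ 2 - 3 * invVar ν τ) * K z (2 * ν * τ)) τ := by
  have hκ := invVar_pos hν hτ
  have h1 := hasDerivAt_invVar hν hτ
  have h2 := (h1.rpow_const (p := 3 / 2) (Or.inl hκ.ne')).const_mul ((2 * Real.pi) ^ (-(3 / 2) : ℝ))
  have h3 := ((h1.mul_const (‖z‖ ^ 2)).div_const 2).neg.exp
  have h4 := h2.mul h3
  refine (h4.congr_deriv ?_).congr_of_eventuallyEq ?_
  · rw [K_eq hν hτ]
    have : invVar ν τ ^ (3 / 2 : ℝ) = invVar ν τ ^ (3 / 2 - 1 : ℝ) * invVar ν τ := by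
      conv_rhs => rw [← Real.rpow_add_one hκ.ne']
      norm_num
    rw [this]
    simp only [Pi.neg_apply]
    ring
  · filter_upwards [lt_mem_nhds hτ] with t ht
    rw [K_eq hν ht]
    rfl

lemma continuous_K_space (t : ℝ) : Continuous fun z : E3 => K z t := by
  unfold K; fun_prop

/-- The n surplus factors are replaced by their value at τ = s, where they are largest. The
remaining factor together with K decays like τ^(-5/2). -/
lemma integrableOn_invVar_pow_mul_K {ν s : ℝ} (hν : 0 < ν) (hs : 0 < s) (n : ℕ) (z : E3) :
    IntegrableOn (fun τ => invVar ν τ ^ (n + 1) * K z (2 * ν * τ)) (Ioi s) := by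
  have h5 : IntegrableOn (fun τ : ℝ => invVar ν s ^ n * (2 * Real.pi) ^ (-(3 / 2) : ℝ) *
      ((2 * ν) ^ (-(5 / 2) : ℝ) * τ ^ (-(5 / 2) : ℝ))) (Ioi s) :=
    ((integrableOn_Ioi_rpow_of_lt (by norm_num) hs).const_mul _).const_mul _
  refine Integrable.mono' h5 ?_ ?_
  · refine (ContinuousOn.aestronglyMeasurable ?_ measurableSet_Ioi)
    intro τ hτ
    have hτ' : 0 < τ := hs.trans hτ
    exact (((hasDerivAt_invVar hν hτ').continuousAt.pow _).mul
      (hasDerivAt_K_time hν hτ' z).continuousAt).continuousWithinAt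
  · refine (ae_restrict_iff' measurableSet_Ioi).2 (Eventually.of_forall fun τ hτ => ?_)
    have hτ' : 0 < τ := hs.trans hτ
    have hκ := invVar_pos hν hτ'
    have hK := K_nonneg z (t := 2 * ν * τ) (by positivity)
    rw [Real.norm_of_nonneg (by positivity)]
    have e : (2 * ν) ^ (-(5 / 2) : ℝ) * τ ^ (-(5 / 2) : ℝ) = invVar ν τ * invVar ν τ ^ (3 / 2 : ℝ) := by
      rw [← Real.mul_rpow (by positivity) (by positivity), Real.rpow_neg (by positivity),
        ← Real.inv_rpow (by positivity), mul_comm (invVar ν τ), ← Real.rpow_add_one hκ.ne']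
      unfold invVar
      norm_num
    rw [e, pow_succ]
    calc invVar ν τ ^ n * invVar ν τ * K z (2 * ν * τ)
        ≤ invVar ν s ^ n * invVar ν τ * ((2 * Real.pi) ^ (-(3 / 2) : ℝ) * invVar ν τ ^ (3 / 2 : ℝ)) := by
          have := invVar_anti hν hs hτ.le
          have := K_le hν hτ' z
          have := invVar_pos hν hs
          gcongr
      _ = _ := by ring

lemma tendsto_invVar_atTop {ν : ℝ} (hν : 0 < ν) : Tendsto (invVar ν) atTop (𝓝 0) :=
  (tendsto_id.const_mul_atTop (by positivity : 0 < 2 * ν)).inv_tendsto_atTop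

lemma tendsto_K_atTop {ν : ℝ} (hν : 0 < ν) (z : E3) :
    Tendsto (fun τ => K z (2 * ν * τ)) atTop (𝓝 0) := by
  have h : Tendsto (fun τ => (2 * Real.pi) ^ (-(3 / 2) : ℝ) * invVar ν τ ^ (3 / 2 : ℝ)) atTop (𝓝 0) := by
    have := ((tendsto_invVar_atTop hν).rpow_const (p := 3 / 2) (Or.inr (by norm_num))).const_mul
      ((2 * Real.pi) ^ (-(3 / 2) : ℝ))
    simpa [Real.zero_rpow (show (3 / 2 : ℝ) ≠ 0 by norm_num)] using this
  refine squeeze_zero' ?_ ?_ h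
  · filter_upwards [eventually_gt_atTop 0] with τ hτ using K_nonneg z (by positivity)
  · filter_upwards [eventually_gt_atTop 0] with τ hτ using K_le hν hτ z

/-- The moments `ν ∫_s^∞ (2ντ)⁻ⁿ K(z, 2ντ) dτ`. -/
def moment (ν : ℝ) (n : ℕ) (z : E3) (s : ℝ) : ℝ :=
  ν * ∫ τ in Ioi s, invVar ν τ ^ n * K z (2 * ν * τ)

lemma moment_nonneg {ν s : ℝ} (hν : 0 < ν) (hs : 0 < s) (n : ℕ) (z : E3) : 0 ≤ moment ν n z s := by
  refine mul_nonneg hν.le (setIntegral_nonneg measurableSet_Ioi fun τ hτ => ?_)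
  have hτ' : 0 < τ := hs.trans hτ
  have := invVar_pos hν hτ'
  have := K_nonneg z (t := 2 * ν * τ) (by positivity)
  positivity

/-- Integrate the time derivative of K over (s, ∞); the boundary term at infinity vanishes. This
recursion and the next one are all that is needed to compare the given kernels with derivatives of
the heat kernel. -/
lemma norm_sq_mul_moment_two {ν s : ℝ} (hν : 0 < ν) (hs : 0 < s) (z : E3) :
    ‖z‖ ^ 2 * moment ν 2 z s = 3 * moment ν 1 z s - K z (2 * ν * s) := by
  have h1 := integrableOn_invVar_pow_mul_K hν hs 0 z
  have h2 := integrableOn_invVar_pow_mul_K hν hs 1 z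
  have h := integral_Ioi_of_hasDerivAt_of_tendsto'
    (fun τ hτ => hasDerivAt_K_time hν (hs.trans_le hτ) z)
    (((h2.const_mul (ν * ‖z‖ ^ 2)).sub (h1.const_mul (ν * 3))).congr
      (Eventually.of_forall fun τ => by simp; ring)) (tendsto_K_atTop hν z)
  have h' : ∫ τ in Ioi s, ν * (invVar ν τ ^ 2 * ‖z‖ ^ 2 - 3 * invVar ν τ) * K z (2 * ν * τ) =
      ν * ‖z‖ ^ 2 * (∫ τ in Ioi s, invVar ν τ ^ 2 * K z (2 * ν * τ)) -
        ν * 3 * ∫ τ in Ioi s, invVar ν τ ^ 1 * K z (2 * ν * τ) := by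
    rw [← integral_const_mul, ← integral_const_mul, ← integral_sub (h2.const_mul _) (h1.const_mul _)]
    congr 1; ext τ; ring
  rw [h'] at h
  unfold moment
  linarith

lemma hasDerivAt_invVar_mul_K {ν τ : ℝ} (hν : 0 < ν) (hτ : 0 < τ) (z : E3) :
    HasDerivAt (fun τ => invVar ν τ * K z (2 * ν * τ))
      (ν * (invVar ν τ ^ 3 * ‖z‖ ^ 2 - 5 * invVar ν τ ^ 2) * K z (2 * ν * τ)) τ := by
  refine ((hasDerivAt_invVar hν hτ).mul (hasDerivAt_K_time hν hτ z)).congr_deriv ?_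
  ring

/-- The same integration, applied to the product of the inverse variance and K. -/
lemma norm_sq_mul_moment_three {ν s : ℝ} (hν : 0 < ν) (hs : 0 < s) (z : E3) :
    ‖z‖ ^ 2 * moment ν 3 z s = 5 * moment ν 2 z s - invVar ν s * K z (2 * ν * s) := by
  have h1 := integrableOn_invVar_pow_mul_K hν hs 1 z
  have h2 := integrableOn_invVar_pow_mul_K hν hs 2 z
  have ht : Tendsto (fun τ => invVar ν τ * K z (2 * ν * τ)) atTop (𝓝 0) := by
    simpa using (tendsto_invVar_atTop hν).mul (tendsto_K_atTop hν z)
  have h := integral_Ioi_of_hasDerivAt_of_tendsto'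
    (fun τ hτ => hasDerivAt_invVar_mul_K hν (hs.trans_le hτ) z)
    (((h2.const_mul (ν * ‖z‖ ^ 2)).sub (h1.const_mul (ν * 5))).congr
      (Eventually.of_forall fun τ => by simp; ring)) ht
  have h' : ∫ τ in Ioi s, ν * (invVar ν τ ^ 3 * ‖z‖ ^ 2 - 5 * invVar ν τ ^ 2) * K z (2 * ν * τ) =
      ν * ‖z‖ ^ 2 * (∫ τ in Ioi s, invVar ν τ ^ 3 * K z (2 * ν * τ)) -
        ν * 5 * ∫ τ in Ioi s, invVar ν τ ^ 2 * K z (2 * ν * τ) := by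
    rw [← integral_const_mul, ← integral_const_mul, ← integral_sub (h2.const_mul _) (h1.const_mul _)]
    congr 1; ext τ; ring
  rw [h'] at h
  unfold moment
  linarith

/-! ### The mass of a ball as a time integral of the heat kernel. -/

lemma volume_real_unit_ball : (volume : Measure E3).real (Metric.ball 0 1) = Real.pi * 4 / 3 := by
  rw [Measure.real, EuclideanSpace.volume_ball_fin_three]
  simp [ENNReal.toReal_ofReal (show 0 ≤ Real.pi * 4 / 3 by positivity)]

lemma ballMass_eq_integral_radius (r t : ℝ) :
    ballMass r t = 4 * Real.pi * ∫ ρ in Ioo 0 r,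
      ρ ^ 2 * ((2 * Real.pi * t) ^ (-(3 / 2) : ℝ) * Real.exp (-ρ ^ 2 / (2 * t))) := by
  have h := integral_fun_norm_addHaar (volume : Measure E3)
    ((Iic r).indicator fun ρ : ℝ => (2 * Real.pi * t) ^ (-(3 / 2) : ℝ) * Real.exp (-ρ ^ 2 / (2 * t)))
  have e : ballMass r t = ∫ y : E3, ((Iic r).indicator fun ρ : ℝ =>
      (2 * Real.pi * t) ^ (-(3 / 2) : ℝ) * Real.exp (-ρ ^ 2 / (2 * t))) ‖y‖ := by
    rw [ballMass, ← integral_indicator Metric.isClosed_closedBall.measurableSet]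
    congr 1; ext y
    by_cases hy : ‖y‖ ≤ r <;> simp [indicator, hy, K]
  rw [e, h, volume_real_unit_ball]
  have hf : Module.finrank ℝ E3 = 3 := by simp [E3]
  rw [hf]
  have e2 : ∫ y in Ioi (0 : ℝ), y ^ (3 - 1) • ((Iic r).indicator fun ρ : ℝ =>
      (2 * Real.pi * t) ^ (-(3 / 2) : ℝ) * Real.exp (-ρ ^ 2 / (2 * t))) y = ∫ ρ in Ioo 0 r,
      ρ ^ 2 * ((2 * Real.pi * t) ^ (-(3 / 2) : ℝ) * Real.exp (-ρ ^ 2 / (2 * t))) := by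
    rw [← integral_Ioc_eq_integral_Ioo, ← Ioi_inter_Iic, ← setIntegral_indicator measurableSet_Iic]
    congr 1; ext y
    by_cases hy : y ≤ r <;> simp [indicator, hy]
  rw [e2]
  simp
  ring

lemma image_scaling {r s : ℝ} (hr : 0 < r) (hs : 0 < s) :
    (fun τ => r * √(s / τ)) '' Ioi s = Ioo 0 r := by
  ext ρ
  constructor
  · rintro ⟨τ, hτ, rfl⟩
    have hτ' : 0 < τ := hs.trans hτ
    refine ⟨by positivity, mul_lt_of_lt_one_right hr ?_⟩
    rw [Real.sqrt_lt' one_pos, one_pow, div_lt_one hτ']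
    exact hτ
  · rintro ⟨h0, h1⟩
    refine ⟨s * r ^ 2 / ρ ^ 2, ?_, ?_⟩
    · rw [mem_Ioi, lt_div_iff₀ (by positivity)]
      gcongr
    · have : s / (s * r ^ 2 / ρ ^ 2) = (ρ / r) ^ 2 := by field_simp
      simp only [this]
      rw [Real.sqrt_sq (by positivity)]
      field_simp

/-- Gaussian scaling: under ρ = |z| √(s/τ) the density at radius ρ and time s becomes, up to a power
of τ, the density at radius |z| and time τ. Radii in (0, |z|) correspond to times in (s, ∞). -/
lemma ballMass_eq_moment {ν s : ℝ} (hν : 0 < ν) (hs : 0 < s) {z : E3} (hz : z ≠ 0) :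
    ballMass ‖z‖ (2 * ν * s) = 4 * Real.pi * ‖z‖ ^ 3 * moment ν 1 z s := by
  have hr : 0 < ‖z‖ := norm_pos_iff.2 hz
  set r := ‖z‖ with hrdef
  have hder : ∀ τ ∈ Ioi s, HasDerivWithinAt (fun τ => r * √(s / τ))
      (-(r * √(s / τ) / (2 * τ))) (Ioi s) τ := by
    intro τ hτ
    have hτ' : 0 < τ := hs.trans hτ
    have h1 : HasDerivAt (fun τ => s / τ) (-(s / τ ^ 2)) τ := by
      have := (hasDerivAt_inv hτ'.ne').const_mul s
      simpa [div_eq_mul_inv] using this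
    have h2 := (h1.sqrt (by positivity)).const_mul r
    refine (h2.congr_deriv ?_).hasDerivWithinAt
    have h3 : √(s / τ) ^ 2 = s / τ := Real.sq_sqrt (by positivity)
    have h4 : 0 < √(s / τ) := by positivity
    rw [neg_div, mul_neg, neg_inj]
    have : s / τ ^ 2 = √(s / τ) ^ 2 / τ := by rw [h3]; field_simp
    rw [this]
    field_simp
  have hinj : InjOn (fun τ => r * √(s / τ)) (Ioi s) := by
    intro a ha b hb hab
    have ha' : 0 < a := hs.trans ha
    have hb' : 0 < b := hs.trans hb
    have h1 : √(s / a) = √(s / b) := mul_left_cancel₀ hr.ne' hab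
    rw [Real.sqrt_inj (by positivity) (by positivity)] at h1
    field_simp at h1
    exact h1.symm
  have hch := integral_image_eq_integral_abs_deriv_smul measurableSet_Ioi hder hinj
    (fun ρ => ρ ^ 2 * ((2 * Real.pi * (2 * ν * s)) ^ (-(3 / 2) : ℝ) *
      Real.exp (-ρ ^ 2 / (2 * (2 * ν * s)))))
  rw [image_scaling hr hs] at hch
  rw [ballMass_eq_integral_radius, hch, moment, mul_assoc (4 * Real.pi), ← integral_const_mul ν,
    ← integral_const_mul (r ^ 3)]
  congr 1
  refine setIntegral_congr_fun measurableSet_Ioi fun τ hτ => ?_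
  have hτ' : 0 < τ := hs.trans hτ
  have h3 : √(s / τ) ^ 2 = s / τ := Real.sq_sqrt (by positivity)
  have h4 : 0 < √(s / τ) := by positivity
  simp only [smul_eq_mul]
  rw [abs_neg, abs_of_pos (by positivity), mul_pow, h3]
  unfold K invVar
  rw [← hrdef]
  have e1 : -(r ^ 2 * (s / τ)) / (2 * (2 * ν * s)) = -r ^ 2 / (2 * (2 * ν * τ)) := by
    field_simp
  have e2 : (2 * Real.pi * (2 * ν * τ)) ^ (-(3 / 2) : ℝ) =
      √(s / τ) ^ 3 * (2 * Real.pi * (2 * ν * s)) ^ (-(3 / 2) : ℝ) := by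
    have : 2 * Real.pi * (2 * ν * τ) = (s / τ)⁻¹ * (2 * Real.pi * (2 * ν * s)) := by
      field_simp
    rw [this, Real.mul_rpow (by positivity) (by positivity)]
    congr 1
    rw [Real.inv_rpow (by positivity), Real.rpow_neg (by positivity), inv_inv, Real.sqrt_eq_rpow,
      ← Real.rpow_natCast, ← Real.rpow_mul (by positivity)]
    norm_num
  rw [e1, e2]
  have : √(s / τ) ^ 3 = √(s / τ) * (s / τ) := by rw [pow_succ', h3]
  rw [this]
  field_simp

/-- Once the ball mass is a moment, the recursion for the second moment removes the negative powers
of |z|. What remains has the shape of K times the identity plus a time-integrated Hessian of the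
heat kernel. -/
lemma forcingTerm_eq {ν s : ℝ} (hν : 0 < ν) (hs : 0 < s) {z : E3} (hz : z ≠ 0) (w : E3) :
    forcingTerm ν z s w =
      (K z (2 * ν * s) - moment ν 1 z s) • w + (moment ν 2 z s * ⟪z, w⟫) • z := by
  have hr : 0 < ‖z‖ := norm_pos_iff.2 hz
  have h2 : moment ν 2 z s = (3 * moment ν 1 z s - K z (2 * ν * s)) / ‖z‖ ^ 2 := by
    rw [← norm_sq_mul_moment_two hν hs]; field_simp
  unfold forcingTerm perp reflThree unitVec
  rw [ballMass_eq_moment hν hs hz, h2, real_inner_smul_left]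
  match_scalars
  · field_simp
  · field_simp
    ring

/-- Both sides reduce to the second moment and K: the recursions express the first and third moments
through these two. -/
lemma nonlinearTerm_eq {ν s : ℝ} (hν : 0 < ν) (hs : 0 < s) {z : E3} (hz : z ≠ 0) (w : E3) :
    nonlinearTerm ν z s w =
      (invVar ν s * ⟪z, w⟫ * K z (2 * ν * s) - 2 * moment ν 2 z s * ⟪z, w⟫) • w +
        (moment ν 3 z s * ⟪z, w⟫ ^ 2 - moment ν 2 z s * ‖w‖ ^ 2) • z := by
  have hr : 0 < ‖z‖ := norm_pos_iff.2 hz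
  have h1 : moment ν 1 z s = (‖z‖ ^ 2 * moment ν 2 z s + K z (2 * ν * s)) / 3 := by
    rw [norm_sq_mul_moment_two hν hs]; ring
  have h3 : moment ν 3 z s = (5 * moment ν 2 z s - invVar ν s * K z (2 * ν * s)) / ‖z‖ ^ 2 := by
    rw [← norm_sq_mul_moment_three hν hs]; field_simp
  unfold nonlinearTerm b₂ b₁ perp reflThree unitVec
  rw [ballMass_eq_moment hν hs hz, h3, h1, inner_sub_right, real_inner_smul_left,
    real_inner_smul_right, real_inner_smul_right, real_inner_self_eq_norm_sq, real_inner_comm w z]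
  unfold invVar
  rw [real_inner_smul_right]
  match_scalars
  · field_simp
    ring
  · field_simp
    ring

/-! ### Pointwise bounds for the kernels -/

/-- The squared parabolic distance `2 ν s + |z|²`. -/
def parDist (ν : ℝ) (z : E3) (s : ℝ) : ℝ := 2 * ν * s + ‖z‖ ^ 2

lemma parDist_pos {ν s : ℝ} (hν : 0 < ν) (hs : 0 < s) (z : E3) : 0 < parDist ν z s := by
  unfold parDist; positivity

lemma norm_sq_le_parDist {ν s : ℝ} (hν : 0 < ν) (hs : 0 < s) (z : E3) :
    ‖z‖ ^ 2 ≤ parDist ν z s := by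
  unfold parDist
  have : 0 < 2 * ν * s := by positivity
  linarith

/-- Fifth power of 1 + X ≤ 10 exp(X/10). The exponent five covers all the powers needed below, the
largest of which is 3 + 3/2. -/
lemma one_add_pow_five_mul_exp_le {X : ℝ} (hX : 0 ≤ X) :
    (1 + X) ^ 5 * Real.exp (-(X / 2)) ≤ 10 ^ 5 := by
  have h1 : 1 + X ≤ 10 * Real.exp (X / 10) := by
    have := Real.add_one_le_exp (X / 10)
    linarith
  have h2 : (1 + X) ^ 5 ≤ 10 ^ 5 * Real.exp (X / 2) := by
    calc (1 + X) ^ 5 ≤ (10 * Real.exp (X / 10)) ^ 5 := by gcongr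
      _ = 10 ^ 5 * Real.exp (X / 2) := by
        rw [mul_pow, ← Real.exp_nat_mul]; congr 2; push_cast; ring
  calc (1 + X) ^ 5 * Real.exp (-(X / 2)) ≤ 10 ^ 5 * Real.exp (X / 2) * Real.exp (-(X / 2)) := by
        gcongr
    _ = 10 ^ 5 := by rw [mul_assoc, ← Real.exp_add]; simp

lemma two_pi_rpow_le_one : (2 * Real.pi) ^ (-(3 / 2) : ℝ) ≤ 1 := by
  refine Real.rpow_le_one_of_one_le_of_nonpos ?_ (by norm_num)
  have := Real.two_le_pi
  linarith

/-- With κ the inverse variance and X = κ|z|², the squared parabolic distance is (1 + X)/κ. Powers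
of κ cancel and the claim becomes boundedness of (1 + X)^(n + 3/2) exp(-X/2), where n ≤ 3 keeps the
exponent below five. -/
lemma invVar_pow_mul_K_le {ν s : ℝ} (hν : 0 < ν) (hs : 0 < s) (z : E3) {n : ℕ} (hn : n ≤ 3) :
    invVar ν s ^ n * K z (2 * ν * s) ≤ 10 ^ 5 * parDist ν z s ^ (-(n + 3 / 2) : ℝ) := by
  have hκ := invVar_pos hν hs
  have hA := parDist_pos hν hs z
  set X := invVar ν s * ‖z‖ ^ 2 with hX
  have hX0 : 0 ≤ X := by positivity
  have hAX : parDist ν z s = (invVar ν s)⁻¹ * (1 + X) := by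
    rw [hX, mul_add, mul_one, ← mul_assoc, inv_mul_cancel₀ hκ.ne', one_mul]
    simp [parDist, invVar]
  rw [K_eq hν hs, hAX, Real.mul_rpow (x := (invVar ν s)⁻¹) (by positivity) (by positivity),
    Real.inv_rpow hκ.le, ← Real.rpow_neg hκ.le, neg_neg]
  have e : invVar ν s ^ n * ((2 * Real.pi) ^ (-(3 / 2) : ℝ) * invVar ν s ^ (3 / 2 : ℝ) *
      Real.exp (-(X / 2))) = (2 * Real.pi) ^ (-(3 / 2) : ℝ) * invVar ν s ^ (n + 3 / 2 : ℝ) *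
        Real.exp (-(X / 2)) := by
    rw [Real.rpow_add hκ, Real.rpow_natCast]; ring
  rw [e]
  have h5 : Real.exp (-(X / 2)) ≤ 10 ^ 5 * (1 + X) ^ (-(n + 3 / 2) : ℝ) := by
    have h := one_add_pow_five_mul_exp_le hX0
    have h1 : (1 + X) ^ (n + 3 / 2 : ℝ) ≤ (1 + X) ^ 5 := by
      rw [← Real.rpow_natCast (1 + X) 5]
      refine Real.rpow_le_rpow_of_exponent_le (by linarith) ?_
      have : (n : ℝ) ≤ 3 := by exact_mod_cast hn
      push_cast
      linarith
    rw [Real.rpow_neg (by positivity), ← div_eq_mul_inv, le_div_iff₀ (by positivity)]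
    calc Real.exp (-(X / 2)) * (1 + X) ^ (n + 3 / 2 : ℝ) ≤ Real.exp (-(X / 2)) * (1 + X) ^ 5 := by
          gcongr
      _ ≤ _ := by rw [mul_comm]; exact h
  calc _ ≤ 1 * invVar ν s ^ (n + 3 / 2 : ℝ) * (10 ^ 5 * (1 + X) ^ (-(n + 3 / 2) : ℝ)) := by
        gcongr
        exact two_pi_rpow_le_one
    _ = _ := by ring

lemma hasDerivAt_parDist_rpow {ν τ : ℝ} (hν : 0 < ν) (hτ : 0 < τ) (z : E3) (p : ℝ) :
    HasDerivAt (fun τ => parDist ν z τ ^ p) (2 * ν * p * parDist ν z τ ^ (p - 1)) τ := by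
  have h1 : HasDerivAt (fun τ => parDist ν z τ) (2 * ν) τ := by
    simpa [parDist] using ((hasDerivAt_id τ).const_mul (2 * ν)).add_const (‖z‖ ^ 2)
  refine (h1.rpow_const (p := p) (Or.inl (parDist_pos hν hτ z).ne')).congr_deriv ?_
  ring

lemma tendsto_parDist_rpow {ν : ℝ} (hν : 0 < ν) (z : E3) {p : ℝ} (hp : 0 < p) :
    Tendsto (fun τ => parDist ν z τ ^ (-p)) atTop (𝓝 0) := by
  refine (tendsto_rpow_neg_atTop hp).comp ?_
  exact tendsto_atTop_add_const_right _ _ (tendsto_id.const_mul_atTop (by positivity))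

lemma integrableOn_parDist_rpow {ν s : ℝ} (hν : 0 < ν) (hs : 0 < s) (z : E3) {p : ℝ} (hp : 0 < p) :
    IntegrableOn (fun τ => parDist ν z τ ^ (-p - 1)) (Ioi s) ∧
      ∫ τ in Ioi s, parDist ν z τ ^ (-p - 1) = (2 * ν * p)⁻¹ * parDist ν z s ^ (-p) := by
  have hd : ∀ τ ∈ Ici s, HasDerivAt (fun τ => -(2 * ν * p)⁻¹ * parDist ν z τ ^ (-p))
      (parDist ν z τ ^ (-p - 1)) τ := fun τ hτ => by
    refine ((hasDerivAt_parDist_rpow hν (hs.trans_le hτ) z (-p)).const_mul _).congr_deriv ?_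
    field_simp
  have ht : Tendsto (fun τ => -(2 * ν * p)⁻¹ * parDist ν z τ ^ (-p)) atTop (𝓝 0) := by
    simpa using (tendsto_parDist_rpow hν z hp).const_mul (-(2 * ν * p)⁻¹)
  have hi := integrableOn_Ioi_deriv_of_nonneg' hd
    (fun τ hτ => Real.rpow_nonneg (parDist_pos hν (hs.trans hτ) z).le _) ht
  refine ⟨hi, ?_⟩
  rw [integral_Ioi_of_hasDerivAt_of_tendsto' hd hi ht]
  ring

/-- Integrating the pointwise bound in τ gains one power of the squared parabolic distance. The
factor 1/(2(n + 3/2)) produced by the integration is at most one and is dropped. -/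
lemma moment_le {ν s : ℝ} (hν : 0 < ν) (hs : 0 < s) (z : E3) {n : ℕ} (hn : n + 1 ≤ 3) :
    moment ν (n + 1) z s ≤ 10 ^ 5 * parDist ν z s ^ (-(n + 3 / 2) : ℝ) := by
  have hA := parDist_pos hν hs z
  obtain ⟨hi, hv⟩ := integrableOn_parDist_rpow hν hs z (p := n + 3 / 2) (by positivity)
  have h1 : ∫ τ in Ioi s, invVar ν τ ^ (n + 1) * K z (2 * ν * τ) ≤
      ∫ τ in Ioi s, 10 ^ 5 * parDist ν z τ ^ (-(n + 3 / 2) - 1 : ℝ) := by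
    refine setIntegral_mono_on (integrableOn_invVar_pow_mul_K hν hs n z) (hi.const_mul _)
      measurableSet_Ioi fun τ hτ => ?_
    refine (invVar_pow_mul_K_le hν (hs.trans hτ) z hn).trans_eq ?_
    congr 2
    push_cast
    ring
  rw [integral_const_mul, hv] at h1
  unfold moment
  calc _ ≤ ν * (10 ^ 5 * ((2 * ν * (n + 3 / 2))⁻¹ * parDist ν z s ^ (-(n + 3 / 2) : ℝ))) := by gcongr
    _ = 10 ^ 5 * parDist ν z s ^ (-(n + 3 / 2) : ℝ) * (2 * (n + 3 / 2) : ℝ)⁻¹ := by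
      field_simp
    _ ≤ _ := by
      refine mul_le_of_le_one_right (by positivity) (inv_le_one_of_one_le₀ ?_)
      have : (0 : ℝ) ≤ n := by positivity
      linarith

/-- The kernel has parabolic degree -3: each factor of z in `forcingTerm_eq` costs at most half a
power of the squared parabolic distance. The constant absorbs three contributions of size 10⁵. -/
lemma norm_forcingTerm_le {ν s : ℝ} (hν : 0 < ν) (hs : 0 < s) {z : E3} (hz : z ≠ 0) (w : E3) :
    ‖forcingTerm ν z s w‖ ≤ 10 ^ 6 * parDist ν z s ^ (-(3 / 2) : ℝ) * ‖w‖ := by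
  have hA := parDist_pos hν hs z
  have hzA := norm_sq_le_parDist hν hs z
  have hK0 := K_nonneg z (t := 2 * ν * s) (by positivity)
  have hK : K z (2 * ν * s) ≤ 10 ^ 5 * parDist ν z s ^ (-(3 / 2) : ℝ) := by
    simpa using invVar_pow_mul_K_le hν hs z (n := 0) (by norm_num)
  have hm1 : moment ν 1 z s ≤ 10 ^ 5 * parDist ν z s ^ (-(3 / 2) : ℝ) := by
    simpa using moment_le hν hs z (n := 0) (by norm_num)
  have hm2 := moment_le hν hs z (n := 1) (by norm_num)
  have h10 := moment_nonneg hν hs 1 z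
  have h20 := moment_nonneg hν hs 2 z
  have hm2' : moment ν 2 z s * ‖z‖ ^ 2 ≤ 10 ^ 5 * parDist ν z s ^ (-(3 / 2) : ℝ) := by
    calc moment ν 2 z s * ‖z‖ ^ 2 ≤ 10 ^ 5 * parDist ν z s ^ (-((1 : ℕ) + 3 / 2) : ℝ) * parDist ν z s := by
          gcongr
      _ = 10 ^ 5 * parDist ν z s ^ (-(3 / 2) : ℝ) := by
          rw [mul_assoc, ← Real.rpow_add_one hA.ne']; norm_num
  rw [forcingTerm_eq hν hs hz]
  have hin := abs_real_inner_le_norm z w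
  calc _ ≤ ‖(K z (2 * ν * s) - moment ν 1 z s) • w‖ + ‖(moment ν 2 z s * ⟪z, w⟫) • z‖ := norm_add_le _ _
    _ ≤ (K z (2 * ν * s) + moment ν 1 z s) * ‖w‖ + moment ν 2 z s * (‖z‖ * ‖w‖) * ‖z‖ := by
      rw [norm_smul, norm_smul, norm_mul, Real.norm_eq_abs, Real.norm_eq_abs, Real.norm_eq_abs,
        abs_of_nonneg h20]
      gcongr
      rw [abs_le]; constructor <;> linarith
    _ = (K z (2 * ν * s) + moment ν 1 z s + moment ν 2 z s * ‖z‖ ^ 2) * ‖w‖ := by ring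
    _ ≤ (10 ^ 6 * parDist ν z s ^ (-(3 / 2) : ℝ)) * ‖w‖ := by
      have : 0 ≤ parDist ν z s ^ (-(3 / 2) : ℝ) := by positivity
      gcongr
      linarith

/-- One degree lower than the forcing kernel, since this kernel is a derivative of it. The constant
absorbs five contributions of size 10⁵. -/
lemma norm_nonlinearTerm_le {ν s : ℝ} (hν : 0 < ν) (hs : 0 < s) {z : E3} (hz : z ≠ 0) (w : E3) :
    ‖nonlinearTerm ν z s w‖ ≤ 10 ^ 6 * (parDist ν z s ^ 2)⁻¹ * ‖w‖ ^ 2 := by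
  have hA := parDist_pos hν hs z
  have hzA : ‖z‖ ≤ parDist ν z s ^ (1 / 2 : ℝ) := by
    rw [← Real.sqrt_eq_rpow]
    exact Real.le_sqrt_of_sq_le (norm_sq_le_parDist hν hs z)
  have hz0 := norm_nonneg z
  have hK0 := K_nonneg z (t := 2 * ν * s) (by positivity)
  have hκ := invVar_pos hν hs
  have hm3 := moment_le hν hs z (n := 2) (by norm_num)
  have hm2 := moment_le hν hs z (n := 1) (by norm_num)
  have hK := invVar_pow_mul_K_le hν hs z (n := 1) (by norm_num)
  have h30 := moment_nonneg hν hs 3 z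
  have h20 := moment_nonneg hν hs 2 z
  set A := parDist ν z s
  have e2 : (A ^ 2)⁻¹ = A ^ (-2 : ℝ) := by
    rw [Real.rpow_neg hA.le]; norm_num
  have e5 : A ^ (-((1 : ℕ) + 3 / 2) : ℝ) * A ^ (1 / 2 : ℝ) = A ^ (-2 : ℝ) := by
    rw [← Real.rpow_add hA]; norm_num
  have e7 : A ^ (-((2 : ℕ) + 3 / 2) : ℝ) * (A ^ (1 / 2 : ℝ)) ^ 3 = A ^ (-2 : ℝ) := by
    rw [← Real.rpow_natCast, ← Real.rpow_mul hA.le, ← Real.rpow_add hA]; norm_num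
  have b1 : invVar ν s ^ 1 * K z (2 * ν * s) * ‖z‖ ≤ 10 ^ 5 * A ^ (-2 : ℝ) := by
    rw [← e5, ← mul_assoc]; gcongr
  have b2 : moment ν 2 z s * ‖z‖ ≤ 10 ^ 5 * A ^ (-2 : ℝ) := by
    rw [← e5, ← mul_assoc]; gcongr
  have b3 : moment ν 3 z s * ‖z‖ ^ 3 ≤ 10 ^ 5 * A ^ (-2 : ℝ) := by
    rw [← e7, ← mul_assoc]; gcongr
  rw [nonlinearTerm_eq hν hs hz, e2]
  have hin := abs_real_inner_le_norm z w
  have hin2 : ⟪z, w⟫ ^ 2 ≤ (‖z‖ * ‖w‖) ^ 2 := by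
    rw [← sq_abs]; gcongr
  calc _ ≤ ‖(invVar ν s * ⟪z, w⟫ * K z (2 * ν * s) - 2 * moment ν 2 z s * ⟪z, w⟫) • w‖ +
        ‖(moment ν 3 z s * ⟪z, w⟫ ^ 2 - moment ν 2 z s * ‖w‖ ^ 2) • z‖ := norm_add_le _ _
    _ ≤ (invVar ν s * K z (2 * ν * s) + 2 * moment ν 2 z s) * (‖z‖ * ‖w‖) * ‖w‖ +
        (moment ν 3 z s * (‖z‖ * ‖w‖) ^ 2 + moment ν 2 z s * ‖w‖ ^ 2) * ‖z‖ := by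
      rw [norm_smul, norm_smul]
      gcongr
      · rw [show invVar ν s * ⟪z, w⟫ * K z (2 * ν * s) - 2 * moment ν 2 z s * ⟪z, w⟫ =
          (invVar ν s * K z (2 * ν * s) - 2 * moment ν 2 z s) * ⟪z, w⟫ by ring, norm_mul,
          Real.norm_eq_abs, Real.norm_eq_abs]
        gcongr
        have : 0 ≤ invVar ν s * K z (2 * ν * s) := by positivity
        rw [abs_le]; constructor <;> linarith
      · rw [Real.norm_eq_abs, abs_le]
        have h1 : moment ν 3 z s * ⟪z, w⟫ ^ 2 ≤ moment ν 3 z s * (‖z‖ * ‖w‖) ^ 2 := by gcongr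
        have h2 : 0 ≤ moment ν 3 z s * ⟪z, w⟫ ^ 2 := by positivity
        have h3 : 0 ≤ moment ν 2 z s * ‖w‖ ^ 2 := by positivity
        constructor <;> linarith
    _ = (invVar ν s ^ 1 * K z (2 * ν * s) * ‖z‖ + 3 * (moment ν 2 z s * ‖z‖) +
        moment ν 3 z s * ‖z‖ ^ 3) * ‖w‖ ^ 2 := by ring
    _ ≤ _ := by
      have : 0 ≤ A ^ (-2 : ℝ) := by positivity
      gcongr
      linarith

/-- Restrict the time integral to the window (|z|²/ν, 2|z|²/ν), which lies beyond s by hypothesis.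
There the inverse variance is between 1/(4|z|²) and 1/(2|z|²), so the Gaussian exponent is at least
-1/4 and every factor is comparable to a power of |z|. -/
lemma moment_ge {ν s : ℝ} (hν : 0 < ν) (hs : 0 < s) {z : E3} (hz : z ≠ 0) (h : ν * s ≤ ‖z‖ ^ 2)
    (n : ℕ) :
    (2 * Real.pi) ^ (-(3 / 2) : ℝ) * Real.exp (-(1 / 4)) * (8 * 4 ^ (n + 1) : ℝ)⁻¹ ≤
      ‖z‖ ^ (2 * (n + 1) + 1) * moment ν (n + 1) z s := by
  have hr : 0 < ‖z‖ := norm_pos_iff.2 hz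
  set r := ‖z‖
  set c := (2 * Real.pi) ^ (-(3 / 2) : ℝ) * Real.exp (-(1 / 4))
  have hc : 0 < c := by positivity
  have hI := integrableOn_invVar_pow_mul_K hν hs n z
  have hsub : Ioo (r ^ 2 / ν) (2 * (r ^ 2 / ν)) ⊆ Ioi s := fun τ hτ => by
    have : s ≤ r ^ 2 / ν := by rw [le_div_iff₀ hν]; linarith
    exact this.trans_lt hτ.1
  have h1 : ∫ τ in Ioo (r ^ 2 / ν) (2 * (r ^ 2 / ν)), c * ((4 * r ^ 2) ^ (n + 1) * (8 * r ^ 3))⁻¹ ≤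
      ∫ τ in Ioi s, invVar ν τ ^ (n + 1) * K z (2 * ν * τ) := by
    refine (setIntegral_mono_on ?_ (hI.mono_set hsub) measurableSet_Ioo ?_).trans
      (setIntegral_mono_set hI ?_ hsub.eventuallyLE)
    · exact integrableOn_const (by simp)
    · intro τ hτ
      have hτ0 : 0 < τ := hs.trans (hsub hτ)
      have hκ := invVar_pos hν hτ0
      have hκ1 : (4 * r ^ 2)⁻¹ ≤ invVar ν τ := by
        unfold invVar
        gcongr ?_⁻¹
        have := hτ.2
        rw [← mul_div_assoc, lt_div_iff₀ hν] at this
        linarith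
      have hκ2 : invVar ν τ * r ^ 2 ≤ 1 / 2 := by
        unfold invVar
        rw [inv_mul_le_iff₀ (by positivity)]
        have := hτ.1
        rw [div_lt_iff₀ hν] at this
        linarith
      have e : (8 * r ^ 3)⁻¹ = ((4 * r ^ 2)⁻¹) ^ (3 / 2 : ℝ) := by
        rw [Real.inv_rpow (by positivity), show 4 * r ^ 2 = (2 * r) ^ (2 : ℝ) by norm_cast; ring,
          ← Real.rpow_mul (by positivity)]
        norm_num
        ring
      rw [K_eq hν hτ0, mul_inv, e, ← inv_pow]
      calc c * (((4 * r ^ 2)⁻¹) ^ (n + 1) * ((4 * r ^ 2)⁻¹) ^ (3 / 2 : ℝ)) =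
          ((4 * r ^ 2)⁻¹) ^ (n + 1) * ((2 * Real.pi) ^ (-(3 / 2) : ℝ) * ((4 * r ^ 2)⁻¹) ^ (3 / 2 : ℝ) *
            Real.exp (-(1 / 4))) := by ring
        _ ≤ invVar ν τ ^ (n + 1) * ((2 * Real.pi) ^ (-(3 / 2) : ℝ) * invVar ν τ ^ (3 / 2 : ℝ) *
            Real.exp (-(invVar ν τ * r ^ 2 / 2))) := by
          have hexp : Real.exp (-(1 / 4)) ≤ Real.exp (-(invVar ν τ * r ^ 2 / 2)) :=
            Real.exp_le_exp.2 (by linarith)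
          gcongr
    · refine (ae_restrict_iff' measurableSet_Ioi).2 (Eventually.of_forall fun τ hτ => ?_)
      have hτ' : 0 < τ := hs.trans hτ
      have := invVar_pos hν hτ'
      have := K_nonneg z (t := 2 * ν * τ) (by positivity)
      simp only [Pi.zero_apply]
      positivity
  rw [setIntegral_const, Measure.real, Real.volume_Ioo, show 2 * (r ^ 2 / ν) - r ^ 2 / ν = r ^ 2 / ν by ring,
    ENNReal.toReal_ofReal (by positivity), smul_eq_mul] at h1
  unfold moment
  calc _ = r ^ (2 * (n + 1) + 1) * (ν * (r ^ 2 / ν * (c * ((4 * r ^ 2) ^ (n + 1) * (8 * r ^ 3))⁻¹))) := by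
        rw [mul_pow, ← pow_mul, pow_succ r (2 * (n + 1))]
        field_simp
    _ ≤ _ := by gcongr

/-- Normalized to the homogeneity of the moments, the Gaussian terms are O(s/|z|²), hence negligible
outside a wide parabola. In terms of X = κ|z|² this is boundedness of X^(n + 5/2) exp(-X/2). -/
lemma pow_mul_K_le {ν s : ℝ} (hν : 0 < ν) (hs : 0 < s) {z : E3} (hz : z ≠ 0) {n : ℕ} (hn : n ≤ 2) :
    ‖z‖ ^ (2 * n + 3) * (invVar ν s ^ n * K z (2 * ν * s)) ≤ 10 ^ 5 * (2 * ν * s / ‖z‖ ^ 2) := by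
  have hr : 0 < ‖z‖ := norm_pos_iff.2 hz
  have hκ := invVar_pos hν hs
  set r := ‖z‖ with hrd
  set X := invVar ν s * r ^ 2 with hX
  have hX0 : 0 < X := by positivity
  have e : r ^ (2 * n + 3) * (invVar ν s ^ n * K z (2 * ν * s)) =
      (2 * Real.pi) ^ (-(3 / 2) : ℝ) * (X ^ (n + 3 / 2 : ℝ) * Real.exp (-(X / 2))) := by
    rw [K_eq hν hs, ← hrd, ← hX]
    have : X ^ (n + 3 / 2 : ℝ) = invVar ν s ^ n * invVar ν s ^ (3 / 2 : ℝ) * r ^ (2 * n + 3) := by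
      rw [hX, Real.mul_rpow hκ.le (by positivity), Real.rpow_add hκ, Real.rpow_natCast,
        ← Real.rpow_natCast r 2, ← Real.rpow_mul hr.le, ← Real.rpow_natCast r (2 * n + 3)]
      congr 2
      push_cast
      ring
    rw [this]; ring
  have h1 : X ^ (n + 3 / 2 : ℝ) * X ≤ (1 + X) ^ 5 := by
    rw [← Real.rpow_add_one hX0.ne', ← Real.rpow_natCast (1 + X) 5]
    refine (Real.rpow_le_rpow hX0.le (by linarith : X ≤ 1 + X) (by positivity)).trans ?_
    refine Real.rpow_le_rpow_of_exponent_le (by linarith) ?_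
    have : (n : ℝ) ≤ 2 := by exact_mod_cast hn
    push_cast
    linarith
  have h2 := one_add_pow_five_mul_exp_le hX0.le
  have e2 : 2 * ν * s / r ^ 2 = X⁻¹ := by rw [hX, invVar]; field_simp
  rw [e, e2, ← div_eq_mul_inv, le_div_iff₀ hX0]
  calc _ = (2 * Real.pi) ^ (-(3 / 2) : ℝ) * (X ^ (n + 3 / 2 : ℝ) * X * Real.exp (-(X / 2))) := by ring
    _ ≤ 1 * ((1 + X) ^ 5 * Real.exp (-(X / 2))) := by
      gcongr
      exact two_pi_rpow_le_one
    _ ≤ _ := by rw [one_mul]; exact h2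

/-- The kernel is K times I - eeᵗ minus the first moment times I - 3eeᵗ. The first matrix does not
increase norms; the second, with eigenvalues 1, 1, -2, does not decrease them. -/
lemma norm_forcingTerm_ge {ν s : ℝ} (hν : 0 < ν) (hs : 0 < s) {z : E3} (hz : z ≠ 0) (w : E3) :
    (moment ν 1 z s - K z (2 * ν * s)) * ‖w‖ ≤ ‖forcingTerm ν z s w‖ := by
  have hr : 0 < ‖z‖ := norm_pos_iff.2 hz
  have hK0 := K_nonneg z (t := 2 * ν * s) (by positivity)
  have h10 := moment_nonneg hν hs 1 z
  have h2 : moment ν 2 z s = (3 * moment ν 1 z s - K z (2 * ν * s)) / ‖z‖ ^ 2 := by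
    rw [← norm_sq_mul_moment_two hν hs]; field_simp
  set c := ⟪z, w⟫ with hc
  have e : forcingTerm ν z s w = K z (2 * ν * s) • (w - (c / ‖z‖ ^ 2) • z) -
      moment ν 1 z s • (w - (3 * c / ‖z‖ ^ 2) • z) := by
    rw [forcingTerm_eq hν hs hz, h2]
    match_scalars
    · ring
    · field_simp
      ring
  have n1 : ‖w - (c / ‖z‖ ^ 2) • z‖ ≤ ‖w‖ := by
    refine abs_le_of_sq_le_sq' ?_ (norm_nonneg w) |>.2
    rw [norm_sub_sq_real, real_inner_smul_right, norm_smul, mul_pow, real_inner_comm, ← hc,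
      Real.norm_eq_abs, sq_abs]
    have : (c / ‖z‖ ^ 2) ^ 2 * ‖z‖ ^ 2 = c ^ 2 / ‖z‖ ^ 2 := by field_simp
    rw [this]
    have h3 : 0 ≤ c ^ 2 / ‖z‖ ^ 2 := by positivity
    have h4 : c / ‖z‖ ^ 2 * c = c ^ 2 / ‖z‖ ^ 2 := by ring
    rw [h4]; linarith
  have n2 : ‖w‖ ≤ ‖w - (3 * c / ‖z‖ ^ 2) • z‖ := by
    refine abs_le_of_sq_le_sq' ?_ (norm_nonneg _) |>.2
    rw [norm_sub_sq_real, real_inner_smul_right, norm_smul, mul_pow, real_inner_comm, ← hc,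
      Real.norm_eq_abs, sq_abs]
    have : (3 * c / ‖z‖ ^ 2) ^ 2 * ‖z‖ ^ 2 = 9 * (c ^ 2 / ‖z‖ ^ 2) := by field_simp; ring
    rw [this]
    have h3 : 0 ≤ c ^ 2 / ‖z‖ ^ 2 := by positivity
    have h4 : 3 * c / ‖z‖ ^ 2 * c = 3 * (c ^ 2 / ‖z‖ ^ 2) := by ring
    rw [h4]; linarith
  rw [e, norm_sub_rev]
  refine le_trans ?_ (norm_sub_norm_le _ _)
  rw [norm_smul, norm_smul, Real.norm_of_nonneg hK0, Real.norm_of_nonneg h10]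
  nlinarith [mul_le_mul_of_nonneg_left n1 hK0, mul_le_mul_of_nonneg_left n2 h10]

/-- With c = z·w, the kernel is a Gaussian multiple of c w - (c²/|z|²) z minus the second moment
times 2c w + (|w|² - 5c²/|z|²) z. The first vector has length at most |z||w|², the second at least
half of that, whatever the angle between z and w. -/
lemma norm_nonlinearTerm_ge {ν s : ℝ} (hν : 0 < ν) (hs : 0 < s) {z : E3} (hz : z ≠ 0) (w : E3) :
    (moment ν 2 z s / 2 - invVar ν s * K z (2 * ν * s)) * ‖z‖ * ‖w‖ ^ 2 ≤
      ‖nonlinearTerm ν z s w‖ := by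
  have hr : 0 < ‖z‖ := norm_pos_iff.2 hz
  have hK0 : 0 ≤ invVar ν s * K z (2 * ν * s) :=
    mul_nonneg (invVar_pos hν hs).le (K_nonneg z (by positivity))
  have h20 := moment_nonneg hν hs 2 z
  have h3 : moment ν 3 z s = (5 * moment ν 2 z s - invVar ν s * K z (2 * ν * s)) / ‖z‖ ^ 2 := by
    rw [← norm_sq_mul_moment_three hν hs]; field_simp
  set c := ⟪z, w⟫ with hc
  have hcb : |c| ≤ ‖z‖ * ‖w‖ := abs_real_inner_le_norm z w
  have e : nonlinearTerm ν z s w = (invVar ν s * K z (2 * ν * s)) • (c • w - (c ^ 2 / ‖z‖ ^ 2) • z) -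
      moment ν 2 z s • ((2 * c) • w + (‖w‖ ^ 2 - 5 * c ^ 2 / ‖z‖ ^ 2) • z) := by
    rw [nonlinearTerm_eq hν hs hz, h3]
    match_scalars
    · ring
    · field_simp
      ring
  have n1 : ‖c • w - (c ^ 2 / ‖z‖ ^ 2) • z‖ ≤ ‖z‖ * ‖w‖ ^ 2 := by
    refine abs_le_of_sq_le_sq' ?_ (by positivity) |>.2
    rw [norm_sub_sq_real, real_inner_smul_right, real_inner_smul_left, norm_smul, norm_smul, mul_pow,
      mul_pow, real_inner_comm, ← hc, Real.norm_eq_abs, sq_abs, Real.norm_eq_abs, sq_abs]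
    have : (c ^ 2 / ‖z‖ ^ 2) ^ 2 * ‖z‖ ^ 2 = c ^ 4 / ‖z‖ ^ 2 := by field_simp
    rw [this]
    have h3 : 0 ≤ c ^ 4 / ‖z‖ ^ 2 := by positivity
    have h4 : c ^ 2 / ‖z‖ ^ 2 * (c * c) = c ^ 4 / ‖z‖ ^ 2 := by ring
    have h5 : c ^ 2 ≤ (‖z‖ * ‖w‖) ^ 2 := by rw [← sq_abs]; gcongr
    have h6 : c ^ 2 * ‖w‖ ^ 2 ≤ (‖z‖ * ‖w‖) ^ 2 * ‖w‖ ^ 2 := by gcongr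
    rw [h4]
    linarith
  have n2 : ‖z‖ * ‖w‖ ^ 2 / 2 ≤ ‖(2 * c) • w + (‖w‖ ^ 2 - 5 * c ^ 2 / ‖z‖ ^ 2) • z‖ := by
    refine abs_le_of_sq_le_sq' ?_ (norm_nonneg _) |>.2
    rw [norm_add_sq_real, real_inner_smul_right, real_inner_smul_left, norm_smul, norm_smul, mul_pow,
      mul_pow, real_inner_comm, ← hc, Real.norm_eq_abs, sq_abs, Real.norm_eq_abs, sq_abs]
    have : (2 * c) ^ 2 * ‖w‖ ^ 2 + 2 * ((‖w‖ ^ 2 - 5 * c ^ 2 / ‖z‖ ^ 2) * (2 * c * c)) +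
        (‖w‖ ^ 2 - 5 * c ^ 2 / ‖z‖ ^ 2) ^ 2 * ‖z‖ ^ 2 =
        (‖z‖ * ‖w‖ ^ 2) ^ 2 - 2 * (c ^ 2 / ‖z‖) * (‖z‖ * ‖w‖ ^ 2) + 5 * (c ^ 2 / ‖z‖) ^ 2 := by
      field_simp
      ring
    rw [this]
    -- With A = |z||w|² and B = c²/|z|: A² - 2AB + 5B² = (5B - A)²/5 + 4A²/5 ≥ A²/4.
    nlinarith [sq_nonneg (5 * (c ^ 2 / ‖z‖) - ‖z‖ * ‖w‖ ^ 2), sq_nonneg (‖z‖ * ‖w‖ ^ 2)]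
  rw [e, norm_sub_rev]
  refine le_trans ?_ (norm_sub_norm_le _ _)
  rw [norm_smul, norm_smul, Real.norm_of_nonneg hK0, Real.norm_of_nonneg h20]
  nlinarith [mul_le_mul_of_nonneg_left n1 hK0, mul_le_mul_of_nonneg_left n2 h20]

/-- Outside a parabola the kernels are bounded below by their values at time zero. -/
lemma exists_kernel_lower_bound {ν : ℝ} (hν : 0 < ν) :
    ∃ C₀ > 0, ∃ c > 0, ∀ (z : E3) (s : ℝ) (w : E3), z ≠ 0 → 0 < s → C₀ * s ≤ ‖z‖ ^ 2 →
      c * ‖w‖ ^ 2 / ‖z‖ ^ 4 ≤ ‖nonlinearTerm ν z s w‖ ∧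
      c * ‖w‖ / ‖z‖ ^ 3 ≤ ‖forcingTerm ν z s w‖ := by
  set c := (2 * Real.pi) ^ (-(3 / 2) : ℝ) * Real.exp (-(1 / 4)) * (8 * 4 ^ 2 : ℝ)⁻¹ with hc
  have hc0 : 0 < c := by positivity
  -- Here c is the constant of `moment_ge` for the second moment, the smaller of the two in play.
  -- The summand ν in C₀ makes `moment_ge` applicable; the other pushes the Gaussian terms below
  -- c/4. Since at least c/2 comes from the moments, c/4 is left in both cases.
  refine ⟨ν + 10 ^ 5 * (2 * ν) / (c / 4), by positivity, c / 4, by positivity,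
    fun z s w hz hs h => ?_⟩
  have hr : 0 < ‖z‖ := norm_pos_iff.2 hz
  have hA : 0 ≤ 10 ^ 5 * (2 * ν) / (c / 4) * s := by positivity
  have hνs : 0 < ν * s := by positivity
  have h' : ν * s + 10 ^ 5 * (2 * ν) / (c / 4) * s ≤ ‖z‖ ^ 2 := by linarith
  have h1 : ν * s ≤ ‖z‖ ^ 2 := by linarith
  have h2 : 10 ^ 5 * (2 * ν * s / ‖z‖ ^ 2) ≤ c / 4 := by
    have : 10 ^ 5 * (2 * ν) / (c / 4) * s ≤ ‖z‖ ^ 2 := by linarith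
    rw [div_mul_eq_mul_div, div_le_iff₀ (by positivity)] at this
    rw [← mul_div_assoc, div_le_iff₀ (by positivity)]
    linarith
  constructor
  · have m2 := moment_ge hν hs hz h1 1
    have k1 := (pow_mul_K_le hν hs hz (n := 1) (by norm_num)).trans h2
    refine le_trans ?_ (norm_nonlinearTerm_ge hν hs hz w)
    rw [div_le_iff₀ (by positivity)]
    have : c / 4 ≤ ‖z‖ ^ 5 * (moment ν 2 z s / 2 - invVar ν s * K z (2 * ν * s)) := by
      simp only [Nat.reduceAdd, Nat.reduceMul, pow_one] at m2 k1
      rw [← hc] at m2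
      linarith
    calc c / 4 * ‖w‖ ^ 2 ≤ ‖z‖ ^ 5 * (moment ν 2 z s / 2 - invVar ν s * K z (2 * ν * s)) * ‖w‖ ^ 2 := by
          gcongr
      _ = _ := by ring
  · have m1 := moment_ge hν hs hz h1 0
    have k1 := (pow_mul_K_le hν hs hz (n := 0) (by norm_num)).trans h2
    refine le_trans ?_ (norm_forcingTerm_ge hν hs hz w)
    rw [div_le_iff₀ (by positivity)]
    have : c / 4 ≤ ‖z‖ ^ 3 * (moment ν 1 z s - K z (2 * ν * s)) := by
      simp only [Nat.reduceAdd, Nat.reduceMul, pow_one, pow_zero, one_mul] at m1 k1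
      have : c ≤ (2 * Real.pi) ^ (-(3 / 2) : ℝ) * Real.exp (-(1 / 4)) * (8 * 4 : ℝ)⁻¹ := by
        rw [hc]; gcongr; norm_num
      norm_num at m1 this
      linarith
    calc c / 4 * ‖w‖ ≤ ‖z‖ ^ 3 * (moment ν 1 z s - K z (2 * ν * s)) * ‖w‖ := by gcongr
      _ = _ := by ring

section

/-! ### Spatial derivatives of the heat kernel -/

/-- First derivative of the heat kernel in direction `w`. -/
def heatD1 (ν : ℝ) (w z : E3) (τ : ℝ) : ℝ := -(invVar ν τ * ⟪z, w⟫) * K z (2 * ν * τ)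

/-- Second derivative of the heat kernel in directions `w`, `v`. -/
def heatD2 (ν : ℝ) (w v z : E3) (τ : ℝ) : ℝ :=
  (invVar ν τ ^ 2 * ⟪z, w⟫ * ⟪z, v⟫ - invVar ν τ * ⟪w, v⟫) * K z (2 * ν * τ)

/-- Third derivative of the heat kernel in directions `w`, `v`, `u`. -/
def heatD3 (ν : ℝ) (w v u z : E3) (τ : ℝ) : ℝ :=
  (-(invVar ν τ ^ 3 * ⟪z, w⟫ * ⟪z, v⟫ * ⟪z, u⟫) +
    invVar ν τ ^ 2 * (⟪w, v⟫ * ⟪z, u⟫ + ⟪w, u⟫ * ⟪z, v⟫ + ⟪v, u⟫ * ⟪z, w⟫)) * K z (2 * ν * τ)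

lemma hasDerivAt_inner_line (z v w : E3) : HasDerivAt (fun t : ℝ => ⟪z + t • v, w⟫) ⟪v, w⟫ 0 := by
  have : (fun t : ℝ => ⟪z + t • v, w⟫) = fun t => ⟪z, w⟫ + t * ⟪v, w⟫ := by
    ext t; rw [inner_add_left, real_inner_smul_left]
  rw [this]
  simpa using ((hasDerivAt_id (0 : ℝ)).mul_const ⟪v, w⟫).const_add ⟪z, w⟫

lemma hasLineDerivAt_K {ν τ : ℝ} (z v : E3) :
    HasLineDerivAt ℝ (fun z => K z (2 * ν * τ)) (heatD1 ν v z τ) z v := by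
  have h1 : HasDerivAt (fun t : ℝ => ‖z + t • v‖ ^ 2) (2 * ⟪z, v⟫) 0 := by
    have : (fun t : ℝ => ‖z + t • v‖ ^ 2) = fun t => ‖z‖ ^ 2 + t * (2 * ⟪z, v⟫) + t ^ 2 * ‖v‖ ^ 2 := by
      ext t
      rw [norm_add_sq_real, real_inner_smul_right, norm_smul, mul_pow, Real.norm_eq_abs, sq_abs]
      ring
    rw [this]
    have h := (((hasDerivAt_id (0 : ℝ)).mul_const (2 * ⟪z, v⟫)).const_add (‖z‖ ^ 2)).add
      (((hasDerivAt_id (0 : ℝ)).pow 2).mul_const (‖v‖ ^ 2))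
    exact h.congr_deriv (by simp)
  have h2 := ((h1.neg.div_const (2 * (2 * ν * τ))).exp.const_mul
    ((2 * Real.pi * (2 * ν * τ)) ^ (-(3 / 2) : ℝ)))
  refine HasDerivAt.congr_deriv h2 ?_
  unfold heatD1 K invVar
  simp
  field_simp

lemma hasLineDerivAt_heatD1 {ν τ : ℝ} (w z v : E3) :
    HasLineDerivAt ℝ (fun z => heatD1 ν w z τ) (heatD2 ν w v z τ) z v := by
  have h := (((hasDerivAt_inner_line z v w).const_mul (invVar ν τ)).neg).mul
    (hasLineDerivAt_K (ν := ν) (τ := τ) z v)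
  refine HasDerivAt.congr_deriv h ?_
  unfold heatD2 heatD1
  simp only [zero_smul, add_zero, Pi.neg_apply]
  rw [real_inner_comm v w]
  ring

lemma hasLineDerivAt_heatD2 {ν τ : ℝ} (w v z u : E3) :
    HasLineDerivAt ℝ (fun z => heatD2 ν w v z τ) (heatD3 ν w v u z τ) z u := by
  have h := ((((hasDerivAt_inner_line z u w).const_mul (invVar ν τ ^ 2)).mul
    (hasDerivAt_inner_line z u v)).sub_const (invVar ν τ * ⟪w, v⟫)).mul
    (hasLineDerivAt_K (ν := ν) (τ := τ) z u)
  refine HasDerivAt.congr_deriv h ?_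
  unfold heatD3 heatD1
  simp only [zero_smul, add_zero, Pi.mul_apply]
  rw [real_inner_comm u w, real_inner_comm u v]
  ring

lemma continuousOn_invVar {ν : ℝ} (hν : 0 < ν) :
    ContinuousOn (fun p : E3 × ℝ => invVar ν p.2) (univ ×ˢ Ioi 0) := by
  unfold invVar
  refine ContinuousOn.inv₀ (by fun_prop) ?_
  rintro ⟨z, τ⟩ ⟨-, hτ⟩
  have : 0 < τ := hτ
  positivity

lemma continuousOn_K {ν : ℝ} (hν : 0 < ν) :
    ContinuousOn (fun p : E3 × ℝ => K p.1 (2 * ν * p.2)) (univ ×ˢ Ioi 0) := by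
  unfold K
  refine ContinuousOn.mul ?_ ?_
  · refine ContinuousOn.rpow_const (by fun_prop) ?_
    rintro ⟨z, τ⟩ ⟨-, hτ⟩
    have : 0 < τ := hτ
    left; positivity
  · refine Real.continuous_exp.comp_continuousOn (ContinuousOn.div (by fun_prop) (by fun_prop) ?_)
    rintro ⟨z, τ⟩ ⟨-, hτ⟩
    have : 0 < τ := hτ
    positivity

lemma continuousOn_heatD2 {ν : ℝ} (hν : 0 < ν) (w v : E3) :
    ContinuousOn (fun p : E3 × ℝ => heatD2 ν w v p.1 p.2) (univ ×ˢ Ioi 0) := by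
  have h1 := continuousOn_invVar hν
  have h2 := continuousOn_K hν
  unfold heatD2
  fun_prop

lemma continuousOn_heatD3 {ν : ℝ} (hν : 0 < ν) (w v u : E3) :
    ContinuousOn (fun p : E3 × ℝ => heatD3 ν w v u p.1 p.2) (univ ×ˢ Ioi 0) := by
  have h1 := continuousOn_invVar hν
  have h2 := continuousOn_K hν
  unfold heatD3
  fun_prop

lemma continuous_heatD1 (ν : ℝ) (w : E3) (τ : ℝ) : Continuous fun z => heatD1 ν w z τ := by
  have := continuous_K_space (2 * ν * τ)
  unfold heatD1; fun_prop

lemma continuous_heatD2 (ν : ℝ) (w v : E3) (τ : ℝ) : Continuous fun z => heatD2 ν w v z τ := by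
  have := continuous_K_space (2 * ν * τ)
  unfold heatD2; fun_prop

lemma continuous_heatD3 (ν : ℝ) (w v u : E3) (τ : ℝ) : Continuous fun z => heatD3 ν w v u z τ := by
  have := continuous_K_space (2 * ν * τ)
  unfold heatD3; fun_prop

/-- Uniform in z: the dependence on space is given up for the decay τ^(-5/2), which makes time
integrals over (s, ∞) converge after testing against a compactly supported function. -/
lemma abs_heatD2_le {ν τ : ℝ} (hν : 0 < ν) (hτ : 0 < τ) (w v z : E3) :
    |heatD2 ν w v z τ| ≤ 10 ^ 6 * (2 * ν) ^ (-(5 / 2) : ℝ) * ‖w‖ * ‖v‖ * τ ^ (-(5 / 2) : ℝ) := by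
  have hA := parDist_pos hν hτ z
  have hzA := norm_sq_le_parDist hν hτ z
  have hK0 := K_nonneg z (t := 2 * ν * τ) (by positivity)
  have hκ := invVar_pos hν hτ
  have k1 := invVar_pow_mul_K_le hν hτ z (n := 1) (by norm_num)
  have k2 := invVar_pow_mul_K_le hν hτ z (n := 2) (by norm_num)
  set A := parDist ν z τ with hAd
  have e1 : A ^ (-((1 : ℕ) + 3 / 2) : ℝ) = A ^ (-(5 / 2) : ℝ) := by norm_num
  have e2 : A ^ (-((2 : ℕ) + 3 / 2) : ℝ) * A = A ^ (-(5 / 2) : ℝ) := by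
    rw [← Real.rpow_add_one hA.ne']; norm_num
  have hle : A ^ (-(5 / 2) : ℝ) ≤ (2 * ν) ^ (-(5 / 2) : ℝ) * τ ^ (-(5 / 2) : ℝ) := by
    rw [← Real.mul_rpow (by positivity) (by positivity)]
    refine Real.rpow_le_rpow_of_nonpos (by positivity) ?_ (by norm_num)
    rw [hAd, parDist]; nlinarith [sq_nonneg ‖z‖]
  have k3 : invVar ν τ ^ 2 * K z (2 * ν * τ) * ‖z‖ ^ 2 ≤ 10 ^ 5 * A ^ (-(5 / 2) : ℝ) := by
    rw [← e2, ← mul_assoc]; gcongr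
  rw [e1, pow_one] at k1
  have i1 := abs_real_inner_le_norm z w
  have i2 := abs_real_inner_le_norm z v
  have i3 := abs_real_inner_le_norm w v
  calc |heatD2 ν w v z τ| ≤ (invVar ν τ ^ 2 * (‖z‖ * ‖w‖) * (‖z‖ * ‖v‖) + invVar ν τ * (‖w‖ * ‖v‖)) *
        K z (2 * ν * τ) := by
        unfold heatD2
        rw [abs_mul, abs_of_nonneg hK0]
        gcongr
        refine (abs_sub _ _).trans ?_
        rw [abs_mul, abs_mul, abs_mul, abs_of_nonneg (by positivity : 0 ≤ invVar ν τ ^ 2),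
          abs_of_pos hκ]
        gcongr
    _ = (invVar ν τ ^ 2 * K z (2 * ν * τ) * ‖z‖ ^ 2 + invVar ν τ * K z (2 * ν * τ)) * (‖w‖ * ‖v‖) := by
        ring
    _ ≤ (10 ^ 6 * A ^ (-(5 / 2) : ℝ)) * (‖w‖ * ‖v‖) := by
        have : 0 ≤ A ^ (-(5 / 2) : ℝ) := by positivity
        gcongr
        linarith
    _ ≤ (10 ^ 6 * ((2 * ν) ^ (-(5 / 2) : ℝ) * τ ^ (-(5 / 2) : ℝ))) * (‖w‖ * ‖v‖) := by gcongr
    _ = _ := by ring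

lemma abs_heatD3_le {ν τ : ℝ} (hν : 0 < ν) (hτ : 0 < τ) (w v u z : E3) :
    |heatD3 ν w v u z τ| ≤
      10 ^ 6 * (2 * ν) ^ (-3 : ℝ) * ‖w‖ * ‖v‖ * ‖u‖ * τ ^ (-3 : ℝ) := by
  have hA := parDist_pos hν hτ z
  have hzA : ‖z‖ ≤ parDist ν z τ ^ (1 / 2 : ℝ) := by
    rw [← Real.sqrt_eq_rpow]
    exact Real.le_sqrt_of_sq_le (norm_sq_le_parDist hν hτ z)
  have hK0 := K_nonneg z (t := 2 * ν * τ) (by positivity)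
  have hκ := invVar_pos hν hτ
  have k2 := invVar_pow_mul_K_le hν hτ z (n := 2) (by norm_num)
  have k3 := invVar_pow_mul_K_le hν hτ z (n := 3) (by norm_num)
  set A := parDist ν z τ with hAd
  have e1 : A ^ (-((2 : ℕ) + 3 / 2) : ℝ) * A ^ (1 / 2 : ℝ) = A ^ (-3 : ℝ) := by
    rw [← Real.rpow_add hA]; norm_num
  have e2 : A ^ (-((3 : ℕ) + 3 / 2) : ℝ) * (A ^ (1 / 2 : ℝ)) ^ 3 = A ^ (-3 : ℝ) := by
    rw [← Real.rpow_natCast, ← Real.rpow_mul hA.le, ← Real.rpow_add hA]; norm_num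
  have hle : A ^ (-3 : ℝ) ≤ (2 * ν) ^ (-3 : ℝ) * τ ^ (-3 : ℝ) := by
    rw [← Real.mul_rpow (by positivity) (by positivity)]
    refine Real.rpow_le_rpow_of_nonpos (by positivity) ?_ (by norm_num)
    rw [hAd, parDist]; nlinarith [sq_nonneg ‖z‖]
  have b2 : invVar ν τ ^ 2 * K z (2 * ν * τ) * ‖z‖ ≤ 10 ^ 5 * A ^ (-3 : ℝ) := by
    rw [← e1, ← mul_assoc]; gcongr
  have b3 : invVar ν τ ^ 3 * K z (2 * ν * τ) * ‖z‖ ^ 3 ≤ 10 ^ 5 * A ^ (-3 : ℝ) := by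
    rw [← e2, ← mul_assoc]; gcongr
  have i1 := abs_real_inner_le_norm z w
  have i2 := abs_real_inner_le_norm z v
  have i3 := abs_real_inner_le_norm z u
  have j1 := abs_real_inner_le_norm w v
  have j2 := abs_real_inner_le_norm w u
  have j3 := abs_real_inner_le_norm v u
  calc |heatD3 ν w v u z τ| ≤ (invVar ν τ ^ 3 * (‖z‖ * ‖w‖) * (‖z‖ * ‖v‖) * (‖z‖ * ‖u‖) +
        invVar ν τ ^ 2 * ((‖w‖ * ‖v‖) * (‖z‖ * ‖u‖) + (‖w‖ * ‖u‖) * (‖z‖ * ‖v‖) +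
          (‖v‖ * ‖u‖) * (‖z‖ * ‖w‖))) * K z (2 * ν * τ) := by
        unfold heatD3
        rw [abs_mul, abs_of_nonneg hK0]
        gcongr
        refine (abs_add_le _ _).trans ?_
        rw [abs_neg, abs_mul, abs_mul, abs_mul, abs_mul,
          abs_of_nonneg (by positivity : 0 ≤ invVar ν τ ^ 2),
          abs_of_nonneg (by positivity : 0 ≤ invVar ν τ ^ 3)]
        gcongr
        refine (abs_add_three _ _ _).trans ?_
        rw [abs_mul, abs_mul, abs_mul]
        gcongr
    _ = (invVar ν τ ^ 3 * K z (2 * ν * τ) * ‖z‖ ^ 3 +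
        3 * (invVar ν τ ^ 2 * K z (2 * ν * τ) * ‖z‖)) * (‖w‖ * ‖v‖ * ‖u‖) := by
        ring
    _ ≤ (10 ^ 6 * A ^ (-3 : ℝ)) * (‖w‖ * ‖v‖ * ‖u‖) := by
        have : 0 ≤ A ^ (-3 : ℝ) := by positivity
        gcongr
        linarith
    _ ≤ (10 ^ 6 * ((2 * ν) ^ (-3 : ℝ) * τ ^ (-3 : ℝ))) * (‖w‖ * ‖v‖ * ‖u‖) := by gcongr
    _ = _ := by ring

/-- On the Fourier side the projection onto divergence-free fields is the identity plus the Hessian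
of the inverse of -Δ. Applied to the heat kernel at time s, that inverse is ν times the integral of
the heat kernel over later times. -/
lemma inner_forcingTerm_eq {ν s : ℝ} (hν : 0 < ν) (hs : 0 < s) {z : E3} (hz : z ≠ 0) (w v : E3) :
    ⟪forcingTerm ν z s w, v⟫ =
      K z (2 * ν * s) * ⟪w, v⟫ + ν * ∫ τ in Ioi s, heatD2 ν w v z τ := by
  have h1 := integrableOn_invVar_pow_mul_K hν hs 0 z
  have h2 := integrableOn_invVar_pow_mul_K hν hs 1 z
  have e : ∫ τ in Ioi s, heatD2 ν w v z τ =
      (⟪z, w⟫ * ⟪z, v⟫) * (∫ τ in Ioi s, invVar ν τ ^ 2 * K z (2 * ν * τ)) -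
        ⟪w, v⟫ * ∫ τ in Ioi s, invVar ν τ ^ 1 * K z (2 * ν * τ) := by
    rw [← integral_const_mul, ← integral_const_mul, ← integral_sub (h2.const_mul _) (h1.const_mul _)]
    congr 1; ext τ; unfold heatD2; ring
  rw [e, forcingTerm_eq hν hs hz, inner_add_left, real_inner_smul_left, real_inner_smul_left]
  unfold moment
  ring

/-- This is minus the derivative in the direction w of the formula in `inner_forcingTerm_eq`; both
follow by comparing moments. -/
lemma inner_nonlinearTerm_eq {ν s : ℝ} (hν : 0 < ν) (hs : 0 < s) {z : E3} (hz : z ≠ 0) (w v : E3) :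
    ⟪nonlinearTerm ν z s w, v⟫ =
      -(heatD1 ν w z s * ⟪w, v⟫) - ν * ∫ τ in Ioi s, heatD3 ν w v w z τ := by
  have h1 := integrableOn_invVar_pow_mul_K hν hs 1 z
  have h2 := integrableOn_invVar_pow_mul_K hν hs 2 z
  have e : ∫ τ in Ioi s, heatD3 ν w v w z τ =
      (2 * ⟪w, v⟫ * ⟪z, w⟫ + ‖w‖ ^ 2 * ⟪z, v⟫) * (∫ τ in Ioi s, invVar ν τ ^ 2 * K z (2 * ν * τ)) -
        (⟪z, w⟫ ^ 2 * ⟪z, v⟫) * ∫ τ in Ioi s, invVar ν τ ^ 3 * K z (2 * ν * τ) := by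
    rw [← integral_const_mul, ← integral_const_mul, ← integral_sub (h1.const_mul _) (h2.const_mul _)]
    congr 1; ext τ; unfold heatD3
    rw [real_inner_self_eq_norm_sq, real_inner_comm w v]; ring
  rw [e, nonlinearTerm_eq hν hs hz, inner_add_left, real_inner_smul_left, real_inner_smul_left]
  unfold moment heatD1
  ring

/-! ### Pairing the kernels with test functions of the space variable -/

lemma integral_mul_lineDeriv_kernel {f k k' : E3 → ℝ} {v : E3} (hf : ContDiff ℝ 1 f)
    (hfc : HasCompactSupport f) (hk : Continuous k) (hk' : Continuous k')
    (h : ∀ z, HasLineDerivAt ℝ k (k' z) z v) (x' : E3) :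
    ∫ x, f x * k' (x - x') = -∫ x, fderiv ℝ f x v * k (x - x') := by
  have hdf : Continuous fun x => fderiv ℝ f x v :=
    (hf.continuous_fderiv (by norm_num)).clm_apply continuous_const
  have hdfc : HasCompactSupport fun x => fderiv ℝ f x v := hfc.fderiv_apply ℝ v
  have c1 : Continuous fun x => k (x - x') := hk.comp (by fun_prop)
  have c2 : Continuous fun x => k' (x - x') := hk'.comp (by fun_prop)
  refine integral_bilinear_hasLineDerivAt_right_eq_neg_left_of_integrable (v := v)
    (B := ContinuousLinearMap.mul ℝ ℝ) (f := f) (f' := fun x => fderiv ℝ f x v)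
    (g := fun x => k (x - x')) (g' := fun x => k' (x - x')) ?_ ?_ ?_ ?_ ?_
  · exact (hdf.mul c1).integrable_of_hasCompactSupport hdfc.mul_right
  · exact (hf.continuous.mul c2).integrable_of_hasCompactSupport hfc.mul_right
  · exact (hf.continuous.mul c1).integrable_of_hasCompactSupport hfc.mul_right
  · intro x _
    exact ((hf.differentiable (by norm_num)) x).hasFDerivAt.hasLineDerivAt v
  · intro x _
    have := h (x - x')
    unfold HasLineDerivAt at this ⊢
    simp_rw [add_sub_right_comm]
    exact this

lemma integrable_mul_kernel_prod {f : E3 → ℝ} (hf : Continuous f) (hfc : HasCompactSupport f)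
    {Q : E3 → ℝ → ℝ} (hQ : ContinuousOn (fun p : E3 × ℝ => Q p.1 p.2) (univ ×ˢ Ioi 0)) {C p s : ℝ}
    (hp : p < -1) (hs : 0 < s) (hb : ∀ z τ, 0 < τ → |Q z τ| ≤ C * τ ^ p) (x' : E3) :
    Integrable (fun q : E3 × ℝ => f q.1 * Q (q.1 - x') q.2)
      (volume.prod (volume.restrict (Ioi s))) := by
  have h1 : Integrable (fun q : E3 × ℝ => ‖f q.1‖ * (C * q.2 ^ p))
      (volume.prod (volume.restrict (Ioi s))) :=
    (hf.integrable_of_hasCompactSupport hfc).norm.mul_prod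
      ((integrableOn_Ioi_rpow_of_lt hp hs).const_mul C)
  have e : (volume : Measure E3).prod (volume.restrict (Ioi s)) =
      ((volume : Measure E3).prod volume).restrict (univ ×ˢ Ioi s) := by
    rw [← Measure.prod_restrict, Measure.restrict_univ]
  refine h1.mono' ?_ ?_
  · rw [e]
    refine ContinuousOn.aestronglyMeasurable ?_ (MeasurableSet.univ.prod measurableSet_Ioi)
    refine ContinuousOn.mul (by fun_prop) ?_
    refine hQ.comp (f := fun q : E3 × ℝ => (q.1 - x', q.2)) (by fun_prop) ?_
    rintro ⟨x, τ⟩ ⟨-, hτ⟩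
    exact ⟨mem_univ _, hs.trans hτ⟩
  · rw [e]
    refine (ae_restrict_iff' (MeasurableSet.univ.prod measurableSet_Ioi)).2
      (Eventually.of_forall ?_)
    rintro ⟨x, τ⟩ ⟨-, hτ⟩
    rw [norm_mul]
    gcongr
    exact hb _ _ (hs.trans hτ)

lemma ae_sub_ne_zero (x' : E3) : ∀ᵐ x : E3, x - x' ≠ 0 := by
  have : ∀ᵐ x : E3, x ≠ x' := by simp [ae_iff]
  filter_upwards [this] with x hx using sub_ne_zero.2 hx

section Slices

variable {ν s : ℝ} {f : E3 → ℝ}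

lemma integrable_mul_integral_heatD2 (hν : 0 < ν) (hs : 0 < s) (hf : Continuous f)
    (hfc : HasCompactSupport f) (x' w v : E3) :
    Integrable (fun q : E3 × ℝ => f q.1 * heatD2 ν w v (q.1 - x') q.2)
      (volume.prod (volume.restrict (Ioi s))) :=
  integrable_mul_kernel_prod hf hfc (continuousOn_heatD2 hν w v) (by norm_num) hs
    (fun z _ hτ => abs_heatD2_le hν hτ w v z) x'

lemma integrable_mul_integral_heatD3 (hν : 0 < ν) (hs : 0 < s) (hf : Continuous f)
    (hfc : HasCompactSupport f) (x' w v u : E3) :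
    Integrable (fun q : E3 × ℝ => f q.1 * heatD3 ν w v u (q.1 - x') q.2)
      (volume.prod (volume.restrict (Ioi s))) :=
  integrable_mul_kernel_prod hf hfc (continuousOn_heatD3 hν w v u) (by norm_num) hs
    (fun z _ hτ => abs_heatD3_le hν hτ w v u z) x'

lemma integral_mul_forcing (hν : 0 < ν) (hs : 0 < s) (hf : Continuous f)
    (hfc : HasCompactSupport f) (x' w v : E3) :
    ∫ x, f x * ⟪forcingTerm ν (x - x') s w, v⟫ =
      ⟪w, v⟫ * (∫ x, f x * K (x - x') (2 * ν * s)) +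
        ν * ∫ τ in Ioi s, ∫ x, f x * heatD2 ν w v (x - x') τ := by
  have hI := integrable_mul_integral_heatD2 hν hs hf hfc x' w v
  have hc : Continuous fun x => K (x - x') (2 * ν * s) :=
    (continuous_K_space (2 * ν * s)).comp (by fun_prop : Continuous fun x => x - x')
  have hI1 : Integrable fun x => f x * K (x - x') (2 * ν * s) :=
    (hf.mul hc).integrable_of_hasCompactSupport hfc.mul_right
  have e : (fun x => f x * ⟪forcingTerm ν (x - x') s w, v⟫) =ᵐ[volume]
      fun x => ⟪w, v⟫ * (f x * K (x - x') (2 * ν * s)) +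
        ν * ∫ τ in Ioi s, f x * heatD2 ν w v (x - x') τ := by
    -- The kernel identity is only available off the diagonal x = x', which is a null set.
    filter_upwards [ae_sub_ne_zero x'] with x hx
    rw [inner_forcingTerm_eq hν hs hx, integral_const_mul]
    ring
  rw [integral_congr_ae e, integral_add (hI1.const_mul _) (hI.integral_prod_left.const_mul _),
    integral_const_mul, integral_const_mul, integral_integral_swap hI]

lemma integral_mul_nonlinear (hν : 0 < ν) (hs : 0 < s) (hf : Continuous f)
    (hfc : HasCompactSupport f) (x' w v : E3) :
    ∫ x, f x * ⟪nonlinearTerm ν (x - x') s w, v⟫ =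
      -(⟪w, v⟫ * ∫ x, f x * heatD1 ν w (x - x') s) -
        ν * ∫ τ in Ioi s, ∫ x, f x * heatD3 ν w v w (x - x') τ := by
  have hI := integrable_mul_integral_heatD3 hν hs hf hfc x' w v w
  have hc : Continuous fun x => heatD1 ν w (x - x') s :=
    (continuous_heatD1 ν w s).comp (by fun_prop : Continuous fun x => x - x')
  have hI1 : Integrable fun x => f x * heatD1 ν w (x - x') s :=
    (hf.mul hc).integrable_of_hasCompactSupport hfc.mul_right
  have e : (fun x => f x * ⟪nonlinearTerm ν (x - x') s w, v⟫) =ᵐ[volume]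
      fun x => -⟪w, v⟫ * (f x * heatD1 ν w (x - x') s) -
        ν * ∫ τ in Ioi s, f x * heatD3 ν w v w (x - x') τ := by
    filter_upwards [ae_sub_ne_zero x'] with x hx
    rw [inner_nonlinearTerm_eq hν hs hx, integral_const_mul]
    ring
  rw [integral_congr_ae e, integral_sub (hI1.const_mul _) (hI.integral_prod_left.const_mul _),
    integral_const_mul, integral_const_mul, integral_integral_swap hI, neg_mul]

/-- The nonlinear kernel is minus the derivative of the forcing kernel. -/
lemma integral_mul_nonlinear_eq_forcing (hν : 0 < ν) (hs : 0 < s) (hf : ContDiff ℝ 1 f)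
    (hfc : HasCompactSupport f) (x' w v : E3) :
    ∫ x, f x * ⟪nonlinearTerm ν (x - x') s w, v⟫ =
      ∫ x, fderiv ℝ f x w * ⟪forcingTerm ν (x - x') s w, v⟫ := by
  have hdf : Continuous fun x => fderiv ℝ f x w :=
    (hf.continuous_fderiv (by norm_num)).clm_apply continuous_const
  rw [integral_mul_nonlinear hν hs hf.continuous hfc,
    integral_mul_forcing hν hs hdf (hfc.fderiv_apply ℝ w),
    integral_mul_lineDeriv_kernel hf hfc (continuous_K_space (2 * ν * s)) (continuous_heatD1 ν w s)
      (fun z => hasLineDerivAt_K z w)]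
  simp_rw [integral_mul_lineDeriv_kernel hf hfc (continuous_heatD2 ν w v _)
    (continuous_heatD3 ν w v w _) (fun z => hasLineDerivAt_heatD2 w v z w), integral_neg]
  ring

/-- In the Hessian part one derivative can be moved onto f, where it assembles to the divergence and
vanishes. Only the heat kernel survives. -/
lemma integral_mul_forcing_of_divFree {f : Fin 3 → E3 → ℝ} (hν : 0 < ν) (hs : 0 < s)
    (hf : ∀ i, ContDiff ℝ 1 (f i)) (hfc : ∀ i, HasCompactSupport (f i))
    (hdiv : ∀ x, ∑ i, fderiv ℝ (f i) x (EuclideanSpace.single i 1) = 0) (x' w : E3) :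
    ∑ i, ∫ x, f i x * ⟪forcingTerm ν (x - x') s w, EuclideanSpace.single i 1⟫ =
      ∑ i, w i * ∫ x, f i x * K (x - x') (2 * ν * s) := by
  have hI := fun i => (integrable_mul_integral_heatD2 hν hs (hf i).continuous (hfc i) x' w
    (EuclideanSpace.single i 1)).integral_prod_right
  simp_rw [fun i => integral_mul_forcing hν hs (hf i).continuous (hfc i) x' w]
  rw [Finset.sum_add_distrib, ← Finset.mul_sum, ← integral_finsetSum _ fun i _ => hI i]
  have h0 : ∀ τ, ∑ i, ∫ x, f i x * heatD2 ν w (EuclideanSpace.single i 1) (x - x') τ = 0 := by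
    intro τ
    simp_rw [fun i => integral_mul_lineDeriv_kernel (hf i) (hfc i) (continuous_heatD1 ν w τ)
      (continuous_heatD2 ν w (EuclideanSpace.single i 1) τ)
      (fun z => hasLineDerivAt_heatD1 w z (EuclideanSpace.single i 1)) x']
    have hc : Continuous fun x => heatD1 ν w (x - x') τ :=
      (continuous_heatD1 ν w τ).comp (by fun_prop : Continuous fun x => x - x')
    rw [Finset.sum_neg_distrib, ← integral_finsetSum]
    · simp_rw [← Finset.sum_mul, hdiv]
      simp
    · intro i _
      exact ((((hf i).continuous_fderiv (by norm_num)).clm_apply continuous_const).mul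
        hc).integrable_of_hasCompactSupport ((hfc i).fderiv_apply ℝ _).mul_right
  simp_rw [h0]
  simp [EuclideanSpace.inner_single_right]

/-- The trace is the derivative in the direction w of ΔK, so ν times it is a time derivative of D_w
K and its integral over (s, ∞) is explicit. -/
lemma sum_heatD3_single (w z : E3) (τ : ℝ) :
    ∑ i : Fin 3, heatD3 ν w (EuclideanSpace.single i 1) (EuclideanSpace.single i 1) z τ =
      ⟪z, w⟫ * ((5 * invVar ν τ ^ 2 - invVar ν τ ^ 3 * ‖z‖ ^ 2) * K z (2 * ν * τ)) := by
  have h1 : ‖z‖ ^ 2 = z 0 * z 0 + z 1 * z 1 + z 2 * z 2 := by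
    rw [EuclideanSpace.norm_sq_eq, Fin.sum_univ_three]
    simp [sq]
  have h2 : ⟪z, w⟫ = z 0 * w 0 + z 1 * w 1 + z 2 * w 2 := by
    rw [PiLp.inner_apply, Fin.sum_univ_three]
    simp [mul_comm]
  rw [Fin.sum_univ_three]
  unfold heatD3
  simp only [EuclideanSpace.inner_single_right, one_mul]
  rw [h1, h2]
  simp
  ring

/-- Each column of the kernel is divergence-free. The heat part contributes D_w K at time s, and the
Hessian part contributes ν ∫_s^∞ D_w ΔK dτ, which is -D_w K at time s by the heat equation. -/
lemma sum_integral_fderiv_mul_forcing {ψ : E3 → ℝ} (hν : 0 < ν) (hs : 0 < s)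
    (hf : ContDiff ℝ 2 ψ) (hfc : HasCompactSupport ψ) (x' w : E3) :
    ∑ i, ∫ x, fderiv ℝ ψ x (EuclideanSpace.single i 1) *
      ⟪forcingTerm ν (x - x') s w, EuclideanSpace.single i 1⟫ = 0 := by
  have hf1 : ContDiff ℝ 1 ψ := hf.of_le (by norm_num)
  have hdf : ∀ v, Continuous fun x => fderiv ℝ ψ x v := fun v =>
    (hf1.continuous_fderiv (by norm_num)).clm_apply continuous_const
  have hdc : ∀ v, HasCompactSupport fun x => fderiv ℝ ψ x v := fun v => hfc.fderiv_apply ℝ v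
  have hI := fun i : Fin 3 => (integrable_mul_integral_heatD2 hν hs (hdf _)
    (hdc (EuclideanSpace.single i 1)) x' w (EuclideanSpace.single i 1)).integral_prod_right
  have hI3 := fun i : Fin 3 => integrable_mul_integral_heatD3 hν hs hf.continuous hfc x' w
    (EuclideanSpace.single i 1) (EuclideanSpace.single i 1)
  have hcK : Continuous fun x => K (x - x') (2 * ν * s) :=
    (continuous_K_space (2 * ν * s)).comp (by fun_prop : Continuous fun x => x - x')
  have hc1 : Continuous fun x => heatD1 ν w (x - x') s :=
    (continuous_heatD1 ν w s).comp (by fun_prop : Continuous fun x => x - x')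
  simp_rw [fun i : Fin 3 => integral_mul_forcing hν hs (hdf (EuclideanSpace.single i 1))
    (hdc (EuclideanSpace.single i 1)) x' w (EuclideanSpace.single i 1)]
  rw [Finset.sum_add_distrib, ← Finset.mul_sum, ← integral_finsetSum _ fun i _ => hI i]
  have e1 : ∑ i : Fin 3, ⟪w, EuclideanSpace.single i 1⟫ *
      ∫ x, fderiv ℝ ψ x (EuclideanSpace.single i 1) * K (x - x') (2 * ν * s) =
      -∫ x, ψ x * heatD1 ν w (x - x') s := by
    rw [integral_mul_lineDeriv_kernel hf1 hfc (continuous_K_space (2 * ν * s))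
      (continuous_heatD1 ν w s) (fun z => hasLineDerivAt_K z w), neg_neg]
    simp_rw [← integral_const_mul]
    rw [← integral_finsetSum]
    · congr 1; ext x
      have hw : w = ∑ i : Fin 3, ⟪w, EuclideanSpace.single i 1⟫ • EuclideanSpace.single i (1 : ℝ) := by
        ext j
        simp [EuclideanSpace.inner_single_right, Finset.sum_apply, Pi.single_apply]
      conv_rhs => rw [hw, map_sum, Finset.sum_mul]
      simp [mul_assoc]
    · intro i _
      exact (((hdf _).mul hcK).integrable_of_hasCompactSupport (hdc _).mul_right).const_mul _
  have e2 : ∀ τ, ∑ i : Fin 3, ∫ x, fderiv ℝ ψ x (EuclideanSpace.single i 1) *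
      heatD2 ν w (EuclideanSpace.single i 1) (x - x') τ =
      -∫ x, ∑ i : Fin 3, ψ x *
        heatD3 ν w (EuclideanSpace.single i 1) (EuclideanSpace.single i 1) (x - x') τ := by
    intro τ
    rw [integral_finsetSum, ← Finset.sum_neg_distrib]
    · refine Finset.sum_congr rfl fun i _ => ?_
      rw [integral_mul_lineDeriv_kernel hf1 hfc (continuous_heatD2 ν w _ τ)
        (continuous_heatD3 ν w _ _ τ) (fun z => hasLineDerivAt_heatD2 w _ z _), neg_neg]
    · intro i _
      have hc3 : Continuous fun x => heatD3 ν w (EuclideanSpace.single i 1)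
          (EuclideanSpace.single i 1) (x - x') τ :=
        (continuous_heatD3 ν w _ _ τ).comp (by fun_prop : Continuous fun x => x - x')
      exact (hf.continuous.mul hc3).integrable_of_hasCompactSupport hfc.mul_right
  have hsum : Integrable (fun q : E3 × ℝ => ∑ i : Fin 3, ψ q.1 *
      heatD3 ν w (EuclideanSpace.single i 1) (EuclideanSpace.single i 1) (q.1 - x') q.2)
      (volume.prod (volume.restrict (Ioi s))) := integrable_finsetSum _ fun i _ => hI3 i
  simp_rw [e2]
  rw [e1, integral_neg, ← integral_integral_swap hsum, mul_neg, ← integral_const_mul]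
  -- The time integration of D_w ΔK is exactly the moment recursion `norm_sq_mul_moment_three`,
  -- multiplied by (x - x')·w.
  have e3 : ∀ x, ν * (∫ τ in Ioi s, ∑ i : Fin 3, ψ x *
      heatD3 ν w (EuclideanSpace.single i 1) (EuclideanSpace.single i 1) (x - x') τ) =
      -(ψ x * heatD1 ν w (x - x') s) := by
    intro x
    simp_rw [← Finset.mul_sum, sum_heatD3_single]
    have h1 := integrableOn_invVar_pow_mul_K hν hs 1 (x - x')
    have h2 := integrableOn_invVar_pow_mul_K hν hs 2 (x - x')
    have h3 := norm_sq_mul_moment_three hν hs (x - x')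
    have e : ∫ τ in Ioi s, (5 * invVar ν τ ^ 2 - invVar ν τ ^ 3 * ‖x - x'‖ ^ 2) *
        K (x - x') (2 * ν * τ) = 5 * (∫ τ in Ioi s, invVar ν τ ^ 2 * K (x - x') (2 * ν * τ)) -
        ‖x - x'‖ ^ 2 * ∫ τ in Ioi s, invVar ν τ ^ 3 * K (x - x') (2 * ν * τ) := by
      rw [← integral_const_mul, ← integral_const_mul,
        ← integral_sub (h1.const_mul _) (h2.const_mul _)]
      congr 1; ext τ; ring
    rw [integral_const_mul, integral_const_mul, e]
    unfold moment at h3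
    unfold heatD1
    linear_combination (- ψ x * ⟪x - x', w⟫) * h3
  simp_rw [e3]
  rw [integral_neg]
  ring

end Slices

end

section

/-! ### The heat semigroup -/

lemma K_scale {t : ℝ} (ht : 0 < t) (y : E3) : √t ^ 3 * K (√t • y) t = K y 1 := by
  unfold K
  have e1 : √t ^ 3 = t ^ (3 / 2 : ℝ) := by
    rw [Real.sqrt_eq_rpow, ← Real.rpow_natCast, ← Real.rpow_mul ht.le]; norm_num
  rw [e1, Real.mul_rpow (z := (-(3 / 2) : ℝ)) (by positivity) ht.le, norm_smul, mul_pow,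
    Real.norm_of_nonneg (Real.sqrt_nonneg t), Real.sq_sqrt ht.le, Real.rpow_neg ht.le]
  have : -(t * ‖y‖ ^ 2) / (2 * t) = -‖y‖ ^ 2 / (2 * 1) := by field_simp
  rw [this, mul_one]
  field_simp

/-- Writing heat averages against the fixed Gaussian K(·, 1) moves the time dependence into the
argument of f, so that the limit t → 0 is not singular. -/
lemma integral_comp_sqrt_smul {t : ℝ} (ht : 0 < t) (f : E3 → ℝ) :
    ∫ y, f (√t • y) * K y 1 = ∫ z, f z * K z t := by
  have h := Measure.integral_comp_smul_of_nonneg (volume : Measure E3) (fun z => f z * K z t) (√t)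
    (hR := Real.sqrt_nonneg t)
  have hf : Module.finrank ℝ E3 = 3 := by simp [E3]
  have hs : 0 < √t := by positivity
  rw [hf] at h
  have e : ∀ y, f (√t • y) * K y 1 = √t ^ 3 * (f (√t • y) * K (√t • y) t) := by
    intro y; rw [← K_scale ht]; ring
  simp_rw [e]
  rw [integral_const_mul, h, smul_eq_mul, ← mul_assoc, mul_inv_cancel₀ (by positivity), one_mul]

/-- The integral of a non-integrable function is zero by convention, while the Gaussian integral
formula gives a positive value. -/
lemma integrable_exp_neg_mul_sq_norm {b : ℝ} (hb : 0 < b) :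
    Integrable fun z : E3 => Real.exp (-b * ‖z‖ ^ 2) := by
  by_contra h
  have h1 := GaussianFourier.integral_rexp_neg_mul_sq_norm (V := E3) hb
  rw [integral_undef h] at h1
  have : 0 < (Real.pi / b) ^ ((Module.finrank ℝ E3 : ℝ) / 2) := by positivity
  linarith

lemma K_eq_const_mul_exp (z : E3) (t : ℝ) :
    K z t = (2 * Real.pi * t) ^ (-(3 / 2) : ℝ) * Real.exp (-(2 * t)⁻¹ * ‖z‖ ^ 2) := by
  unfold K
  congr 2
  rw [div_eq_mul_inv]; ring

lemma integrable_K {t : ℝ} (ht : 0 < t) : Integrable fun z : E3 => K z t := by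
  simp_rw [K_eq_const_mul_exp]
  exact (integrable_exp_neg_mul_sq_norm (by positivity)).const_mul _

lemma integral_K {t : ℝ} (ht : 0 < t) : ∫ z : E3, K z t = 1 := by
  simp_rw [K_eq_const_mul_exp]
  rw [integral_const_mul, GaussianFourier.integral_rexp_neg_mul_sq_norm (by positivity)]
  have hf : Module.finrank ℝ E3 = 3 := by simp [E3]
  have e : Real.pi / (2 * t)⁻¹ = 2 * Real.pi * t := by field_simp
  rw [hf, e, ← Real.rpow_add (by positivity)]
  norm_num

lemma measurable_K : Measurable fun p : E3 × ℝ => K p.1 p.2 := by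
  unfold K; fun_prop

lemma abs_integral_mul_K_le {f : E3 → ℝ} {C t : ℝ} (ht : 0 < t) (hC : ∀ x, |f x| ≤ C) (x' : E3) :
    |∫ x, f x * K (x - x') t| ≤ C := by
  have h1 : Integrable fun x => C * K (x - x') t := ((integrable_K ht).comp_sub_right x').const_mul C
  have h2 : ∫ x, C * K (x - x') t = C := by
    rw [integral_const_mul, integral_sub_right_eq_self (fun x => K x t), integral_K ht, mul_one]
  rw [← h2, ← Real.norm_eq_abs]
  refine norm_integral_le_of_norm_le h1 (Eventually.of_forall fun x => ?_)
  rw [norm_mul, Real.norm_of_nonneg (K_nonneg (x - x') ht.le)]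
  exact mul_le_mul_of_nonneg_right (hC x) (K_nonneg _ ht.le)

lemma sum_heatD2_single (ν : ℝ) (z : E3) (τ : ℝ) :
    ∑ i : Fin 3, heatD2 ν (EuclideanSpace.single i 1) (EuclideanSpace.single i 1) z τ =
      (invVar ν τ ^ 2 * ‖z‖ ^ 2 - 3 * invVar ν τ) * K z (2 * ν * τ) := by
  have h1 : ‖z‖ ^ 2 = z 0 * z 0 + z 1 * z 1 + z 2 * z 2 := by
    rw [EuclideanSpace.norm_sq_eq, Fin.sum_univ_three]
    simp [sq]
  rw [Fin.sum_univ_three]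
  unfold heatD2
  simp only [EuclideanSpace.inner_single_right, one_mul]
  rw [h1]
  simp
  ring

/-! ### Slices of test functions -/

lemma contDiff_slice (φ : 𝓢(SpaceTime, ℝ)) (t : ℝ) {n : ℕ∞} :
    ContDiff ℝ n fun x : E3 => φ (x, t) :=
  (φ.smooth n).comp (contDiff_id.prodMk contDiff_const)

lemma fderiv_slice (φ : 𝓢(SpaceTime, ℝ)) (x v : E3) (t : ℝ) :
    fderiv ℝ (fun x : E3 => φ (x, t)) x v = (∂_{((v, 0) : SpaceTime)} φ) (x, t) := by
  rw [SchwartzMap.lineDerivOp_apply_eq_fderiv]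
  have h : HasFDerivAt (fun x : E3 => φ (x, t))
      ((fderiv ℝ φ (x, t)).comp (ContinuousLinearMap.inl ℝ E3 ℝ)) x :=
    (φ.hasFDerivAt (x, t)).comp x (hasFDerivAt_prodMk_left x t)
  rw [h.fderiv]
  simp

lemma hasDerivAt_time_slice (φ : 𝓢(SpaceTime, ℝ)) (x : E3) (t : ℝ) :
    HasDerivAt (fun t : ℝ => φ (x, t)) ((∂_{timeDir} φ) (x, t)) t := by
  rw [SchwartzMap.lineDerivOp_apply_eq_fderiv]
  have h : HasFDerivAt (fun t : ℝ => φ (x, t))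
      ((fderiv ℝ φ (x, t)).comp (ContinuousLinearMap.inr ℝ E3 ℝ)) t :=
    (φ.hasFDerivAt (x, t)).comp t (hasFDerivAt_prodMk_right x t)
  simpa [timeDir] using h.hasDerivAt

lemma hasCompactSupport_slice {φ : SpaceTime → ℝ} (hφ : HasCompactSupport φ) (t : ℝ) :
    HasCompactSupport fun x : E3 => φ (x, t) := by
  refine hφ.comp_isClosedEmbedding (g := fun x : E3 => ((x, t) : SpaceTime)) ?_
  exact Topology.IsClosedEmbedding.of_continuous_injective_isClosedMap (by fun_prop)
    (fun a b h => (Prod.ext_iff.1 h).1) (isClosedMap_prodMk_right t)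

lemma exists_forall_norm_le_of_ne_zero {φ : SpaceTime → ℝ} (hφ : HasCompactSupport φ) :
    ∃ R, 0 < R ∧ ∀ x t, φ (x, t) ≠ 0 → ‖x‖ ≤ R ∧ |t| ≤ R := by
  obtain ⟨R, hR⟩ := hφ.isCompact.isBounded.exists_norm_le
  refine ⟨max R 1, by positivity, fun x t h => ?_⟩
  have h1 := hR (x, t) (subset_tsupport _ h)
  rw [Prod.norm_def, max_le_iff] at h1
  exact ⟨h1.1.trans (le_max_left _ _), h1.2.trans (le_max_left _ _)⟩

lemma exists_abs_le (φ : 𝓢(SpaceTime, ℝ)) : ∃ C, 0 ≤ C ∧ ∀ q, |φ q| ≤ C :=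
  ⟨_, apply_nonneg _ φ, fun q => SchwartzMap.norm_le_seminorm ℝ φ q⟩

lemma hasCompactSupport_lineDeriv {φ : 𝓢(SpaceTime, ℝ)} (hφ : HasCompactSupport φ) (v : SpaceTime) :
    HasCompactSupport (∂_{v} φ : 𝓢(SpaceTime, ℝ)) :=
  HasCompactSupport.of_support_subset_isCompact hφ.isCompact
    ((subset_tsupport _).trans (SchwartzMap.tsupport_lineDerivOp_subset v φ))

/-! ### The backward heat operator -/

/-- The backward heat operator `-∂ₜ - νΔ`. -/
def backwardHeat (ν : ℝ) (φ : 𝓢(SpaceTime, ℝ)) : 𝓢(SpaceTime, ℝ) :=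
  -(∂_{timeDir} φ) - ν • ∑ j : Fin 3, ∂_{spaceDir j} (∂_{spaceDir j} φ)

lemma backwardHeat_apply (ν : ℝ) (φ : 𝓢(SpaceTime, ℝ)) (q : SpaceTime) :
    backwardHeat ν φ q =
      -(∂_{timeDir} φ) q - ν * ∑ j : Fin 3, (∂_{spaceDir j} (∂_{spaceDir j} φ)) q := by
  simp [backwardHeat, Fin.sum_univ_three, mul_add]

lemma tsupport_backwardHeat_subset (ν : ℝ) (φ : 𝓢(SpaceTime, ℝ)) :
    tsupport (backwardHeat ν φ) ⊆ tsupport φ := by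
  refine closure_minimal (fun q hq => ?_) (isClosed_tsupport φ)
  by_contra h
  refine hq ?_
  have h1 : ∀ v : SpaceTime, (∂_{v} φ : 𝓢(SpaceTime, ℝ)) q = 0 := fun v => image_eq_zero_of_notMem_tsupport fun hq' =>
    h (SchwartzMap.tsupport_lineDerivOp_subset v φ hq')
  have h2 : ∀ v : SpaceTime, (∂_{v} (∂_{v} φ) : 𝓢(SpaceTime, ℝ)) q = 0 := fun v => image_eq_zero_of_notMem_tsupport fun hq' =>
    h (SchwartzMap.tsupport_lineDerivOp_subset v φ
      (SchwartzMap.tsupport_lineDerivOp_subset v (∂_{v} φ) hq'))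
  rw [backwardHeat_apply]
  simp [h1, h2]

lemma hasCompactSupport_backwardHeat (ν : ℝ) {φ : 𝓢(SpaceTime, ℝ)} (hφ : HasCompactSupport φ) :
    HasCompactSupport (backwardHeat ν φ) :=
  HasCompactSupport.of_support_subset_isCompact hφ.isCompact
    ((subset_tsupport _).trans (tsupport_backwardHeat_subset ν φ))

section Representation

variable {ν : ℝ} {φ : 𝓢(SpaceTime, ℝ)}

lemma integral_slice_mul_heatD2 (hφ : HasCompactSupport φ) (t τ : ℝ) (x' : E3) (j : Fin 3) :
    ∫ x, φ (x, t) * heatD2 ν (EuclideanSpace.single j 1) (EuclideanSpace.single j 1) (x - x') τ =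
      ∫ x, (∂_{spaceDir j} (∂_{spaceDir j} φ)) (x, t) * K (x - x') (2 * ν * τ) := by
  have h1 := integral_mul_lineDeriv_kernel (contDiff_slice φ t) (hasCompactSupport_slice hφ t)
    (continuous_heatD1 ν (EuclideanSpace.single j 1) τ)
    (continuous_heatD2 ν (EuclideanSpace.single j 1) (EuclideanSpace.single j 1) τ)
    (fun z => hasLineDerivAt_heatD1 _ z _) x'
  have h2 := integral_mul_lineDeriv_kernel (contDiff_slice (∂_{spaceDir j} φ) t)
    (hasCompactSupport_slice (hasCompactSupport_lineDeriv hφ _) t)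
    (continuous_K_space (2 * ν * τ)) (continuous_heatD1 ν (EuclideanSpace.single j 1) τ)
    (fun z => hasLineDerivAt_K z _) x'
  simp_rw [fderiv_slice] at h1 h2
  rw [h1]
  unfold spaceDir at h2 ⊢
  rw [h2, neg_neg]

lemma integrable_slice_mul (hφ : HasCompactSupport φ) {k : E3 → ℝ} (hk : Continuous k) (t : ℝ)
    (x' : E3) : Integrable fun x => φ (x, t) * k (x - x') :=
  ((contDiff_slice φ t (n := 0)).continuous.mul
    (hk.comp (by fun_prop : Continuous fun x => x - x'))).integrable_of_hasCompactSupport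
      (hasCompactSupport_slice hφ t).mul_right

/-- The product rule gives ∂ₜφ · K plus φ · νΔK; two integrations by parts move the Laplacian onto
φ. -/
lemma hasDerivAt_integral_slice_mul_K (hν : 0 < ν) (hφ : HasCompactSupport φ) (x' : E3) (t' : ℝ)
    {s : ℝ} (hs : 0 < s) :
    HasDerivAt (fun s => ∫ x, φ (x, t' + s) * K (x - x') (2 * ν * s))
      (-∫ x, backwardHeat ν φ (x, t' + s) * K (x - x') (2 * ν * s)) s := by
  obtain ⟨R, hR0, hR⟩ := exists_forall_norm_le_of_ne_zero hφ
  obtain ⟨R1, hR10, hR1⟩ := exists_forall_norm_le_of_ne_zero (hasCompactSupport_lineDeriv hφ timeDir)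
  obtain ⟨C, hC0, hC⟩ := exists_abs_le φ
  obtain ⟨C1, hC10, hC1⟩ := exists_abs_le (∂_{timeDir} φ)
  set F' : ℝ → E3 → ℝ := fun s x => (∂_{timeDir} φ) (x, t' + s) * K (x - x') (2 * ν * s) +
    ν * ∑ i : Fin 3, φ (x, t' + s) *
      heatD2 ν (EuclideanSpace.single i 1) (EuclideanSpace.single i 1) (x - x') s with hF'
  -- A majorant for all times beyond s/2, where K and its second derivatives are largest at s/2. It
  -- is used on a ball containing the spatial supports of φ and of ∂ₜφ.
  set B : ℝ := C1 * ((2 * Real.pi) ^ (-(3 / 2) : ℝ) * invVar ν (s / 2) ^ (3 / 2 : ℝ)) +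
    ν * (3 * (C * (10 ^ 6 * (2 * ν) ^ (-(5 / 2) : ℝ) * (s / 2) ^ (-(5 / 2) : ℝ))))
  have hder : ∀ x, ∀ σ, 0 < σ → HasDerivAt (fun σ => φ (x, t' + σ) * K (x - x') (2 * ν * σ))
      (F' σ x) σ := by
    intro x σ hσ
    have h1 := (hasDerivAt_time_slice φ x (t' + σ)).comp_const_add t' σ
    refine (h1.mul (hasDerivAt_K_time hν hσ (x - x'))).congr_deriv ?_
    rw [hF']
    simp only
    rw [← Finset.mul_sum, sum_heatD2_single]
    ring
  have hFc : Continuous (F' s) := by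
    have c1 := continuous_K_space (2 * ν * s)
    have c2 := fun i : Fin 3 => continuous_heatD2 ν (EuclideanSpace.single i 1)
      (EuclideanSpace.single i 1) s
    have c3 : Continuous fun x => K (x - x') (2 * ν * s) :=
      c1.comp (by fun_prop : Continuous fun x => x - x')
    have c4 := fun i : Fin 3 => (c2 i).comp (by fun_prop : Continuous fun x => x - x')
    have c5 := (contDiff_slice φ (t' + s) (n := 0)).continuous
    have c6 := (contDiff_slice (∂_{timeDir} φ) (t' + s) (n := 0)).continuous
    exact (c6.mul c3).add (continuous_const.mul (continuous_finsetSum _ fun i _ => c5.mul (c4 i)))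
  have key := (hasDerivAt_integral_of_dominated_loc_of_deriv_le
    (F := fun s x => φ (x, t' + s) * K (x - x') (2 * ν * s)) (F' := F') (x₀ := s)
    (s := Ioi (s / 2)) (μ := volume)
    (bound := (Metric.closedBall (0 : E3) (max R R1)).indicator fun _ => B)
    (Ioi_mem_nhds (by linarith)) ?_ ?_ ?_ ?_ ?_ ?_).2
  · refine key.congr_deriv ?_
    simp_rw [hF', backwardHeat_apply]
    have i1 := integrable_slice_mul (hasCompactSupport_lineDeriv hφ timeDir)
      (continuous_K_space (2 * ν * s)) (t' + s) x'
    have i2 := fun j : Fin 3 => integrable_slice_mul (hasCompactSupport_lineDeriv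
      (hasCompactSupport_lineDeriv hφ (spaceDir j)) (spaceDir j))
      (continuous_K_space (2 * ν * s)) (t' + s) x'
    have i3 := fun j : Fin 3 => integrable_slice_mul hφ (continuous_heatD2 ν
      (EuclideanSpace.single j 1) (EuclideanSpace.single j 1) s) (t' + s) x'
    rw [integral_add i1 ((integrable_finsetSum _ fun j _ => i3 j).const_mul ν),
      integral_const_mul, integral_finsetSum _ fun j _ => i3 j]
    simp_rw [integral_slice_mul_heatD2 hφ]
    have e : ∀ x, (-(∂_{timeDir} φ) (x, t' + s) - ν * ∑ j : Fin 3,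
        (∂_{spaceDir j} (∂_{spaceDir j} φ)) (x, t' + s)) * K (x - x') (2 * ν * s) =
        -((∂_{timeDir} φ) (x, t' + s) * K (x - x') (2 * ν * s) + ν * ∑ j : Fin 3,
          (∂_{spaceDir j} (∂_{spaceDir j} φ)) (x, t' + s) * K (x - x') (2 * ν * s)) := by
      intro x; rw [← Finset.sum_mul]; ring
    simp_rw [e]
    rw [integral_neg, neg_neg,
      integral_add i1 ((integrable_finsetSum _ fun j _ => i2 j).const_mul ν),
      integral_const_mul, integral_finsetSum _ fun j _ => i2 j]
  · exact Eventually.of_forall fun σ =>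
      (integrable_slice_mul hφ (continuous_K_space (2 * ν * σ)) (t' + σ) x').aestronglyMeasurable
  · exact integrable_slice_mul hφ (continuous_K_space (2 * ν * s)) (t' + s) x'
  · exact hFc.aestronglyMeasurable
  · refine Eventually.of_forall fun x σ hσ => ?_
    have hσ0 : 0 < σ := lt_trans (by positivity) hσ
    by_cases hx : x ∈ Metric.closedBall (0 : E3) (max R R1)
    · rw [indicator_of_mem hx, hF']
      refine (norm_add_le _ _).trans (add_le_add ?_ ?_)
      · rw [norm_mul, Real.norm_of_nonneg (K_nonneg _ (by positivity : 0 ≤ 2 * ν * σ))]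
        refine mul_le_mul (hC1 _) ((K_le hν hσ0 _).trans ?_) (K_nonneg _ (by positivity)) hC10
        have := invVar_anti hν (by positivity) (le_of_lt hσ)
        have := invVar_pos hν hσ0
        gcongr
      · rw [norm_mul, Real.norm_of_nonneg hν.le]
        gcongr
        have hb : ∀ i : Fin 3, ‖φ (x, t' + σ) * heatD2 ν (EuclideanSpace.single i 1)
            (EuclideanSpace.single i 1) (x - x') σ‖ ≤
            C * (10 ^ 6 * (2 * ν) ^ (-(5 / 2) : ℝ) * (s / 2) ^ (-(5 / 2) : ℝ)) := by
          intro i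
          rw [norm_mul]
          refine mul_le_mul (hC _) ((abs_heatD2_le hν hσ0 _ _ _).trans ?_) (norm_nonneg _) hC0
          have := Real.rpow_le_rpow_of_nonpos (by positivity) (le_of_lt hσ)
            (by norm_num : -(5 / 2) ≤ (0 : ℝ))
          simp only [PiLp.norm_single, norm_one, mul_one]
          gcongr
        refine (norm_sum_le _ _).trans ((Finset.sum_le_sum fun i _ => hb i).trans_eq ?_)
        simp
    · rw [indicator_of_notMem hx, hF']
      have hx' : max R R1 < ‖x‖ := by simpa using hx
      have z1 : φ (x, t' + σ) = 0 := by
        by_contra h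
        exact absurd (hR _ _ h).1 (not_le.2 ((le_max_left _ _).trans_lt hx'))
      have z2 : (∂_{timeDir} φ) (x, t' + σ) = 0 := by
        by_contra h
        exact absurd (hR1 _ _ h).1 (not_le.2 ((le_max_right _ _).trans_lt hx'))
      simp [z1, z2]
  · exact (integrable_indicator_iff Metric.isClosed_closedBall.measurableSet).2
      (integrableOn_const (measure_closedBall_lt_top.ne))
  · exact Eventually.of_forall fun x σ hσ => hder x σ (lt_trans (by positivity) hσ)

/-- A test function is recovered from its image under the backward heat operator. -/
theorem integral_backwardHeat_mul_K (hν : 0 < ν) (hφ : HasCompactSupport φ) (x' : E3) (t' : ℝ) :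
    ∫ s in Ioi (0 : ℝ), ∫ x, backwardHeat ν φ (x, t' + s) * K (x - x') (2 * ν * s) =
      φ (x', t') := by
  obtain ⟨C, hC0, hC⟩ := exists_abs_le φ
  obtain ⟨C1, hC10, hC1⟩ := exists_abs_le (backwardHeat ν φ)
  obtain ⟨R, hR0, hR⟩ := exists_forall_norm_le_of_ne_zero hφ
  obtain ⟨R1, hR10, hR1⟩ := exists_forall_norm_le_of_ne_zero (hasCompactSupport_backwardHeat ν hφ)
  -- The heat average of φ along t' + s, written against the unit Gaussian so that it is continuous
  -- down to s = 0 and takes the value φ(x', t') there. It vanishes for large s, so the fundamental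
  -- theorem of calculus on (0, ∞) gives the claim.
  set a : ℝ → ℝ := fun s => ∫ y, φ (x' + √(2 * ν * s) • y, t' + s) * K y 1
  have ha0 : a 0 = φ (x', t') := by
    simp only [a, mul_zero, Real.sqrt_zero, zero_smul, add_zero]
    rw [integral_const_mul, integral_K one_pos, mul_one]
  have hac : Continuous a := by
    refine continuous_of_dominated (bound := fun y => C * K y 1) ?_ ?_ ?_ ?_
    · intro s
      refine Continuous.aestronglyMeasurable ?_
      have := φ.continuous
      have := continuous_K_space 1
      fun_prop
    · intro s
      refine Eventually.of_forall fun y => ?_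
      rw [norm_mul, Real.norm_of_nonneg (K_nonneg y zero_le_one)]
      exact mul_le_mul_of_nonneg_right (hC _) (K_nonneg y zero_le_one)
    · exact (integrable_K one_pos).const_mul C
    · refine Eventually.of_forall fun y => ?_
      have := φ.continuous
      fun_prop
  have haeq : ∀ s, 0 < s → a s = ∫ x, φ (x, t' + s) * K (x - x') (2 * ν * s) := by
    intro s hs
    have h1 := integral_comp_sqrt_smul (t := 2 * ν * s) (by positivity)
      (fun z => φ (x' + z, t' + s))
    rw [← integral_add_left_eq_self (fun x => φ (x, t' + s) * K (x - x') (2 * ν * s)) x']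
    simp only [add_sub_cancel_left]
    exact h1
  have hder : ∀ s ∈ Ioi (0 : ℝ), HasDerivAt a
      (-∫ x, backwardHeat ν φ (x, t' + s) * K (x - x') (2 * ν * s)) s := by
    intro s hs
    refine (hasDerivAt_integral_slice_mul_K hν hφ x' t' hs).congr_of_eventuallyEq ?_
    filter_upwards [lt_mem_nhds hs] with σ hσ using haeq σ hσ
  have hlim : Tendsto a atTop (𝓝 0) := by
    refine tendsto_const_nhds.congr' ?_
    filter_upwards [eventually_gt_atTop (|t'| + R)] with s hs
    have : ∀ y : E3, φ (x' + √(2 * ν * s) • y, t' + s) = 0 := by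
      intro y
      by_contra h
      have h2 := (hR _ _ h).2
      have h3 := neg_abs_le t'
      have h4 := le_abs_self (t' + s)
      linarith
    simp [a, this]
  have hint : IntegrableOn (fun s => -∫ x, backwardHeat ν φ (x, t' + s) * K (x - x') (2 * ν * s))
      (Ioi 0) := by
    refine Integrable.neg ?_
    have hb : IntegrableOn ((Ioo 0 (|t'| + R1 + 1)).indicator fun _ => C1) (Ioi 0) :=
      ((integrable_indicator_iff measurableSet_Ioo).2
        (integrableOn_const (by simp))).integrableOn
    refine hb.mono' ?_ ?_
    · have hm : StronglyMeasurable (Function.uncurry fun (s : ℝ) (x : E3) =>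
          backwardHeat ν φ (x, t' + s) * K (x - x') (2 * ν * s)) := by
        refine Measurable.stronglyMeasurable ?_
        have m1 := (backwardHeat ν φ).continuous.measurable
        have m2 := measurable_K
        refine (m1.comp (by fun_prop : Measurable fun p : ℝ × E3 => (p.2, t' + p.1))).mul
          (m2.comp (by fun_prop : Measurable fun p : ℝ × E3 => (p.2 - x', 2 * ν * p.1)))
      exact hm.integral_prod_right.aestronglyMeasurable
    · refine (ae_restrict_iff' measurableSet_Ioi).2 (Eventually.of_forall fun s hs => ?_)
      have hs' : 0 < s := hs
      by_cases h : s < |t'| + R1 + 1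
      · rw [indicator_of_mem (show s ∈ Ioo 0 (|t'| + R1 + 1) from ⟨hs, h⟩)]
        exact abs_integral_mul_K_le (by positivity) (fun x => hC1 _) x'
      · have : ∀ x : E3, backwardHeat ν φ (x, t' + s) = 0 := by
          intro y
          by_contra h'
          have h2 := (hR1 _ _ h').2
          have h3 := neg_abs_le t'
          have h4 := le_abs_self (t' + s)
          linarith
        rw [indicator_of_notMem (fun hm => h hm.2)]
        simp [this]
  have h := integral_Ioi_of_hasDerivAt_of_tendsto hac.continuousWithinAt hder hint hlim
  rw [integral_neg, ha0] at h
  linarith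

end Representation

/-- The forcing kernel is uniformly bounded on smooth functions. -/
lemma exists_bound_integral_mul_forcing {ν : ℝ} (hν : 0 < ν) {ψ : E3 → ℝ} (hψ : ContDiff ℝ 2 ψ)
    (hc : HasCompactSupport ψ) : ∃ C, 0 ≤ C ∧ ∀ (x' w v : E3) (s : ℝ), 0 < s →
      |∫ x, ψ x * ⟪forcingTerm ν (x - x') s w, v⟫| ≤ C * ‖w‖ * ‖v‖ := by
  obtain ⟨C0, hC0⟩ := hψ.continuous.bounded_above_of_compact_support hc
  have hd1 : ContDiff ℝ 1 (fderiv ℝ ψ) := hψ.fderiv_right (by norm_num)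
  obtain ⟨C2, hC2⟩ := (hd1.continuous_fderiv (by norm_num)).bounded_above_of_compact_support
    ((hc.fderiv ℝ).fderiv ℝ)
  have hC00 : 0 ≤ C0 := (norm_nonneg _).trans (hC0 0)
  have hC20 : 0 ≤ C2 := (norm_nonneg _).trans (hC2 0)
  have hψi : Integrable ψ := hψ.continuous.integrable_of_hasCompactSupport hc
  set C3 := 10 ^ 6 * (2 * ν) ^ (-(5 / 2) : ℝ) * ∫ x, ‖ψ x‖ with hC3
  have hC30 : 0 ≤ C3 := by positivity
  -- For τ ≤ 1 both derivatives are moved onto ψ and the heat average of a bounded function is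
  -- bounded; for τ > 1 the decay of the kernel is used against the L¹ norm of ψ. The resulting
  -- majorant is integrable on all of (0, ∞), which makes the bound independent of s.
  set b : ℝ → ℝ := fun τ => if τ ≤ 1 then C2 else C3 * τ ^ (-(5 / 2) : ℝ) with hb
  have hbI : IntegrableOn b (Ioi 0) := by
    rw [← Ioc_union_Ioi_eq_Ioi (zero_le_one : (0 : ℝ) ≤ 1)]
    refine IntegrableOn.union ?_ ?_
    · refine (integrableOn_const (C := C2) (by simp)).congr_fun ?_ measurableSet_Ioc
      intro τ hτ; simp [hb, hτ.2]
    · have h : IntegrableOn (fun τ : ℝ => C3 * τ ^ (-(5 / 2) : ℝ)) (Ioi 1) :=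
        (integrableOn_Ioi_rpow_of_lt (by norm_num) one_pos).const_mul C3
      refine h.congr_fun ?_ measurableSet_Ioi
      intro τ hτ; simp [hb, not_le.2 (mem_Ioi.1 hτ)]
  have hb0 : ∀ τ, 0 < τ → 0 ≤ b τ := by
    intro τ hτ
    simp only [hb]
    split_ifs <;> positivity
  refine ⟨C0 + ν * ∫ τ in Ioi 0, b τ, ?_, fun x' w v s hs => ?_⟩
  · have : 0 ≤ ∫ τ in Ioi 0, b τ := setIntegral_nonneg measurableSet_Ioi hb0
    positivity
  have hbd : ∀ τ, 0 < τ → |∫ x, ψ x * heatD2 ν w v (x - x') τ| ≤ b τ * (‖w‖ * ‖v‖) := by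
    intro τ hτ
    simp only [hb]
    split_ifs with h1
    · have hψ1 : ContDiff ℝ 1 fun x => fderiv ℝ ψ x v := hd1.clm_apply contDiff_const
      rw [integral_mul_lineDeriv_kernel (hψ.of_le (by norm_num)) hc (continuous_heatD1 ν w τ)
        (continuous_heatD2 ν w v τ) (fun z => hasLineDerivAt_heatD1 w z v),
        integral_mul_lineDeriv_kernel hψ1 (hc.fderiv_apply ℝ v) (continuous_K_space (2 * ν * τ))
        (continuous_heatD1 ν w τ) (fun z => hasLineDerivAt_K z w), neg_neg]
      refine abs_integral_mul_K_le (by positivity) (fun x => ?_) x'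
      have e : fderiv ℝ (fun x => fderiv ℝ ψ x v) x w = fderiv ℝ (fderiv ℝ ψ) x w v := by
        rw [fderiv_clm_apply (hd1.differentiable (by norm_num) x) (differentiableAt_const v)]
        simp
      rw [e, ← mul_assoc]
      exact (ContinuousLinearMap.le_opNorm _ _).trans (mul_le_mul_of_nonneg_right
        ((ContinuousLinearMap.le_opNorm _ _).trans
          (mul_le_mul_of_nonneg_right (hC2 x) (norm_nonneg _))) (norm_nonneg _))
    · have e : C3 * τ ^ (-(5 / 2) : ℝ) * (‖w‖ * ‖v‖) =
          ∫ x, ‖ψ x‖ * (10 ^ 6 * (2 * ν) ^ (-(5 / 2) : ℝ) * ‖w‖ * ‖v‖ * τ ^ (-(5 / 2) : ℝ)) := by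
        rw [integral_mul_const, hC3]; ring
      rw [e, ← Real.norm_eq_abs]
      refine norm_integral_le_of_norm_le (hψi.norm.mul_const _) (Eventually.of_forall fun x => ?_)
      rw [norm_mul]
      exact mul_le_mul_of_nonneg_left (abs_heatD2_le hν hτ w v _) (norm_nonneg _)
  rw [integral_mul_forcing hν hs hψ.continuous hc]
  refine (abs_add_le _ _).trans ?_
  rw [abs_mul, abs_mul, abs_of_pos hν]
  have e : (C0 + ν * ∫ τ in Ioi 0, b τ) * ‖w‖ * ‖v‖ =
      ‖w‖ * ‖v‖ * C0 + ν * ((∫ τ in Ioi 0, b τ) * (‖w‖ * ‖v‖)) := by ring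
  rw [e]
  refine add_le_add ?_ (mul_le_mul_of_nonneg_left ?_ hν.le)
  · exact mul_le_mul (abs_real_inner_le_norm w v) (abs_integral_mul_K_le (by positivity) hC0 x')
      (abs_nonneg _) (by positivity)
  · have hsub : Ioi s ⊆ Ioi (0 : ℝ) := Ioi_subset_Ioi hs.le
    have h1 : ‖∫ τ in Ioi s, ∫ x, ψ x * heatD2 ν w v (x - x') τ‖ ≤
        ∫ τ in Ioi s, b τ * (‖w‖ * ‖v‖) :=
      norm_integral_le_of_norm_le ((hbI.mono_set hsub).mul_const _)
        ((ae_restrict_iff' measurableSet_Ioi).2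
          (Eventually.of_forall fun τ hτ => hbd τ (hs.trans hτ)))
    refine h1.trans ?_
    rw [integral_mul_const]
    refine mul_le_mul_of_nonneg_right ?_ (by positivity)
    exact setIntegral_mono_set hbI ((ae_restrict_iff' measurableSet_Ioi).2
      (Eventually.of_forall hb0)) hsub.eventuallyLE

end

section

/-! ### Measurability of the kernels -/

lemma measurable_ballMass : Measurable fun p : ℝ × ℝ => ballMass p.1 p.2 := by
  have hm : StronglyMeasurable (Function.uncurry fun (p : ℝ × ℝ) (y : E3) =>
      ({a : (ℝ × ℝ) × E3 | ‖a.2‖ ≤ a.1.1}.indicator (fun a => K a.2 a.1.2)) (p, y)) := by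
    refine Measurable.stronglyMeasurable ?_
    refine Measurable.indicator ?_ ?_
    · exact measurable_K.comp (by fun_prop : Measurable fun a : (ℝ × ℝ) × E3 => (a.2, a.1.2))
    · exact measurableSet_le (by fun_prop) (by fun_prop)
  have := hm.integral_prod_right (ν := (volume : Measure E3))
  convert this.measurable using 1
  ext p
  rw [ballMass, ← integral_indicator Metric.isClosed_closedBall.measurableSet]
  congr 1; ext y
  simp [indicator]

lemma measurable_unitVec : Measurable unitVec := by
  unfold unitVec; fun_prop

lemma measurable_forcingTerm (ν : ℝ) :
    Measurable fun p : E3 × ℝ × E3 => forcingTerm ν p.1 p.2.1 p.2.2 := by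
  have h1 : Measurable fun p : E3 × ℝ × E3 => K p.1 (2 * ν * p.2.1) :=
    measurable_K.comp (by fun_prop : Measurable fun p : E3 × ℝ × E3 => (p.1, 2 * ν * p.2.1))
  have h2 : Measurable fun p : E3 × ℝ × E3 => ballMass ‖p.1‖ (2 * ν * p.2.1) :=
    measurable_ballMass.comp
      (by fun_prop : Measurable fun p : E3 × ℝ × E3 => (‖p.1‖, 2 * ν * p.2.1))
  have h3 : Measurable fun p : E3 × ℝ × E3 => unitVec p.1 := measurable_unitVec.comp measurable_fst
  unfold forcingTerm perp reflThree
  fun_prop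

lemma measurable_nonlinearTerm (ν : ℝ) :
    Measurable fun p : E3 × ℝ × E3 => nonlinearTerm ν p.1 p.2.1 p.2.2 := by
  have h1 : Measurable fun p : E3 × ℝ × E3 => K p.1 (2 * ν * p.2.1) :=
    measurable_K.comp (by fun_prop : Measurable fun p : E3 × ℝ × E3 => (p.1, 2 * ν * p.2.1))
  have h2 : Measurable fun p : E3 × ℝ × E3 => ballMass ‖p.1‖ (2 * ν * p.2.1) :=
    measurable_ballMass.comp
      (by fun_prop : Measurable fun p : E3 × ℝ × E3 => (‖p.1‖, 2 * ν * p.2.1))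
  have h3 : Measurable fun p : E3 × ℝ × E3 => unitVec p.1 := measurable_unitVec.comp measurable_fst
  unfold nonlinearTerm b₂ b₁ perp reflThree
  fun_prop

/-! ### Local integrability of the data -/

lemma mem_halfSpace {q : SpaceTime} : q ∈ (halfSpace : Set SpaceTime) ↔ 0 < q.2 := by
  simp [halfSpace]

lemma isOpen_halfSpace : IsOpen (halfSpace : Set SpaceTime) := halfSpace.isOpen

lemma slab_subset_halfSpace (T : ℝ) : (univ ×ˢ Ioo 0 T : Set SpaceTime) ⊆ halfSpace :=
  fun _ hq => mem_halfSpace.2 hq.2.1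

lemma measurableSet_slab (T : ℝ) : MeasurableSet (univ ×ˢ Ioo 0 T : Set SpaceTime) :=
  MeasurableSet.univ.prod measurableSet_Ioo

lemma locallyIntegrableOn_norm_sq {u : SpaceTime → E3} (hu : LocallySquareIntegrable u) :
    LocallyIntegrableOn (fun q => ‖u q‖ ^ 2) (halfSpace : Set SpaceTime) := by
  rw [locallyIntegrableOn_iff isOpen_halfSpace.isLocallyClosed]
  intro k hk hkc
  exact (hu k hkc hk).integrable_norm_pow (by norm_num)

lemma locallyIntegrableOn_velocity {u : SpaceTime → E3} (hu : LocallySquareIntegrable u) :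
    LocallyIntegrableOn u (halfSpace : Set SpaceTime) := by
  rw [locallyIntegrableOn_iff isOpen_halfSpace.isLocallyClosed]
  intro k hk hkc
  have : IsFiniteMeasure (volume.restrict k) := ⟨by simpa using hkc.measure_lt_top⟩
  exact (hu k hkc hk).integrable (by norm_num)

instance : (volume : Measure SpaceTime).IsAddHaarMeasure :=
  inferInstanceAs ((volume : Measure E3).prod (volume : Measure ℝ)).IsAddHaarMeasure

/-- The reflection p ↦ (x, t) - p preserves Haar measure and maps the slab 0 < s < t onto itself. It
exchanges lags and source points. -/
lemma integrableOn_comp_sub_iff {E : Type*} [NormedAddCommGroup E] {F : SpaceTime → E}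
    (x : E3) (t : ℝ) :
    IntegrableOn (fun p : SpaceTime => F (x - p.1, t - p.2)) (univ ×ˢ Ioo 0 t) ↔
      IntegrableOn F (univ ×ˢ Ioo 0 t) := by
  rw [← integrable_indicator_iff (measurableSet_slab t),
    ← integrable_indicator_iff (measurableSet_slab t),
    ← integrable_comp_sub_left (indicator (univ ×ˢ Ioo 0 t) F) ((x, t) : SpaceTime)]
  refine iff_of_eq (congrArg (Integrable · volume) ?_)
  ext p
  by_cases hp : p.2 ∈ Ioo 0 t
  · have h1 : p ∈ (univ ×ˢ Ioo 0 t : Set SpaceTime) := ⟨mem_univ _, hp⟩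
    have h2 : (x, t) - p ∈ (univ ×ˢ Ioo 0 t : Set SpaceTime) :=
      ⟨mem_univ _, by simp [hp.2], by simp [hp.1]⟩
    rw [indicator_of_mem h1, indicator_of_mem h2]
    rfl
  · have h1 : p ∉ (univ ×ˢ Ioo 0 t : Set SpaceTime) := fun h => hp h.2
    have h2 : (x, t) - p ∉ (univ ×ˢ Ioo 0 t : Set SpaceTime) := fun h => hp (by
      have := h.2
      simp only [Prod.snd_sub, mem_Ioo] at this
      exact ⟨by linarith, by linarith⟩)
    rw [indicator_of_notMem h1, indicator_of_notMem h2]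

lemma setIntegral_comp_sub {E : Type*} [NormedAddCommGroup E] [NormedSpace ℝ E] (F : SpaceTime → E)
    (x : E3) (t : ℝ) :
    ∫ p in (univ ×ˢ Ioo 0 t : Set SpaceTime), F (x - p.1, t - p.2) =
      ∫ q in (univ ×ˢ Ioo 0 t : Set SpaceTime), F q := by
  rw [← integral_indicator (measurableSet_slab t), ← integral_indicator (measurableSet_slab t),
    ← integral_sub_left_eq_self (indicator (univ ×ˢ Ioo 0 t) F) volume ((x, t) : SpaceTime)]
  refine integral_congr_ae (Eventually.of_forall fun p => ?_)
  by_cases hp : p.2 ∈ Ioo 0 t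
  · have h1 : p ∈ (univ ×ˢ Ioo 0 t : Set SpaceTime) := ⟨mem_univ _, hp⟩
    have h2 : (x, t) - p ∈ (univ ×ˢ Ioo 0 t : Set SpaceTime) :=
      ⟨mem_univ _, by simp [hp.2], by simp [hp.1]⟩
    simp only [indicator_of_mem h1, indicator_of_mem h2]
    rfl
  · have h1 : p ∉ (univ ×ˢ Ioo 0 t : Set SpaceTime) := fun h => hp h.2
    have h2 : (x, t) - p ∉ (univ ×ˢ Ioo 0 t : Set SpaceTime) := fun h => hp (by
      have := h.2
      simp only [Prod.snd_sub, mem_Ioo] at this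
      exact ⟨by linarith, by linarith⟩)
    simp only [indicator_of_notMem h1, indicator_of_notMem h2]

section Equation

variable {ν : ℝ} {u₀ : E3 → E3} {g u : SpaceTime → E3} {x : E3} {t : ℝ}

lemma IntegralEquationAt.integrableOn_nonlinear (h : IntegralEquationAt ν u₀ g u x t) :
    IntegrableOn (fun q : SpaceTime => nonlinearTerm ν (x - q.1) (t - q.2) (u q))
      (univ ×ˢ Ioo 0 t) := by
  rw [← integrableOn_comp_sub_iff x t]
  simpa using h.integrable_nonlinear

lemma IntegralEquationAt.integrableOn_forcing (h : IntegralEquationAt ν u₀ g u x t) :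
    IntegrableOn (fun q : SpaceTime => forcingTerm ν (x - q.1) (t - q.2) (g q))
      (univ ×ˢ Ioo 0 t) := by
  rw [← integrableOn_comp_sub_iff x t]
  simpa using h.integrable_forcing

lemma IntegralEquationAt.eq_add (h : IntegralEquationAt ν u₀ g u x t) (ht : 0 < t) :
    u (x, t) = (∫ y : E3, K y (2 * ν * t) • u₀ (x - y)) +
      ((∫ q in (univ ×ˢ Ioo 0 t : Set SpaceTime), nonlinearTerm ν (x - q.1) (t - q.2) (u q)) +
        ∫ q in (univ ×ˢ Ioo 0 t : Set SpaceTime), forcingTerm ν (x - q.1) (t - q.2) (g q)) := by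
  rw [h.eq]
  congr 1
  have e : (volume : Measure SpaceTime).restrict (univ ×ˢ Ioo 0 t) =
      (volume : Measure E3).prod (volume.restrict (Ioo 0 t)) := by
    rw [Measure.volume_eq_prod, ← Measure.prod_restrict, Measure.restrict_univ]
  have h1 := h.integrable_nonlinear
  have h2 := h.integrable_forcing
  have h3 := setIntegral_comp_sub (fun q => nonlinearTerm ν (x - q.1) (t - q.2) (u q)) x t
  have h4 := setIntegral_comp_sub (fun q => forcingTerm ν (x - q.1) (t - q.2) (g q)) x t
  simp only [sub_sub_cancel] at h3 h4
  rw [← h3, ← h4, ← integral_add h1 h2, intervalIntegral.integral_of_le ht.le,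
    integral_Ioc_eq_integral_Ioo, e, integral_prod_symm]
  have := h1.add h2
  rw [IntegrableOn, e] at this
  exact this

end Equation

/-! ### Weighted integrability of the data, extracted from convergence at single points. -/

lemma exists_good_point {P : SpaceTime → Prop}
    (h : ∀ᵐ q ∂(volume.restrict (halfSpace : Set SpaceTime)), P q) {U : Set SpaceTime}
    (hU : IsOpen U) (hne : U.Nonempty) (hsub : U ⊆ halfSpace) : ∃ q ∈ U, P q := by
  have h1 : ∀ᵐ q ∂(volume.restrict U), P q := ae_restrict_of_ae_restrict_of_subset hsub h
  have h2 : (volume.restrict U) ≠ 0 := by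
    rw [Ne, Measure.restrict_eq_zero]
    exact (hU.measure_pos volume hne).ne'
  have : (ae (volume.restrict U)).NeBot := ae_neBot.2 h2
  obtain ⟨q, hq1, hq2⟩ := (h1.and (ae_restrict_mem hU.measurableSet)).exists
  exact ⟨q, hq2, hq1⟩

lemma one_add_norm_pow_inv_le (x x' : E3) (n : ℕ) (hx : x - x' ≠ 0) :
    ((1 + ‖x'‖) ^ n)⁻¹ ≤ (1 + ‖x‖) ^ n * (‖x - x'‖ ^ n)⁻¹ := by
  have hr : 0 < ‖x - x'‖ := norm_pos_iff.2 hx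
  have h1 : ‖x - x'‖ ≤ (1 + ‖x‖) * (1 + ‖x'‖) := by
    have := norm_sub_le x x'
    have := norm_nonneg x
    have := norm_nonneg x'
    nlinarith [mul_nonneg (norm_nonneg x) (norm_nonneg x')]
  rw [inv_le_iff_one_le_mul₀ (by positivity), mul_assoc, mul_left_comm, ← mul_pow,
    ← div_eq_inv_mul, le_div_iff₀ (by positivity), one_mul]
  exact pow_le_pow_left₀ hr.le h1 n

/-- From two good points far apart, a kernel that is nondegenerate outside a parabola gives
weighted integrability of the density. -/
lemma integrableOn_weight_of_good_points {N : E3 → ℝ → E3 → E3} {m : E3 → ℝ} {n : ℕ}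
    {w : SpaceTime → E3} {C₀ c : ℝ} (hc : 0 < c) (hC₀ : 0 < C₀) (hm : ∀ v, 0 ≤ m v)
    (hmm : AEStronglyMeasurable (fun q => m (w q)) (volume.restrict (halfSpace : Set SpaceTime)))
    (hN : ∀ z s v, z ≠ 0 → 0 < s → C₀ * s ≤ ‖z‖ ^ 2 → c * m v / ‖z‖ ^ n ≤ ‖N z s v‖)
    (hgood : ∀ᵐ q ∂(volume.restrict (halfSpace : Set SpaceTime)),
      IntegrableOn (fun p : SpaceTime => N (q.1 - p.1) (q.2 - p.2) (w p)) (univ ×ˢ Ioo 0 q.2))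
    {T : ℝ} (hT : 0 < T) :
    IntegrableOn (fun q : SpaceTime => m (w q) * ((1 + ‖q.1‖) ^ n)⁻¹) (univ ×ˢ Ioo 0 T) := by
  -- At a good point with time in (T, T + 1) all lags to the slab are below T + 1, so the lower
  -- bound on the kernel applies wherever |x - x'|² ≥ C₀(T + 1). Only a ball in space is missed.
  have key : ∀ q : SpaceTime, T < q.2 → q.2 < T + 1 →
      IntegrableOn (fun p : SpaceTime => N (q.1 - p.1) (q.2 - p.2) (w p)) (univ ×ˢ Ioo 0 q.2) →
      IntegrableOn (fun p : SpaceTime => m (w p) * ((1 + ‖p.1‖) ^ n)⁻¹)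
        ((univ ×ˢ Ioo 0 T) ∩ {p | C₀ * (T + 1) ≤ ‖q.1 - p.1‖ ^ 2}) := by
    intro q hq1 hq2 hq
    have hS : MeasurableSet {p : SpaceTime | C₀ * (T + 1) ≤ ‖q.1 - p.1‖ ^ 2} :=
      measurableSet_le measurable_const (by fun_prop)
    have hsub : ((univ ×ˢ Ioo 0 T) ∩ {p : SpaceTime | C₀ * (T + 1) ≤ ‖q.1 - p.1‖ ^ 2}) ⊆
        (univ ×ˢ Ioo 0 q.2 : Set SpaceTime) :=
      fun p hp => ⟨mem_univ _, hp.1.2.1, hp.1.2.2.trans hq1⟩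
    have h1 := ((hq.mono_set hsub).norm.const_mul (c⁻¹ * (1 + ‖q.1‖) ^ n))
    refine Integrable.mono' h1 ?_ ?_
    · refine AEStronglyMeasurable.mul ?_ ?_
      · exact hmm.mono_measure (Measure.restrict_mono
          (inter_subset_left.trans (slab_subset_halfSpace T)) le_rfl)
      · exact (by fun_prop : Measurable fun p : SpaceTime =>
          ((1 + ‖p.1‖) ^ n)⁻¹).aestronglyMeasurable
    · refine (ae_restrict_iff' ((measurableSet_slab T).inter hS)).2 (Eventually.of_forall ?_)
      rintro p ⟨hp1, hp2⟩
      have hp2' : C₀ * (T + 1) ≤ ‖q.1 - p.1‖ ^ 2 := hp2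
      have hr : 0 < ‖q.1 - p.1‖ ^ 2 := lt_of_lt_of_le (by positivity) hp2'
      have hz : q.1 - p.1 ≠ 0 := by
        intro h; rw [h] at hr; simp at hr
      have hr' : 0 < ‖q.1 - p.1‖ := norm_pos_iff.2 hz
      have hpT := hp1.2
      have hs : 0 < q.2 - p.2 := by linarith [hpT.2]
      have h2 := hN _ _ (w p) hz hs (le_trans (by
        have := hpT.1
        gcongr
        linarith) hp2')
      have h3 := one_add_norm_pow_inv_le q.1 p.1 n hz
      have hm0 := hm (w p)
      rw [Real.norm_of_nonneg (by positivity)]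
      calc m (w p) * ((1 + ‖p.1‖) ^ n)⁻¹ ≤ m (w p) * ((1 + ‖q.1‖) ^ n * (‖q.1 - p.1‖ ^ n)⁻¹) := by
            gcongr
        _ = c⁻¹ * (1 + ‖q.1‖) ^ n * (c * m (w p) / ‖q.1 - p.1‖ ^ n) := by field_simp
        _ ≤ _ := by gcongr
  -- Each good point misses a ball of radius D. The points are taken within distance one of the
  -- origin and of a point at distance 2D + 3, so their distance exceeds 2D, the missed balls are
  -- disjoint and the two regions cover the slab.
  set D := √(C₀ * (T + 1)) with hD
  have hD0 : 0 ≤ D := Real.sqrt_nonneg _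
  obtain ⟨q₁, hq₁, hg₁⟩ := exists_good_point hgood
    (U := Metric.ball (0 : E3) 1 ×ˢ Ioo T (T + 1)) (Metric.isOpen_ball.prod isOpen_Ioo)
    ⟨(0, T + 1 / 2), by simp; norm_num⟩ (fun q hq => mem_halfSpace.2 (hT.trans hq.2.1))
  obtain ⟨q₂, hq₂, hg₂⟩ := exists_good_point hgood
    (U := Metric.ball (EuclideanSpace.single 0 (2 * D + 3) : E3) 1 ×ˢ Ioo T (T + 1))
    (Metric.isOpen_ball.prod isOpen_Ioo)
    ⟨(EuclideanSpace.single 0 (2 * D + 3), T + 1 / 2), by simp; norm_num⟩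
    (fun q hq => mem_halfSpace.2 (hT.trans hq.2.1))
  have hU := (key q₁ hq₁.2.1 hq₁.2.2 hg₁).union (key q₂ hq₂.2.1 hq₂.2.2 hg₂)
  refine hU.mono_set fun p hp => ?_
  by_contra hcon
  have hcon' : ¬ (C₀ * (T + 1) ≤ ‖q₁.1 - p.1‖ ^ 2) ∧ ¬ (C₀ * (T + 1) ≤ ‖q₂.1 - p.1‖ ^ 2) :=
    ⟨fun h => hcon (Or.inl ⟨hp, h⟩), fun h => hcon (Or.inr ⟨hp, h⟩)⟩
  have hlt : ∀ z : E3, ¬ (C₀ * (T + 1) ≤ ‖z‖ ^ 2) → ‖z‖ < D := fun z hz =>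
    Real.lt_sqrt_of_sq_lt (not_le.1 hz)
  have l1 := hlt _ hcon'.1
  have l2 := hlt _ hcon'.2
  have b1 : ‖q₁.1‖ < 1 := by simpa using hq₁.1
  have b2 : ‖q₂.1 - EuclideanSpace.single 0 (2 * D + 3)‖ < 1 := by
    have := hq₂.1
    rwa [Metric.mem_ball, dist_eq_norm] at this
  have b3 : ‖(EuclideanSpace.single 0 (2 * D + 3) : E3)‖ = 2 * D + 3 := by
    rw [PiLp.norm_single, Real.norm_of_nonneg (by positivity)]
  have e : (EuclideanSpace.single 0 (2 * D + 3) : E3) =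
      (q₂.1 - p.1) - (q₁.1 - p.1) + q₁.1 - (q₂.1 - EuclideanSpace.single 0 (2 * D + 3)) := by
    abel
  have h5 : ‖(EuclideanSpace.single 0 (2 * D + 3) : E3)‖ ≤
      ‖q₂.1 - p.1‖ + ‖q₁.1 - p.1‖ + ‖q₁.1‖ + ‖q₂.1 - EuclideanSpace.single 0 (2 * D + 3)‖ := by
    conv_lhs => rw [e]
    refine (norm_sub_le _ _).trans (add_le_add_left ?_ _)
    refine (norm_add_le _ _).trans (add_le_add_left ?_ _)
    exact norm_sub_le _ _
  rw [b3] at h5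
  linarith

section Weights

variable {ν : ℝ} {u₀ : E3 → E3} {g u : SpaceTime → E3}

lemma integrableOn_weight_velocity (hν : 0 < ν) (hu : LocallySquareIntegrable u)
    (heq : ∀ᵐ q : SpaceTime ∂(volume.restrict (halfSpace : Set SpaceTime)),
      IntegralEquationAt ν u₀ g u q.1 q.2) {T : ℝ} (hT : 0 < T) :
    IntegrableOn (fun q : SpaceTime => ‖u q‖ ^ 2 * ((1 + ‖q.1‖) ^ 4)⁻¹) (univ ×ˢ Ioo 0 T) := by
  obtain ⟨C₀, hC₀, c, hc, h⟩ := exists_kernel_lower_bound hν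
  refine integrableOn_weight_of_good_points (N := nonlinearTerm ν) (m := fun v => ‖v‖ ^ 2)
    hc hC₀ (fun v => by positivity) (locallyIntegrableOn_norm_sq hu).aestronglyMeasurable
    (fun z s v hz hs hzs => (h z s v hz hs hzs).1) ?_ hT
  filter_upwards [heq] with q hq using hq.integrableOn_nonlinear

lemma integrableOn_weight_force (hν : 0 < ν)
    (hg : LocallyIntegrableOn g (halfSpace : Set SpaceTime))
    (heq : ∀ᵐ q : SpaceTime ∂(volume.restrict (halfSpace : Set SpaceTime)),
      IntegralEquationAt ν u₀ g u q.1 q.2) {T : ℝ} (hT : 0 < T) :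
    IntegrableOn (fun q : SpaceTime => ‖g q‖ * ((1 + ‖q.1‖) ^ 3)⁻¹) (univ ×ˢ Ioo 0 T) := by
  obtain ⟨C₀, hC₀, c, hc, h⟩ := exists_kernel_lower_bound hν
  refine integrableOn_weight_of_good_points (N := forcingTerm ν) (m := fun v => ‖v‖)
    hc hC₀ (fun v => by positivity) hg.aestronglyMeasurable.norm
    (fun z s v hz hs hzs => (h z s v hz hs hzs).2) ?_ hT
  filter_upwards [heq] with q hq using hq.integrableOn_forcing

/-- The equation holds at points with arbitrarily large t, and the heat kernel at a late time has a
wider profile than any prescribed Gaussian. -/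
lemma integrable_exp_mul_initial (hν : 0 < ν) (hu₀ : LocallyIntegrable u₀)
    (heq : ∀ᵐ q : SpaceTime ∂(volume.restrict (halfSpace : Set SpaceTime)),
      IntegralEquationAt ν u₀ g u q.1 q.2) {a : ℝ} (ha : 0 < a) :
    Integrable fun x : E3 => Real.exp (-a * ‖x‖ ^ 2) * ‖u₀ x‖ := by
  obtain ⟨⟨x, t⟩, hq, hgood⟩ := exists_good_point heq
    -- From |x - y|² ≤ 2|x|² + 2|y|² the kernel exponent |x - y|²/(4νt) costs at most |y|²/(2νt) in
    -- y, and this is at most a|y|² when t > 1/(2νa).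
    (U := univ ×ˢ Ioi (2 * ν * a)⁻¹) (isOpen_univ.prod isOpen_Ioi)
    ⟨(0, (2 * ν * a)⁻¹ + 1), by simp⟩ (fun q hq => mem_halfSpace.2
      (lt_trans (by positivity) hq.2))
  have ht : (2 * ν * a)⁻¹ < t := hq.2
  have ht0 : 0 < t := lt_trans (by positivity) ht
  have h1 := hgood.integrable_initial
  simp only at h1
  have h2 := (integrable_comp_sub_left (fun y => K (x - y) (2 * ν * t) • u₀ y) x).1 (by simpa using h1)
  set c : ℝ := (2 * Real.pi * (2 * ν * t)) ^ (-(3 / 2) : ℝ) with hc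
  have hc0 : 0 < c := by positivity
  refine Integrable.mono' (h2.norm.const_mul (c⁻¹ * Real.exp ((2 * ν * t)⁻¹ * ‖x‖ ^ 2))) ?_ ?_
  · exact (by fun_prop : Continuous fun x : E3 =>
      Real.exp (-a * ‖x‖ ^ 2)).aestronglyMeasurable.mul hu₀.aestronglyMeasurable.norm
  · refine Eventually.of_forall fun y => ?_
    rw [Real.norm_of_nonneg (by positivity), norm_smul, Real.norm_of_nonneg
      (K_nonneg _ (by positivity)), K_eq_const_mul_exp, ← hc]
    have h3 : Real.exp (-a * ‖y‖ ^ 2) ≤ Real.exp ((2 * ν * t)⁻¹ * ‖x‖ ^ 2) *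
        Real.exp (-(2 * (2 * ν * t))⁻¹ * ‖x - y‖ ^ 2) := by
      rw [← Real.exp_add, Real.exp_le_exp]
      have h4 : ‖x - y‖ ^ 2 ≤ 2 * ‖x‖ ^ 2 + 2 * ‖y‖ ^ 2 := by
        have := norm_sub_le x y
        nlinarith [norm_nonneg (x - y), sq_nonneg (‖x‖ - ‖y‖)]
      have h5 : (2 * ν * t)⁻¹ ≤ a := by
        rw [inv_le_comm₀ (by positivity) ha]
        have := ht.le
        rw [inv_le_iff_one_le_mul₀ (by positivity)] at this
        rw [inv_le_iff_one_le_mul₀ ha]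
        linarith
      have h6 : (2 * (2 * ν * t))⁻¹ = (2 * ν * t)⁻¹ / 2 := by field_simp
      rw [h6]
      have h7 : 0 < (2 * ν * t)⁻¹ := by positivity
      nlinarith [mul_le_mul_of_nonneg_left h4 h7.le, mul_le_mul_of_nonneg_right h5 (sq_nonneg ‖y‖)]
    calc _ ≤ Real.exp ((2 * ν * t)⁻¹ * ‖x‖ ^ 2) *
        Real.exp (-(2 * (2 * ν * t))⁻¹ * ‖x - y‖ ^ 2) * ‖u₀ y‖ := by gcongr
      _ = _ := by field_simp

end Weights

end

/-! ### Integrability of the parabolic kernel -/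

/-- A radial majorant of the parabolic kernel. -/
def radialMajorant (r : ℝ) : ℝ :=
  (Ioo (0 : ℝ) 1).indicator (fun r => r ^ (-(5 / 2) : ℝ)) r +
    (Ici (1 : ℝ)).indicator (fun r => r ^ (-4 : ℝ)) r

/-- In polar coordinates the integrand is r^(-1/2) near zero and r^(-2) at infinity. -/
lemma integrable_radialMajorant : Integrable fun z : E3 => radialMajorant ‖z‖ := by
  rw [integrable_fun_norm_addHaar (volume : Measure E3)]
  have hf : Module.finrank ℝ E3 = 3 := by simp [E3]
  rw [hf]
  have h1 : IntegrableOn (fun r : ℝ => (Ioo (0 : ℝ) 1).indicator (fun r => r ^ (-(1 / 2) : ℝ)) r)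
      (Ioi 0) := by
    rw [IntegrableOn, integrable_indicator_iff measurableSet_Ioo, IntegrableOn,
      Measure.restrict_restrict measurableSet_Ioo]
    exact ((intervalIntegral.integrableOn_Ioo_rpow_iff (s := (-(1 / 2) : ℝ)) one_pos).2
      (by norm_num)).mono_set inter_subset_left
  have h2 : IntegrableOn (fun r : ℝ => (Ici (1 : ℝ)).indicator (fun r => r ^ (-2 : ℝ)) r)
      (Ioi 0) := by
    rw [IntegrableOn, integrable_indicator_iff measurableSet_Ici, IntegrableOn,
      Measure.restrict_restrict measurableSet_Ici]
    exact ((integrableOn_Ici_iff_integrableOn_Ioi (by finiteness)).2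
      (integrableOn_Ioi_rpow_of_lt (by norm_num) one_pos)).mono_set inter_subset_left
  refine (h1.add h2).congr_fun (fun r hr => ?_) measurableSet_Ioi
  have hr0 : (0 : ℝ) < r := hr
  have e1 : r ^ 2 * r ^ (-(5 / 2) : ℝ) = r ^ (-(1 / 2) : ℝ) := by
    rw [← Real.rpow_natCast, ← Real.rpow_add hr0]; norm_num
  have e2 : r ^ 2 * r ^ (-4 : ℝ) = r ^ (-2 : ℝ) := by
    rw [← Real.rpow_natCast, ← Real.rpow_add hr0]; norm_num
  simp only [Pi.add_apply, radialMajorant, smul_eq_mul, mul_add]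
  by_cases h : r < 1
  · have hm : r ∈ Ioo (0 : ℝ) 1 := ⟨hr0, h⟩
    have hm' : r ∉ Ici (1 : ℝ) := not_le.2 h
    simp only [indicator_of_mem hm, indicator_of_notMem hm', ← e1, mul_zero, Nat.reduceSub]
  · simp [indicator, h, not_lt.1 h, ← e2]

/-- Near the origin the power -2 of the squared parabolic distance is split as -3/4 - 5/4. The first
part is charged to time and gives s^(-3/4), the second to space and gives |z|^(-5/2); both are
locally integrable, in dimensions one and three. -/
lemma parDist_sq_inv_le {ν s : ℝ} (hν : 0 < ν) (hs : 0 < s) {z : E3} (hz : z ≠ 0) :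
    (parDist ν z s ^ 2)⁻¹ ≤
      ((2 * ν) ^ (-(3 / 4) : ℝ) * s ^ (-(3 / 4) : ℝ) + 1) * radialMajorant ‖z‖ := by
  have hr : 0 < ‖z‖ := norm_pos_iff.2 hz
  have hA := parDist_pos hν hs z
  have hzA := norm_sq_le_parDist hν hs z
  have hsA : 2 * ν * s ≤ parDist ν z s := by unfold parDist; nlinarith
  have e0 : (parDist ν z s ^ 2)⁻¹ = parDist ν z s ^ (-2 : ℝ) := by
    rw [Real.rpow_neg hA.le]; norm_cast
  by_cases h : ‖z‖ < 1
  · have e1 : radialMajorant ‖z‖ = ‖z‖ ^ (-(5 / 2) : ℝ) := by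
      simp [radialMajorant, indicator, hr, h, not_le.2 h, -norm_pos_iff]
    have e2 : parDist ν z s ^ (-2 : ℝ) =
        parDist ν z s ^ (-(3 / 4) : ℝ) * parDist ν z s ^ (-(5 / 4) : ℝ) := by
      rw [← Real.rpow_add hA]; norm_num
    have h1 : parDist ν z s ^ (-(3 / 4) : ℝ) ≤ (2 * ν * s) ^ (-(3 / 4) : ℝ) :=
      Real.rpow_le_rpow_of_nonpos (by positivity) hsA (by norm_num)
    have h2 : parDist ν z s ^ (-(5 / 4) : ℝ) ≤ (‖z‖ ^ 2) ^ (-(5 / 4) : ℝ) :=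
      Real.rpow_le_rpow_of_nonpos (by positivity) hzA (by norm_num)
    have e3 : (‖z‖ ^ 2) ^ (-(5 / 4) : ℝ) = ‖z‖ ^ (-(5 / 2) : ℝ) := by
      rw [← Real.rpow_natCast, ← Real.rpow_mul hr.le]; norm_num
    rw [e3] at h2
    rw [Real.mul_rpow (by positivity) hs.le] at h1
    rw [e0, e1, e2, add_mul, one_mul]
    refine (mul_le_mul h1 h2 (by positivity) (by positivity)).trans ?_
    have : 0 ≤ ‖z‖ ^ (-(5 / 2) : ℝ) := by positivity
    linarith
  · have e1 : radialMajorant ‖z‖ = ‖z‖ ^ (-4 : ℝ) := by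
      simp [radialMajorant, indicator, h, not_lt.1 h]
    have h2 : parDist ν z s ^ (-2 : ℝ) ≤ (‖z‖ ^ 2) ^ (-2 : ℝ) :=
      Real.rpow_le_rpow_of_nonpos (by positivity) hzA (by norm_num)
    have e3 : (‖z‖ ^ 2) ^ (-2 : ℝ) = ‖z‖ ^ (-4 : ℝ) := by
      rw [← Real.rpow_natCast, ← Real.rpow_mul hr.le]; norm_num
    rw [e0, e1, ← e3, add_mul, one_mul]
    have : 0 ≤ (2 * ν) ^ (-(3 / 4) : ℝ) * s ^ (-(3 / 4) : ℝ) * (‖z‖ ^ 2) ^ (-2 : ℝ) := by positivity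
    linarith

lemma integrable_parDist {ν : ℝ} (hν : 0 < ν) (b : ℝ) :
    Integrable ((univ ×ˢ Ioo 0 b : Set SpaceTime).indicator
      fun q => (parDist ν q.1 q.2 ^ 2)⁻¹) := by
  have h1 : Integrable ((Ioo 0 b).indicator fun s : ℝ =>
      (2 * ν) ^ (-(3 / 4) : ℝ) * s ^ (-(3 / 4) : ℝ) + 1) := by
    rw [integrable_indicator_iff measurableSet_Ioo]
    refine Integrable.add (Integrable.const_mul ?_ _) (integrableOn_const (by simp))
    rcases le_or_gt b 0 with hb | hb
    · rw [Ioo_eq_empty (not_lt.2 hb)]; simp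
    · exact (intervalIntegral.integrableOn_Ioo_rpow_iff hb).2 (by norm_num)
  have h2 := integrable_radialMajorant.mul_prod h1
  refine Integrable.mono' h2 ?_ ?_
  · refine Measurable.aestronglyMeasurable (Measurable.indicator ?_ (measurableSet_slab b))
    unfold parDist; fun_prop
  · have h3 : ∀ᵐ q : SpaceTime, q.1 ≠ 0 := by
      have : ∀ᵐ z : E3, z ≠ 0 := by simp [ae_iff, measure_singleton]
      exact Measure.quasiMeasurePreserving_fst.ae this
    filter_upwards [h3] with q hq
    by_cases hq2 : q.2 ∈ Ioo 0 b
    · have hm : q ∈ (univ ×ˢ Ioo 0 b : Set SpaceTime) := ⟨mem_univ _, hq2⟩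
      rw [indicator_of_mem hm, indicator_of_mem hq2, Real.norm_of_nonneg (by positivity), mul_comm]
      exact parDist_sq_inv_le hν hq2.1 hq
    · have hm : q ∉ (univ ×ˢ Ioo 0 b : Set SpaceTime) := fun h => hq2 h.2
      rw [indicator_of_notMem hm, indicator_of_notMem hq2]
      simp

/-- Separates the weight in x' from the singularity. For |x| ≤ R one has 1 + |x'| ≤ (1 + R)(1 + √A),
where A is the squared parabolic distance, so A^(-n/2) times the weight is bounded for large A, and
n ≤ 4 makes it at most a multiple of A⁻² for small A. -/
lemma parDist_rpow_le {ν s R : ℝ} (hν : 0 < ν) (hs : 0 < s) {x x' : E3} (hx : ‖x‖ ≤ R)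
    {n : ℕ} (hn : n ≤ 4) :
    parDist ν (x - x') s ^ (-(n / 2) : ℝ) ≤
      2 * (2 * (1 + R)) ^ n * ((1 + ‖x'‖) ^ n)⁻¹ * (1 + (parDist ν (x - x') s ^ 2)⁻¹) := by
  have hR : 0 ≤ R := (norm_nonneg x).trans hx
  have hA := parDist_pos hν hs (x - x')
  have hzA := norm_sq_le_parDist hν hs (x - x')
  set A := parDist ν (x - x') s
  set z := x - x' with hz
  have hrA : 0 < √A := Real.sqrt_pos.2 hA
  have hzr : ‖z‖ ≤ √A := Real.le_sqrt_of_sq_le hzA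
  have h1 : 1 + ‖x'‖ ≤ (1 + R) * (1 + √A) := by
    have : ‖x'‖ ≤ ‖x‖ + ‖z‖ := by
      have e : x' = x - z := by rw [hz]; abel
      rw [e]; exact norm_sub_le _ _
    nlinarith [mul_nonneg hR hrA.le]
  have e1 : A ^ (-(n / 2) : ℝ) = (√A ^ n)⁻¹ := by
    rw [Real.sqrt_eq_rpow, ← Real.rpow_natCast, ← Real.rpow_mul hA.le, ← Real.rpow_neg hA.le]
    congr 1; ring
  have e2 : (A ^ 2)⁻¹ = (√A ^ 4)⁻¹ := by
    have : √A ^ 4 = (√A ^ 2) ^ 2 := by ring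
    rw [this, Real.sq_sqrt hA.le]
  have h2 : (1 + √A) ^ n ≤ 2 ^ n * (1 + √A ^ n) := by
    rcases le_total (√A) 1 with h | h
    · calc (1 + √A) ^ n ≤ 2 ^ n := pow_le_pow_left₀ (by positivity) (by linarith) n
        _ ≤ _ := le_mul_of_one_le_right (by positivity) (by have := pow_pos hrA n; linarith)
    · calc (1 + √A) ^ n ≤ (2 * √A) ^ n := pow_le_pow_left₀ (by positivity) (by linarith) n
        _ = 2 ^ n * √A ^ n := mul_pow _ _ _
        _ ≤ _ := by gcongr; linarith
  have h3 : (√A ^ n)⁻¹ ≤ 1 + (√A ^ 4)⁻¹ := by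
    rcases le_total (√A) 1 with h | h
    · have : (√A ^ n)⁻¹ ≤ (√A ^ 4)⁻¹ :=
        inv_anti₀ (by positivity) (pow_le_pow_of_le_one hrA.le h hn)
      linarith
    · have : (√A ^ n)⁻¹ ≤ 1 := inv_le_one_of_one_le₀ (one_le_pow₀ h)
      have : 0 ≤ (√A ^ 4)⁻¹ := by positivity
      linarith
  rw [e1, e2]
  have h4 : (1 + ‖x'‖) ^ n * (√A ^ n)⁻¹ ≤ 2 * (2 * (1 + R)) ^ n * (1 + (√A ^ 4)⁻¹) := by
    calc (1 + ‖x'‖) ^ n * (√A ^ n)⁻¹ ≤ ((1 + R) * (1 + √A)) ^ n * (√A ^ n)⁻¹ := by gcongr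
      _ = (1 + R) ^ n * (1 + √A) ^ n * (√A ^ n)⁻¹ := by rw [mul_pow]
      _ ≤ (1 + R) ^ n * (2 ^ n * (1 + √A ^ n)) * (√A ^ n)⁻¹ := by gcongr
      _ = (2 * (1 + R)) ^ n * ((√A ^ n)⁻¹ + 1) := by rw [mul_pow]; field_simp
      _ ≤ (2 * (1 + R)) ^ n * (2 * (1 + (√A ^ 4)⁻¹)) := by
          have : 0 ≤ (√A ^ 4)⁻¹ := by positivity
          gcongr; linarith
      _ = _ := by ring
  calc (√A ^ n)⁻¹ = ((1 + ‖x'‖) ^ n)⁻¹ * ((1 + ‖x'‖) ^ n * (√A ^ n)⁻¹) := by field_simp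
    _ ≤ ((1 + ‖x'‖) ^ n)⁻¹ * (2 * (2 * (1 + R)) ^ n * (1 + (√A ^ 4)⁻¹)) := by gcongr
    _ = _ := by ring

/-! ### Sources -/

/-- A kernel `N` and a field `w` whose Duhamel potential can be integrated against compactly
supported functions. -/
structure AdmissibleSource (ν : ℝ) (N : E3 → ℝ → E3 → E3) (w : SpaceTime → E3) (m : SpaceTime → ℝ)
    (n : ℕ) : Prop where
  measurable : Measurable fun p : E3 × ℝ × E3 => N p.1 p.2.1 p.2.2
  aestronglyMeasurable : AEStronglyMeasurable w (volume.restrict (halfSpace : Set SpaceTime))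
  bound : ∃ D, 0 ≤ D ∧ ∀ z s q, 0 < s → ‖N z s (w q)‖ ≤ D * parDist ν z s ^ (-(n / 2) : ℝ) * m q
  ae_integrableOn : ∀ᵐ q ∂(volume.restrict (halfSpace : Set SpaceTime)),
    IntegrableOn (fun p : SpaceTime => N (q.1 - p.1) (q.2 - p.2) (w p)) (univ ×ˢ Ioo 0 q.2)
  le_four : n ≤ 4
  nonneg : ∀ q, 0 ≤ m q
  integrableOn_weight : ∀ T, 0 < T →
    IntegrableOn (fun q : SpaceTime => m q * ((1 + ‖q.1‖) ^ n)⁻¹) (univ ×ˢ Ioo 0 T)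

/-- The integrand of a Duhamel potential tested against `f`. -/
def duhamelIntegrand (N : E3 → ℝ → E3 → E3) (w : SpaceTime → E3) (f : SpaceTime → ℝ) (v : E3) :
    SpaceTime × SpaceTime → ℝ :=
  {p : SpaceTime × SpaceTime | 0 < p.2.2 ∧ p.2.2 < p.1.2}.indicator fun p =>
    f p.1 * ⟪N (p.1.1 - p.2.1) (p.1.2 - p.2.2) (w p.2), v⟫

lemma measurableSet_causal :
    MeasurableSet {p : SpaceTime × SpaceTime | 0 < p.2.2 ∧ p.2.2 < p.1.2} :=
  MeasurableSet.inter (s₁ := {p : SpaceTime × SpaceTime | 0 < p.2.2})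
    (s₂ := {p : SpaceTime × SpaceTime | p.2.2 < p.1.2})
    (measurableSet_lt (by fun_prop) (by fun_prop)) (measurableSet_lt (by fun_prop) (by fun_prop))

/-- By `parDist_rpow_le` the integrand is dominated by two integrable functions of the pair of
points: a product of the weighted density with the indicator of a bounded set, and a convolution
integrand of the weighted density with the inverse square of the squared parabolic distance. -/
lemma AdmissibleSource.integrable_duhamelIntegrand {ν : ℝ} {N : E3 → ℝ → E3 → E3}
    {w : SpaceTime → E3} {m : SpaceTime → ℝ} {n : ℕ} (hN : AdmissibleSource ν N w m n) (hν : 0 < ν)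
    {f : SpaceTime → ℝ} (hf : Measurable f) {C R b : ℝ} (hR0 : 0 ≤ R) (hC : ∀ q, |f q| ≤ C)
    (hR : ∀ q, f q ≠ 0 → ‖q.1‖ ≤ R ∧ q.2 < b) (v : E3) :
    Integrable (duhamelIntegrand N w f v) := by
  obtain ⟨D, hD0, hD⟩ := hN.bound
  have hb : 0 < max b 1 := by positivity
  set h : SpaceTime → ℝ := (univ ×ˢ Ioo 0 (max b 1) : Set SpaceTime).indicator
    (fun q => m q * ((1 + ‖q.1‖) ^ n)⁻¹) with hh
  have hhi : Integrable h := (integrable_indicator_iff (measurableSet_slab _)).2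
    (hN.integrableOn_weight _ hb)
  set a : SpaceTime → ℝ := (univ ×ˢ Ioo 0 (max b 1) : Set SpaceTime).indicator
    (fun q => (parDist ν q.1 q.2 ^ 2)⁻¹) with ha
  have hai : Integrable a := integrable_parDist hν _
  set B : Set SpaceTime := Metric.closedBall (0 : E3) R ×ˢ Ioo 0 (max b 1) with hB
  have hBm : MeasurableSet B := Metric.isClosed_closedBall.measurableSet.prod measurableSet_Ioo
  have hBi : Integrable (B.indicator fun _ => (1 : ℝ)) := by
    rw [integrable_indicator_iff hBm]
    refine integrableOn_const (ne_of_lt ?_)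
    refine (measure_mono (prod_mono subset_rfl Ioo_subset_Icc_self)).trans_lt
      ((isCompact_closedBall (0 : E3) R).prod (isCompact_Icc (a := (0 : ℝ)) (b := max b 1))).measure_lt_top
  have hdom := ((hBi.mul_prod hhi).add (hhi.convolution_integrand (ContinuousLinearMap.mul ℝ ℝ) hai)
    ).const_mul (C * ‖v‖ * D * (2 * (2 * (1 + R)) ^ n))
  refine Integrable.mono' hdom ?_ (Eventually.of_forall fun p => ?_)
  -- The field is only known to be measurable on the half-space. Extending it by zero does not
  -- change the integrand, which is supported at positive source times.
  · have hw : AEMeasurable ((halfSpace : Set SpaceTime).indicator w) :=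
      (aemeasurable_indicator_iff isOpen_halfSpace.measurableSet).2
        hN.aestronglyMeasurable.aemeasurable
    have e : duhamelIntegrand N w f v =
        {p : SpaceTime × SpaceTime | 0 < p.2.2 ∧ p.2.2 < p.1.2}.indicator fun p =>
          f p.1 * ⟪N (p.1.1 - p.2.1) (p.1.2 - p.2.2) ((halfSpace : Set SpaceTime).indicator w p.2), v⟫ := by
      refine indicator_congr fun p hp => ?_
      rw [indicator_of_mem (mem_halfSpace.2 hp.1)]
    rw [e]
    refine AEMeasurable.aestronglyMeasurable (AEMeasurable.indicator ?_ measurableSet_causal)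
    refine AEMeasurable.mul (hf.comp measurable_fst).aemeasurable ?_
    refine AEMeasurable.inner (hN.measurable.comp_aemeasurable (f := fun p : SpaceTime × SpaceTime =>
      (p.1.1 - p.2.1, p.1.2 - p.2.2, (halfSpace : Set SpaceTime).indicator w p.2)) ?_)
      aemeasurable_const
    refine AEMeasurable.prodMk (by fun_prop) (AEMeasurable.prodMk (by fun_prop) ?_)
    exact hw.comp_quasiMeasurePreserving Measure.quasiMeasurePreserving_snd
  · have hC0 : 0 ≤ C := (abs_nonneg _).trans (hC 0)
    have hh0 : 0 ≤ h p.2 := indicator_nonneg (fun q _ => by have := hN.nonneg q; positivity) _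
    have ha0 : 0 ≤ a (p.1 - p.2) := indicator_nonneg (fun q _ => by positivity) _
    have hB0 : 0 ≤ B.indicator (fun _ => (1 : ℝ)) p.1 := indicator_nonneg (fun q _ => by positivity) _
    by_cases hp : (0 < p.2.2 ∧ p.2.2 < p.1.2) ∧ f p.1 ≠ 0
    · obtain ⟨⟨hp1, hp2⟩, hp3⟩ := hp
      obtain ⟨hx, ht⟩ := hR _ hp3
      have htb : p.1.2 < max b 1 := ht.trans_le (le_max_left _ _)
      have hs : 0 < p.1.2 - p.2.2 := sub_pos.2 hp2
      have e1 : h p.2 = m p.2 * ((1 + ‖p.2.1‖) ^ n)⁻¹ :=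
        indicator_of_mem (s := (univ ×ˢ Ioo 0 (max b 1) : Set SpaceTime)) ⟨mem_univ _, hp1, hp2.trans htb⟩ _
      have e2 : a (p.1 - p.2) = (parDist ν (p.1.1 - p.2.1) (p.1.2 - p.2.2) ^ 2)⁻¹ :=
        indicator_of_mem (s := (univ ×ˢ Ioo 0 (max b 1) : Set SpaceTime))
          ⟨mem_univ _, hs, by simp only [Prod.snd_sub]; linarith⟩ _
      have e3 : B.indicator (fun _ => (1 : ℝ)) p.1 = 1 :=
        indicator_of_mem (s := B) ⟨by simpa using hx, hp1.trans hp2, htb⟩ _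
      have h1 := hD (p.1.1 - p.2.1) _ p.2 hs
      have h2 := parDist_rpow_le hν hs (x' := p.2.1) hx hN.le_four
      have hm0 := hN.nonneg p.2
      simp only [duhamelIntegrand]
      rw [indicator_of_mem (by exact ⟨hp1, hp2⟩), norm_mul, Real.norm_eq_abs]
      calc _ ≤ C * (‖N (p.1.1 - p.2.1) (p.1.2 - p.2.2) (w p.2)‖ * ‖v‖) :=
            mul_le_mul (hC _) (norm_inner_le_norm _ _) (norm_nonneg _) hC0
        _ ≤ C * ((D * parDist ν (p.1.1 - p.2.1) (p.1.2 - p.2.2) ^ (-(n / 2) : ℝ) * m p.2) * ‖v‖) := by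
            gcongr
        _ ≤ C * ((D * (2 * (2 * (1 + R)) ^ n * ((1 + ‖p.2.1‖) ^ n)⁻¹ *
            (1 + (parDist ν (p.1.1 - p.2.1) (p.1.2 - p.2.2) ^ 2)⁻¹)) * m p.2) * ‖v‖) := by
            gcongr
        _ = _ := by
            simp only [Pi.add_apply, ContinuousLinearMap.mul_apply', e1, e2, e3]
            ring
    · have e : duhamelIntegrand N w f v p = 0 := by
        simp only [duhamelIntegrand, indicator_apply_eq_zero, mem_ofPred_eq]
        intro hp'
        rw [not_and, not_not] at hp
        rw [hp hp', zero_mul]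
      rw [e, norm_zero]
      simp only [Pi.add_apply, ContinuousLinearMap.mul_apply']
      positivity

section

/-! ### Duhamel potentials tested against functions -/

/-- The Duhamel potential of the source `w` with kernel `N`. -/
def duhamel (N : E3 → ℝ → E3 → E3) (w : SpaceTime → E3) (q : SpaceTime) : E3 :=
  ∫ p in (univ ×ˢ Ioo 0 q.2 : Set SpaceTime), N (q.1 - p.1) (q.2 - p.2) (w p)

section

variable {ν : ℝ} {N : E3 → ℝ → E3 → E3} {w : SpaceTime → E3} {m : SpaceTime → ℝ} {n : ℕ}

lemma duhamelIntegrand_apply_of_mem {f : SpaceTime → ℝ} {v : E3} {p : SpaceTime × SpaceTime}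
    (h1 : 0 < p.2.2) (h2 : p.2.2 < p.1.2) :
    duhamelIntegrand N w f v p = f p.1 * ⟪N (p.1.1 - p.2.1) (p.1.2 - p.2.2) (w p.2), v⟫ :=
  indicator_of_mem (s := {p : SpaceTime × SpaceTime | 0 < p.2.2 ∧ p.2.2 < p.1.2}) ⟨h1, h2⟩ _

lemma duhamelIntegrand_apply_of_not {f : SpaceTime → ℝ} {v : E3} {p : SpaceTime × SpaceTime}
    (h : ¬ (0 < p.2.2 ∧ p.2.2 < p.1.2)) : duhamelIntegrand N w f v p = 0 :=
  indicator_of_notMem (s := {p : SpaceTime × SpaceTime | 0 < p.2.2 ∧ p.2.2 < p.1.2}) h _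

lemma integral_duhamelIntegrand {f : SpaceTime → ℝ} {v : E3} {q : SpaceTime}
    (h : 0 < q.2 →
      IntegrableOn (fun p : SpaceTime => N (q.1 - p.1) (q.2 - p.2) (w p)) (univ ×ˢ Ioo 0 q.2)) :
    ∫ p, duhamelIntegrand N w f v (q, p) = f q * ⟪duhamel N w q, v⟫ := by
  have e : ∀ p, duhamelIntegrand N w f v (q, p) = (univ ×ˢ Ioo 0 q.2 : Set SpaceTime).indicator
      (fun p => f q * ⟪N (q.1 - p.1) (q.2 - p.2) (w p), v⟫) p := by
    intro p
    by_cases hp : p.2 ∈ Ioo 0 q.2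
    · rw [indicator_of_mem (show p ∈ (univ ×ˢ Ioo 0 q.2 : Set SpaceTime) from ⟨mem_univ _, hp⟩),
        duhamelIntegrand_apply_of_mem hp.1 hp.2]
    · rw [indicator_of_notMem (fun h : p ∈ (univ ×ˢ Ioo 0 q.2 : Set SpaceTime) => hp h.2),
        duhamelIntegrand_apply_of_not (p := (q, p)) hp]
  simp_rw [e]
  rw [integral_indicator (measurableSet_slab _), integral_const_mul, duhamel]
  congr 1
  by_cases hq : 0 < q.2
  · simp_rw [real_inner_comm v]
    rw [integral_inner (h hq)]
  · simp [Ioo_eq_empty hq]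

lemma AdmissibleSource.ae_integral_duhamelIntegrand (hN : AdmissibleSource ν N w m n) (f : SpaceTime → ℝ) (v : E3) :
    ∀ᵐ q, ∫ p, duhamelIntegrand N w f v (q, p) = f q * ⟪duhamel N w q, v⟫ := by
  filter_upwards [(ae_restrict_iff' isOpen_halfSpace.measurableSet).1 hN.ae_integrableOn] with q hq
  exact integral_duhamelIntegrand fun h => hq (mem_halfSpace.2 h)

lemma AdmissibleSource.integrable_mul_duhamel (hN : AdmissibleSource ν N w m n) (hν : 0 < ν)
    {f : SpaceTime → ℝ} (hf : Measurable f) {C R b : ℝ} (hR0 : 0 ≤ R) (hC : ∀ q, |f q| ≤ C)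
    (hR : ∀ q, f q ≠ 0 → ‖q.1‖ ≤ R ∧ q.2 < b) (v : E3) :
    Integrable fun q => f q * ⟪duhamel N w q, v⟫ :=
  ((hN.integrable_duhamelIntegrand hν hf hR0 hC hR v).integral_prod_left).congr
    (hN.ae_integral_duhamelIntegrand f v)

/-- Fubini for Duhamel potentials: integrate in the observation point first. -/
lemma AdmissibleSource.sum_integral_mul_duhamel (hN : AdmissibleSource ν N w m n) (hν : 0 < ν)
    {ι : Type*} [Fintype ι] {f : ι → SpaceTime → ℝ} (hf : ∀ i, Measurable (f i)) {C R b : ℝ} (hR0 : 0 ≤ R)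
    (hC : ∀ i q, |f i q| ≤ C) (hR : ∀ i q, f i q ≠ 0 → ‖q.1‖ ≤ R ∧ q.2 < b) (v : ι → E3) :
    ∑ i, ∫ q, f i q * ⟪duhamel N w q, v i⟫ =
      ∫ q' in (halfSpace : Set SpaceTime), ∫ s in Ioi (0 : ℝ),
        ∑ i, ∫ x, f i (x, q'.2 + s) * ⟪N (x - q'.1) s (w q'), v i⟫ := by
  have hi := fun i => hN.integrable_duhamelIntegrand hν (hf i) hR0 (hC i) (hR i) (v i)
  have h1 : ∀ i, ∫ q, f i q * ⟪duhamel N w q, v i⟫ =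
      ∫ q', ∫ q, duhamelIntegrand N w (f i) (v i) (q, q') := by
    intro i
    rw [← integral_integral_swap (f := fun q q' => duhamelIntegrand N w (f i) (v i) (q, q')) (hi i)]
    exact integral_congr_ae
      ((hN.ae_integral_duhamelIntegrand (f i) (v i)).mono fun q hq => hq.symm)
  simp_rw [h1]
  rw [← integral_finsetSum _ (fun i _ => (hi i).integral_prod_right),
    ← setIntegral_eq_integral_of_forall_compl_eq_zero (s := (halfSpace : Set SpaceTime))]
  · refine setIntegral_congr_ae isOpen_halfSpace.measurableSet ?_
    have hae : ∀ᵐ q', ∀ i, Integrable fun q => duhamelIntegrand N w (f i) (v i) (q, q') :=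
      ae_all_iff.2 fun i => (hi i).prod_left_ae
    filter_upwards [hae] with q' hq' hmem
    have ht' : 0 < q'.2 := mem_halfSpace.1 hmem
    -- The observation time is written as source time plus lag s; causality then restricts s to (0,
    -- ∞).
    have h2 : ∀ i, ∫ q, duhamelIntegrand N w (f i) (v i) (q, q') =
        ∫ s : ℝ, ∫ x : E3, duhamelIntegrand N w (f i) (v i) ((x, q'.2 + s), q') := by
      intro i
      rw [integral_add_left_eq_self (fun t : ℝ =>
        ∫ x : E3, duhamelIntegrand N w (f i) (v i) ((x, t), q')) q'.2]
      exact integral_prod_symm _ (hq' i)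
    have h3 : ∀ i, Integrable fun s : ℝ =>
        ∫ x : E3, duhamelIntegrand N w (f i) (v i) ((x, q'.2 + s), q') := fun i =>
      Integrable.comp_add_left (f := fun t : ℝ =>
        ∫ x : E3, duhamelIntegrand N w (f i) (v i) ((x, t), q')) (hq' i).integral_prod_right q'.2
    simp_rw [h2]
    rw [← integral_finsetSum _ (fun i _ => h3 i),
      ← setIntegral_eq_integral_of_forall_compl_eq_zero (s := Ioi (0 : ℝ))]
    · refine setIntegral_congr_fun measurableSet_Ioi fun s hs => ?_
      refine Finset.sum_congr rfl fun i _ => integral_congr_ae (Eventually.of_forall fun x => ?_)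
      have hs' : (0 : ℝ) < s := hs
      simp only
      rw [duhamelIntegrand_apply_of_mem (by exact ht') (by simpa using hs')]
      simp
    · intro s hs
      refine Finset.sum_eq_zero fun i _ => ?_
      rw [← integral_zero E3 ℝ]
      refine integral_congr_ae (Eventually.of_forall fun x => ?_)
      exact duhamelIntegrand_apply_of_not fun h => hs (by simpa using h.2)
  · intro q' hq'
    refine Finset.sum_eq_zero fun i _ => ?_
    rw [← integral_zero SpaceTime ℝ]
    refine integral_congr_ae (Eventually.of_forall fun q => ?_)
    exact duhamelIntegrand_apply_of_not fun h => hq' (mem_halfSpace.2 h.1)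

/-- Fubini for Duhamel potentials on almost every time slice. -/
lemma AdmissibleSource.ae_integral_slice_mul_duhamel (hN : AdmissibleSource ν N w m n)
    (hν : 0 < ν) {φ : E3 → ℝ} (hφ : Measurable φ) {C R : ℝ} (hR0 : 0 ≤ R) (hC : ∀ x, |φ x| ≤ C)
    (hR : ∀ x, φ x ≠ 0 → ‖x‖ ≤ R) (v : E3) (b : ℝ) :
    ∀ᵐ t : ℝ, t < b → (Integrable fun x => φ x * ⟪duhamel N w (x, t), v⟫) ∧
      ∫ x, φ x * ⟪duhamel N w (x, t), v⟫ =
        ∫ q' in (univ ×ˢ Ioo 0 t : Set SpaceTime),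
          ∫ x, φ x * ⟪N (x - q'.1) (t - q'.2) (w q'), v⟫ := by
  -- Extending φ constantly in time up to b gives a function to which space-time integrability
  -- applies. Regrouping the variables as (t, (x, p)) then yields, for almost every t, Fubini in (x,
  -- p).
  set f : SpaceTime → ℝ := fun q => (Iio b).indicator (fun _ => φ q.1) q.2 with hf
  have hfm : Measurable f := by
    have : f = {q : SpaceTime | q.2 < b}.indicator fun q => φ q.1 := by
      ext q; simp [hf, indicator]
    rw [this]
    exact (hφ.comp measurable_fst).indicator (measurableSet_lt (by fun_prop) (by fun_prop))
  have hC0 : 0 ≤ C := (abs_nonneg _).trans (hC 0)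
  have hfC : ∀ q, |f q| ≤ C := by
    intro q
    by_cases h : q.2 < b
    · simpa [hf, indicator, h] using hC q.1
    · simpa [hf, indicator, h] using hC0
  have hfR : ∀ q, f q ≠ 0 → ‖q.1‖ ≤ R ∧ q.2 < b := by
    intro q hq
    by_cases h : q.2 < b
    · exact ⟨hR q.1 (by simpa [hf, indicator, h] using hq), h⟩
    · simp [hf, indicator, h] at hq
  have hi := hN.integrable_duhamelIntegrand hν hfm hR0 hfC hfR v
  have hmp : MeasurePreserving
      (fun p : ℝ × E3 × SpaceTime => (((p.2.1, p.1), p.2.2) : SpaceTime × SpaceTime))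
      ((volume : Measure ℝ).prod ((volume : Measure E3).prod (volume : Measure SpaceTime)))
      ((volume : Measure SpaceTime).prod (volume : Measure SpaceTime)) := by
    have h1 : MeasurePreserving (MeasurableEquiv.prodAssoc (α := ℝ) (β := E3) (γ := SpaceTime)) 
        (((volume : Measure ℝ).prod (volume : Measure E3)).prod (volume : Measure SpaceTime))
        ((volume : Measure ℝ).prod ((volume : Measure E3).prod (volume : Measure SpaceTime))) :=
      ⟨MeasurableEquiv.measurable _, Measure.prodAssoc_prod⟩
    have h2 := (Measure.measurePreserving_swap (μ := (volume : Measure ℝ))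
      (ν := (volume : Measure E3))).prod (MeasurePreserving.id (volume : Measure SpaceTime))
    exact h2.comp (h1.symm _)
  have hi2 := (hmp.integrable_comp hi.aestronglyMeasurable).2 hi
  have hae : ∀ᵐ t : ℝ, ∀ᵐ x : E3, ∫ p, duhamelIntegrand N w f v ((x, t), p) =
      f (x, t) * ⟪duhamel N w (x, t), v⟫ := by
    have := (Measure.measurePreserving_swap (μ := (volume : Measure ℝ))
      (ν := (volume : Measure E3))).quasiMeasurePreserving.ae
        (hN.ae_integral_duhamelIntegrand f v)
    exact Measure.ae_ae_of_ae_prod this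
  filter_upwards [hi2.prod_right_ae, hae] with t ht1 ht2 htb
  have hfe : ∀ x, f (x, t) = φ x := fun x => by simp [hf, indicator, htb]
  simp only [hfe] at ht2
  refine ⟨ht1.integral_prod_left.congr ht2, ?_⟩
  rw [← integral_congr_ae ht2,
    integral_integral_swap (f := fun x p => duhamelIntegrand N w f v ((x, t), p)) ht1,
    ← integral_indicator (measurableSet_slab t)]
  refine integral_congr_ae (Eventually.of_forall fun p => ?_)
  by_cases hp : p.2 ∈ Ioo 0 t
  · simp only [indicator_of_mem (show p ∈ (univ ×ˢ Ioo 0 t : Set SpaceTime) from ⟨mem_univ _, hp⟩)]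
    refine integral_congr_ae (Eventually.of_forall fun x => ?_)
    simp only
    rw [duhamelIntegrand_apply_of_mem hp.1 hp.2, hfe]
  · simp only [indicator_of_notMem (fun h : p ∈ (univ ×ˢ Ioo 0 t : Set SpaceTime) => hp h.2)]
    rw [← integral_zero E3 ℝ]
    refine integral_congr_ae (Eventually.of_forall fun x => ?_)
    exact duhamelIntegrand_apply_of_not hp

end

end

section

section Sources

variable {ν : ℝ} {u₀ : E3 → E3} {g u : SpaceTime → E3}

lemma admissibleSource_nonlinear (hν : 0 < ν) (hu : LocallySquareIntegrable u)
    (heq : ∀ᵐ q : SpaceTime ∂(volume.restrict (halfSpace : Set SpaceTime)),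
      IntegralEquationAt ν u₀ g u q.1 q.2) :
    AdmissibleSource ν (nonlinearTerm ν) u (fun q => ‖u q‖ ^ 2) 4 where
  measurable := measurable_nonlinearTerm ν
  aestronglyMeasurable := (locallyIntegrableOn_velocity hu).aestronglyMeasurable
  bound := by
    refine ⟨10 ^ 6, by norm_num, fun z s q hs => ?_⟩
    have hA := parDist_pos hν hs z
    have e : parDist ν z s ^ (-((4 : ℕ) / 2) : ℝ) = (parDist ν z s ^ 2)⁻¹ := by
      rw [Real.rpow_neg hA.le]; norm_num
    rw [e]
    -- At z = 0 inverses and the unit vector take the default value zero, so the nonlinear term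
    -- vanishes.
    by_cases hz : z = 0
    · subst hz
      have : nonlinearTerm ν 0 s (u q) = 0 := by simp [nonlinearTerm, b₁, b₂, unitVec]
      rw [this, norm_zero]
      positivity
    · exact norm_nonlinearTerm_le hν hs hz _
  ae_integrableOn := heq.mono fun q hq => hq.integrableOn_nonlinear
  le_four := le_rfl
  nonneg := fun q => by positivity
  integrableOn_weight := fun T hT => integrableOn_weight_velocity hν hu heq hT

lemma admissibleSource_forcing (hν : 0 < ν)
    (hg : LocallyIntegrableOn g (halfSpace : Set SpaceTime))
    (heq : ∀ᵐ q : SpaceTime ∂(volume.restrict (halfSpace : Set SpaceTime)),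
      IntegralEquationAt ν u₀ g u q.1 q.2) :
    AdmissibleSource ν (forcingTerm ν) g (fun q => ‖g q‖) 3 where
  measurable := measurable_forcingTerm ν
  aestronglyMeasurable := hg.aestronglyMeasurable
  bound := by
    refine ⟨10 ^ 6, by norm_num, fun z s q hs => ?_⟩
    have hA := parDist_pos hν hs z
    -- At z = 0 the ball mass term has the default coefficient zero and the unit vector is zero,
    -- which leaves K times the force.
    by_cases hz : z = 0
    · subst hz
      have e : forcingTerm ν 0 s (g q) = K 0 (2 * ν * s) • g q := by
        simp [forcingTerm, perp, unitVec]
      have hK0 := K_nonneg (0 : E3) (t := 2 * ν * s) (by positivity)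
      have hK : K (0 : E3) (2 * ν * s) ≤ 10 ^ 5 * parDist ν 0 s ^ (-(3 / 2) : ℝ) := by
        simpa using invVar_pow_mul_K_le hν hs (0 : E3) (n := 0) (by norm_num)
      rw [e, norm_smul, Real.norm_of_nonneg hK0]
      refine mul_le_mul_of_nonneg_right (hK.trans ?_) (norm_nonneg _)
      have : 0 ≤ parDist ν (0 : E3) s ^ (-(3 / 2) : ℝ) := by positivity
      push_cast
      linarith
    · exact_mod_cast norm_forcingTerm_le hν hs hz _
  ae_integrableOn := heq.mono fun q hq => hq.integrableOn_forcing
  le_four := by norm_num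
  nonneg := fun q => by positivity
  integrableOn_weight := fun T hT => integrableOn_weight_force hν hg heq hT

end Sources

/-! ### The caloric extension of the initial velocity -/

/-- The caloric extension of the initial velocity. -/
def caloric (ν : ℝ) (u₀ : E3 → E3) (q : SpaceTime) : E3 :=
  ∫ y, K y (2 * ν * q.2) • u₀ (q.1 - y)

lemma caloric_eq (ν : ℝ) (u₀ : E3 → E3) (q : SpaceTime) :
    caloric ν u₀ q = ∫ x', K (q.1 - x') (2 * ν * q.2) • u₀ x' := by
  rw [caloric, ← integral_sub_left_eq_self (fun x' => K (q.1 - x') (2 * ν * q.2) • u₀ x') volume q.1]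
  simp

/-- A Gaussian majorant in x' that is uniform for a ≤ t ≤ b and |x| ≤ R. The prefactor is largest at
t = a, the exponent is weakest at t = b, and |x - x'|² ≥ |x'|²/2 - R². -/
lemma K_sub_le {ν a b t R : ℝ} (hν : 0 < ν) (ha : 0 < a) (hat : a ≤ t) (htb : t ≤ b) {x : E3}
    (hx : ‖x‖ ≤ R) (x' : E3) :
    K (x - x') (2 * ν * t) ≤ (2 * Real.pi * (2 * ν * a)) ^ (-(3 / 2) : ℝ) *
      Real.exp ((2 * (2 * ν * b))⁻¹ * R ^ 2) * Real.exp (-(8 * ν * b)⁻¹ * ‖x'‖ ^ 2) := by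
  have ht : 0 < t := ha.trans_le hat
  have hb : 0 < b := ht.trans_le htb
  rw [K_eq_const_mul_exp, mul_assoc ((2 * Real.pi * (2 * ν * a)) ^ (-(3 / 2) : ℝ))]
  have h0 : (2 * Real.pi * (2 * ν * t)) ^ (-(3 / 2) : ℝ) ≤
      (2 * Real.pi * (2 * ν * a)) ^ (-(3 / 2) : ℝ) :=
    Real.rpow_le_rpow_of_nonpos (by positivity) (by gcongr) (by norm_num)
  refine mul_le_mul h0 ?_ (by positivity) (by positivity)
  rw [← Real.exp_add, Real.exp_le_exp]
  have h1 : (2 * (2 * ν * b))⁻¹ ≤ (2 * (2 * ν * t))⁻¹ := inv_anti₀ (by positivity) (by gcongr)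
  have h2 : ‖x'‖ ^ 2 ≤ 2 * ‖x - x'‖ ^ 2 + 2 * R ^ 2 := by
    have h3 : ‖x'‖ ≤ ‖x‖ + ‖x - x'‖ := by
      have e : x' = x - (x - x') := by abel
      conv_lhs => rw [e]
      exact norm_sub_le _ _
    nlinarith [norm_nonneg x', norm_nonneg x, norm_nonneg (x - x'), sq_nonneg (R - ‖x - x'‖)]
  have h4 : (8 * ν * b)⁻¹ = (2 * (2 * ν * b))⁻¹ / 2 := by field_simp; norm_num
  have h5 : 0 < (2 * (2 * ν * b))⁻¹ := by positivity
  rw [h4]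
  nlinarith [mul_le_mul_of_nonneg_right h1 (sq_nonneg ‖x - x'‖), mul_le_mul_of_nonneg_left h2 h5.le]

section Caloric

variable {ν : ℝ} {u₀ : E3 → E3}

lemma integrable_K_smul (hν : 0 < ν) (hm : AEStronglyMeasurable u₀)
    (hint : ∀ a : ℝ, 0 < a → Integrable fun x : E3 => Real.exp (-a * ‖x‖ ^ 2) * ‖u₀ x‖)
    (x : E3) {t : ℝ} (ht : 0 < t) : Integrable fun x' => K (x - x') (2 * ν * t) • u₀ x' := by
  refine Integrable.mono' ((hint (8 * ν * t)⁻¹ (by positivity)).const_mul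
    ((2 * Real.pi * (2 * ν * t)) ^ (-(3 / 2) : ℝ) *
      Real.exp ((2 * (2 * ν * t))⁻¹ * ‖x‖ ^ 2))) ?_ (Eventually.of_forall fun x' => ?_)
  · exact ((continuous_K_space _).comp (by fun_prop : Continuous fun x' => x - x')
      ).aestronglyMeasurable.smul hm
  · rw [norm_smul, Real.norm_of_nonneg (K_nonneg _ (by positivity)), ← mul_assoc]
    exact mul_le_mul_of_nonneg_right (K_sub_le hν ht le_rfl le_rfl le_rfl x') (norm_nonneg _)

lemma inner_caloric (hν : 0 < ν) (hm : AEStronglyMeasurable u₀)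
    (hint : ∀ a : ℝ, 0 < a → Integrable fun x : E3 => Real.exp (-a * ‖x‖ ^ 2) * ‖u₀ x‖)
    {q : SpaceTime} (ht : 0 < q.2) (v : E3) :
    ⟪caloric ν u₀ q, v⟫ = ∫ x', K (q.1 - x') (2 * ν * q.2) * ⟪u₀ x', v⟫ := by
  rw [caloric_eq, real_inner_comm, ← integral_inner (integrable_K_smul hν hm hint q.1 ht)]
  simp_rw [inner_smul_right, real_inner_comm v]

/-- Joint integrability of the caloric extension tested against a function on any space of
observation points. -/
lemma integrable_mul_K_mul_inner {α : Type*} [MeasurableSpace α] {μ : Measure α} [SFinite μ]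
    (hν : 0 < ν) (hm : AEStronglyMeasurable u₀)
    (hint : ∀ a : ℝ, 0 < a → Integrable fun x : E3 => Real.exp (-a * ‖x‖ ^ 2) * ‖u₀ x‖)
    {X : α → E3} {τ : α → ℝ} (hX : Measurable X) (hτ : Measurable τ)
    {f : α → ℝ} (hf : Integrable f μ) {R a b : ℝ} (ha : 0 < a)
    (hR : ∀ q, f q ≠ 0 → ‖X q‖ ≤ R ∧ a ≤ τ q ∧ τ q ≤ b) (hb : 0 < b) (v : E3) :
    Integrable (fun p : α × E3 => f p.1 * (K (X p.1 - p.2) (2 * ν * τ p.1) * ⟪u₀ p.2, v⟫))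
      (μ.prod volume) := by
  have h1 := (hf.norm.mul_prod (hint (8 * ν * b)⁻¹ (by positivity))).const_mul
    ((2 * Real.pi * (2 * ν * a)) ^ (-(3 / 2) : ℝ) *
      Real.exp ((2 * (2 * ν * b))⁻¹ * R ^ 2) * ‖v‖)
  refine Integrable.mono' h1 ?_ (Eventually.of_forall fun p => ?_)
  · refine AEStronglyMeasurable.mul (hf.aestronglyMeasurable.comp_fst) ?_
    refine AEStronglyMeasurable.mul ?_ (AEStronglyMeasurable.inner hm.comp_snd
      aestronglyMeasurable_const)
    exact (measurable_K.comp (by fun_prop : Measurable fun p : α × E3 =>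
      (X p.1 - p.2, 2 * ν * τ p.1))).aestronglyMeasurable
  · by_cases hp : f p.1 = 0
    · simp [hp]
    · obtain ⟨hx, h2, h3⟩ := hR _ hp
      have hτ0 : 0 < τ p.1 := ha.trans_le h2
      have hK := K_sub_le hν ha h2 h3 hx p.2
      rw [norm_mul, norm_mul, Real.norm_of_nonneg (K_nonneg _ (by positivity))]
      calc ‖f p.1‖ * (K (X p.1 - p.2) (2 * ν * τ p.1) * ‖⟪u₀ p.2, v⟫‖)
          ≤ ‖f p.1‖ * (((2 * Real.pi * (2 * ν * a)) ^ (-(3 / 2) : ℝ) *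
            Real.exp ((2 * (2 * ν * b))⁻¹ * R ^ 2) * Real.exp (-(8 * ν * b)⁻¹ * ‖p.2‖ ^ 2)) *
              (‖u₀ p.2‖ * ‖v‖)) := by
            gcongr
            exact norm_inner_le_norm _ _
        _ = _ := by ring

lemma integral_mul_inner_caloric {α : Type*} [MeasurableSpace α] {μ : Measure α} [SFinite μ]
    (hν : 0 < ν) (hm : AEStronglyMeasurable u₀)
    (hint : ∀ a : ℝ, 0 < a → Integrable fun x : E3 => Real.exp (-a * ‖x‖ ^ 2) * ‖u₀ x‖)
    {X : α → E3} {τ : α → ℝ} (hX : Measurable X) (hτ : Measurable τ)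
    {f : α → ℝ} (hf : Integrable f μ) {R a b : ℝ} (ha : 0 < a)
    (hR : ∀ q, f q ≠ 0 → ‖X q‖ ≤ R ∧ a ≤ τ q ∧ τ q ≤ b) (hb : 0 < b) (v : E3) :
    Integrable (fun q => f q * ⟪caloric ν u₀ (X q, τ q), v⟫) μ ∧
      ∫ q, f q * ⟪caloric ν u₀ (X q, τ q), v⟫ ∂μ =
        ∫ x', ∫ q, f q * (K (X q - x') (2 * ν * τ q) * ⟪u₀ x', v⟫) ∂μ := by
  have h1 := integrable_mul_K_mul_inner hν hm hint hX hτ hf ha hR hb v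
  have e : ∀ q, f q * ⟪caloric ν u₀ (X q, τ q), v⟫ =
      ∫ x', f q * (K (X q - x') (2 * ν * τ q) * ⟪u₀ x', v⟫) := by
    intro q
    by_cases hq : f q = 0
    · simp [hq]
    · rw [integral_const_mul, inner_caloric hν hm hint (ha.trans_le (hR q hq).2.1)]
  simp_rw [e]
  exact ⟨h1.integral_prod_left, integral_integral_swap h1⟩

end Caloric

lemma exists_box {φ : SpaceTime → ℝ} (hφ : HasCompactSupport φ)
    (hs : tsupport φ ⊆ halfSpace) :
    ∃ R a b, 0 ≤ R ∧ 0 < a ∧ 0 < b ∧ ∀ q, φ q ≠ 0 → ‖q.1‖ ≤ R ∧ a ≤ q.2 ∧ q.2 < b := by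
  obtain ⟨R, hR0, hR⟩ := exists_forall_norm_le_of_ne_zero hφ
  rcases (tsupport φ).eq_empty_or_nonempty with h | h
  · refine ⟨1, 1, 1, by norm_num, by norm_num, by norm_num, fun q hq => ?_⟩
    have := subset_tsupport φ hq
    rw [h] at this
    exact absurd this (notMem_empty q)
  · obtain ⟨q₀, hq₀, hmin⟩ := hφ.isCompact.exists_isMinOn h continuous_snd.continuousOn
    refine ⟨R, q₀.2, R + 1, hR0.le, mem_halfSpace.1 (hs hq₀), by positivity, fun q hq => ?_⟩
    obtain ⟨h1, h2⟩ := hR q.1 q.2 hq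
    exact ⟨h1, hmin (subset_tsupport φ hq), by linarith [le_abs_self q.2]⟩

lemma integral_spaceTime_eq {f : SpaceTime → ℝ} (hf : Integrable f) (h0 : ∀ q, q.2 ≤ 0 → f q = 0) :
    ∫ q, f q = ∫ s in Ioi (0 : ℝ), ∫ x, f (x, s) := by
  rw [setIntegral_eq_integral_of_forall_compl_eq_zero (s := Ioi (0 : ℝ))]
  · exact integral_prod_symm _ hf
  · intro s hs
    rw [← integral_zero E3 ℝ]
    exact integral_congr_ae (Eventually.of_forall fun x => h0 _ (not_lt.1 hs))

section Tests

variable {ν : ℝ} {u₀ : E3 → E3}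

/-- The caloric extension solves the heat equation. -/
lemma integral_backwardHeat_mul_inner_caloric (hν : 0 < ν) (hm : AEStronglyMeasurable u₀)
    (hint : ∀ a : ℝ, 0 < a → Integrable fun x : E3 => Real.exp (-a * ‖x‖ ^ 2) * ‖u₀ x‖)
    {φ : 𝓢(SpaceTime, ℝ)} (hφ : HasCompactSupport φ) (hs : tsupport φ ⊆ halfSpace) (v : E3) :
    ∫ q, backwardHeat ν φ q * ⟪caloric ν u₀ q, v⟫ = 0 := by
  have hc := hasCompactSupport_backwardHeat ν hφ
  have hs' := (tsupport_backwardHeat_subset ν φ).trans hs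
  obtain ⟨R, a, b, hR0, ha, hb, hR⟩ := exists_box hc hs'
  have hi := integrable_mul_K_mul_inner hν hm hint (μ := (volume : Measure SpaceTime)) measurable_fst
    measurable_snd (backwardHeat ν φ).integrable ha (fun q hq => ⟨(hR q hq).1, (hR q hq).2.1,
      (hR q hq).2.2.le⟩) hb v
  have h1 := (integral_mul_inner_caloric hν hm hint (μ := (volume : Measure SpaceTime)) measurable_fst
    measurable_snd (backwardHeat ν φ).integrable ha (fun q hq => ⟨(hR q hq).1, (hR q hq).2.1,
      (hR q hq).2.2.le⟩) hb v).2
  refine h1.trans ?_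
  rw [← integral_zero E3 ℝ]
  refine integral_congr_ae (hi.prod_left_ae.mono fun x' hx' => ?_)
  simp only at hx' ⊢
  rw [integral_spaceTime_eq hx']
  · simp_rw [← mul_assoc, integral_mul_const]
    -- Sources of the caloric extension sit at time 0, so the representation formula returns φ(x',
    -- 0), which is zero because φ is supported at positive times.
    have := integral_backwardHeat_mul_K hν hφ x' 0
    simp only [zero_add] at this
    rw [this, image_eq_zero_of_notMem_tsupport fun h => lt_irrefl _ (mem_halfSpace.1 (hs h)),
      zero_mul]
  · intro q hq
    have : backwardHeat ν φ q = 0 := image_eq_zero_of_notMem_tsupport fun h =>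
      not_lt.2 hq (mem_halfSpace.1 (hs' h))
    rw [this, zero_mul]

/-- Caloric extension preserves incompressibility, on each time slice. -/
lemma sum_integral_fderiv_mul_inner_caloric (hν : 0 < ν) (hu₀ : LocallyIntegrable u₀)
    (hint : ∀ a : ℝ, 0 < a → Integrable fun x : E3 => Real.exp (-a * ‖x‖ ^ 2) * ‖u₀ x‖)
    (hdiv : DivergenceFree₀ u₀) {ψ : E3 → ℝ} (hψ : ContDiff ℝ (⊤ : ℕ∞) ψ) (hc : HasCompactSupport ψ)
    {t : ℝ} (ht : 0 < t) :
    ∑ i : Fin 3, ∫ x, fderiv ℝ ψ x (EuclideanSpace.single i 1) *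
      ⟪caloric ν u₀ (x, t), EuclideanSpace.single i 1⟫ = 0 := by
  have hm := hu₀.aestronglyMeasurable
  have hdc : ∀ i : Fin 3, Continuous fun x => fderiv ℝ ψ x (EuclideanSpace.single i 1) := fun i =>
    (hψ.continuous_fderiv (by norm_num)).clm_apply continuous_const
  have hds : ∀ i : Fin 3, HasCompactSupport fun x => fderiv ℝ ψ x (EuclideanSpace.single i 1) :=
    fun i => hc.fderiv_apply ℝ _
  obtain ⟨R, hR⟩ := (hc.fderiv ℝ).isCompact.isBounded.exists_norm_le
  have hR' : ∀ (i : Fin 3) (x : E3), fderiv ℝ ψ x (EuclideanSpace.single i 1) ≠ 0 →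
      ‖x‖ ≤ R ∧ t ≤ t ∧ t ≤ t := fun i x hx =>
    ⟨hR x (subset_tsupport _ fun h => hx (by rw [h]; rfl)), le_rfl, le_rfl⟩
  -- The shear (x, x') ↦ (x, x - x') places the translation on u₀. Integrating in x first then
  -- leaves, for each y, the divergence of u₀ tested against a translate of ψ.
  have hmp : MeasurePreserving (fun p : E3 × E3 => (p.1, p.1 - p.2))
      ((volume : Measure E3).prod volume) ((volume : Measure E3).prod volume) := by
    have h1 := measurePreserving_prod_sub (volume : Measure E3) (volume : Measure E3)
    have h2 := (MeasurePreserving.id (volume : Measure E3)).prod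
      (Measure.measurePreserving_neg (volume : Measure E3))
    convert h2.comp h1 using 1
    ext p <;> simp
  have h1 : ∀ i : Fin 3, Integrable (fun p : E3 × E3 => K p.2 (2 * ν * t) *
      (fderiv ℝ ψ p.1 (EuclideanSpace.single i 1) * u₀ (p.1 - p.2) i))
      ((volume : Measure E3).prod volume) := by
    intro i
    have h2 := integrable_mul_K_mul_inner hν hm hint (μ := (volume : Measure E3)) measurable_id
      measurable_const ((hdc i).integrable_of_hasCompactSupport (hds i)) ht (hR' i) ht
      (EuclideanSpace.single i 1)
    have h3 := (hmp.integrable_comp h2.aestronglyMeasurable).2 h2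
    refine h3.congr (Eventually.of_forall fun p => ?_)
    simp [EuclideanSpace.inner_single_right]
    ring
  have h2 : ∀ i : Fin 3, ∫ x, fderiv ℝ ψ x (EuclideanSpace.single i 1) *
      ⟪caloric ν u₀ (x, t), EuclideanSpace.single i 1⟫ =
      ∫ y, K y (2 * ν * t) * ∫ x, fderiv ℝ ψ x (EuclideanSpace.single i 1) * u₀ (x - y) i := by
    intro i
    simp_rw [← integral_const_mul]
    rw [← integral_integral_swap (h1 i)]
    refine integral_congr_ae (Eventually.of_forall fun x => ?_)
    simp only
    rw [inner_caloric hν hm hint ht,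
      ← integral_sub_left_eq_self (fun x' => K (x - x') (2 * ν * t) * _) volume x,
      ← integral_const_mul]
    refine integral_congr_ae (Eventually.of_forall fun y => ?_)
    simp [EuclideanSpace.inner_single_right]
    ring
  simp_rw [h2]
  rw [← integral_finsetSum _ fun i _ => ?_]
  · rw [← integral_zero E3 ℝ]
    refine integral_congr_ae (Eventually.of_forall fun y => ?_)
    simp only
    rw [← Finset.mul_sum]
    have hψy : ContDiff ℝ (⊤ : ℕ∞) fun x => ψ (x + y) := hψ.comp (contDiff_id.add contDiff_const)
    have hcy : HasCompactSupport fun x => ψ (x + y) :=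
      hc.comp_homeomorph (Homeomorph.addRight y)
    have h3 := hdiv ⟨fun x => ψ (x + y), hψy, hcy, by simp⟩
    have h4 : ∑ i : Fin 3, ∫ x, fderiv ℝ ψ x (EuclideanSpace.single i 1) * u₀ (x - y) i = 0 := by
      rw [← h3]
      refine Finset.sum_congr rfl fun i _ => ?_
      rw [← integral_add_right_eq_self _ y]
      refine integral_congr_ae (Eventually.of_forall fun x => ?_)
      simp only [add_sub_cancel_right]
      rw [mul_comm]
      congr 1
      change _ = fderiv ℝ (fun x => ψ (x + y)) x _
      rw [fderiv_comp_add_right]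
    rw [h4, mul_zero]
  · have := (h1 i).integral_prod_right
    simpa only [integral_const_mul] using this

end Tests

end

section

/-! ### Algebra of the differential operators -/

lemma lineDeriv_comm (φ : 𝓢(SpaceTime, ℝ)) (v w : SpaceTime) :
    (∂_{v} (∂_{w} φ) : 𝓢(SpaceTime, ℝ)) = ∂_{w} (∂_{v} φ) := by
  have h : ∀ (v w q : SpaceTime), (∂_{v} (∂_{w} φ) : 𝓢(SpaceTime, ℝ)) q =
      fderiv ℝ (fderiv ℝ φ) q v w := by
    intro v w q
    rw [SchwartzMap.lineDerivOp_apply_eq_fderiv]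
    have e : (⇑(∂_{w} φ : 𝓢(SpaceTime, ℝ)) : SpaceTime → ℝ) = fun q => fderiv ℝ φ q w := by
      ext q; exact SchwartzMap.lineDerivOp_apply_eq_fderiv _ _ _
    rw [e]
    have hd : DifferentiableAt ℝ (fderiv ℝ φ) q :=
      (((φ.smooth 2).fderiv_right (m := 1) (by norm_num)).differentiable (by norm_num)) q
    rw [fderiv_clm_apply hd (differentiableAt_const w)]
    simp
  ext q
  rw [h, h]
  exact ((φ.smooth 2).contDiffAt.isSymmSndFDerivAt (by simp)) v w

lemma backwardHeat_lineDeriv (ν : ℝ) (φ : 𝓢(SpaceTime, ℝ)) (v : SpaceTime) :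
    backwardHeat ν (∂_{v} φ) = ∂_{v} (backwardHeat ν φ) := by
  have h : ∀ w : SpaceTime, (∂_{w} (∂_{w} (∂_{v} φ)) : 𝓢(SpaceTime, ℝ)) = ∂_{v} (∂_{w} (∂_{w} φ)) := by
    intro w
    rw [lineDeriv_comm φ w v, lineDeriv_comm _ w v]
  simp only [backwardHeat, sub_eq_add_neg, LineDeriv.lineDerivOp_add, LineDeriv.lineDerivOp_neg,
    LineDeriv.lineDerivOp_smul, LineDeriv.lineDerivOp_sum, h, lineDeriv_comm φ timeDir v]

lemma backwardHeat_sum_smul {ι : Type*} (ν : ℝ) (s : Finset ι) (c : ι → ℝ)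
    (φ : ι → 𝓢(SpaceTime, ℝ)) :
    backwardHeat ν (∑ i ∈ s, c i • φ i) = ∑ i ∈ s, c i • backwardHeat ν (φ i) := by
  simp only [backwardHeat, LineDeriv.lineDerivOp_sum, LineDeriv.lineDerivOp_smul, smul_sub, smul_neg,
    Finset.sum_sub_distrib, Finset.sum_neg_distrib, Finset.smul_sum]
  congr 1
  rw [Finset.sum_comm]
  simp_rw [smul_comm ν]

lemma lineDeriv_space_eq_sum (φ : 𝓢(SpaceTime, ℝ)) (w : E3) :
    (∂_{((w, 0) : SpaceTime)} φ : 𝓢(SpaceTime, ℝ)) = ∑ j : Fin 3, w j • ∂_{spaceDir j} φ := by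
  have e : ((w, 0) : SpaceTime) = ∑ j : Fin 3, w j • spaceDir j := by
    refine Prod.ext ?_ ?_
    · ext k
      simp [spaceDir, Fin.sum_univ_three]
      fin_cases k <;> simp
    · simp [spaceDir, Fin.sum_univ_three]
  ext q
  rw [SchwartzMap.lineDerivOp_apply_eq_fderiv, e, map_sum]
  simp [SchwartzMap.lineDerivOp_apply_eq_fderiv, Fin.sum_univ_three]

lemma hasCompactSupport_sum_smul {ι : Type*} (s : Finset ι) (c : ι → ℝ)
    {φ : ι → 𝓢(SpaceTime, ℝ)} (hφ : ∀ i, HasCompactSupport (φ i)) :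
    HasCompactSupport (∑ i ∈ s, c i • φ i : 𝓢(SpaceTime, ℝ)) := by
  classical
  induction s using Finset.induction_on with
  | empty => simpa using HasCompactSupport.zero
  | insert i s hi ih =>
    rw [Finset.sum_insert hi]
    have : HasCompactSupport (c i • φ i : 𝓢(SpaceTime, ℝ)) :=
      HasCompactSupport.of_support_subset_isCompact (hφ i).isCompact
        fun q hq => subset_tsupport _ fun h => hq (by simp [h])
    exact this.add ih

section Momentum

variable {ν : ℝ}

/-- Testing the Leray-projected heat kernel against the backward heat operator of a
divergence-free field. -/
lemma integral_sum_backwardHeat_mul_forcing (hν : 0 < ν) {Φ : Fin 3 → 𝓢(SpaceTime, ℝ)}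
    (hc : ∀ i, HasCompactSupport (Φ i)) (hdiv : ∑ i, ∂_{spaceDir i} (Φ i) = 0) (x' w : E3) (t' : ℝ) :
    ∫ s in Ioi (0 : ℝ), ∑ i : Fin 3, ∫ x, backwardHeat ν (Φ i) (x, t' + s) *
      ⟪forcingTerm ν (x - x') s w, EuclideanSpace.single i 1⟫ = ∑ i, w i * Φ i (x', t') := by
  have hc' := hasCompactSupport_sum_smul Finset.univ (fun i => w i) hc
  have h1 := integral_backwardHeat_mul_K hν hc' x' t'
  have e : (∑ i, w i • Φ i : 𝓢(SpaceTime, ℝ)) (x', t') = ∑ i, w i * Φ i (x', t') := by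
    simp [Fin.sum_univ_three]
  rw [e] at h1
  rw [← h1]
  refine setIntegral_congr_fun measurableSet_Ioi fun s hs => ?_
  have hL : ∀ i, HasCompactSupport (backwardHeat ν (Φ i)) := fun i =>
    hasCompactSupport_backwardHeat ν (hc i)
  -- The backward heat operator commutes with spatial derivatives, so it maps divergence-free fields
  -- to divergence-free fields and the Hessian part of the kernel does not contribute.
  have h2 := integral_mul_forcing_of_divFree hν (s := s) hs
    (f := fun i x => backwardHeat ν (Φ i) (x, t' + s))
    (fun i => contDiff_slice (n := 1) _ _) (fun i => hasCompactSupport_slice (hL i) _) (fun x => by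
      simp_rw [fderiv_slice]
      have e2 : ∑ i, ∂_{spaceDir i} (backwardHeat ν (Φ i)) = (0 : 𝓢(SpaceTime, ℝ)) := by
        simp_rw [← backwardHeat_lineDeriv]
        have := backwardHeat_sum_smul ν Finset.univ (fun _ : Fin 3 => (1 : ℝ))
          (fun i => ∂_{spaceDir i} (Φ i))
        simp only [one_smul, hdiv] at this
        rw [← this]
        simp [backwardHeat]
      have e3 := DFunLike.congr_fun e2 (x, t' + s)
      simpa [Fin.sum_univ_three, spaceDir] using e3) x' w
  simp only
  rw [h2, backwardHeat_sum_smul]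
  simp_rw [← integral_const_mul]
  rw [← integral_finsetSum]
  · refine integral_congr_ae (Eventually.of_forall fun x => ?_)
    simp [Fin.sum_univ_three]
    ring
  · intro i _
    exact (integrable_slice_mul (hL i) (continuous_K_space _) _ _).const_mul _

/-- Moving the derivative in the direction w off the quadratic kernel turns the tested field into
the gradient of ∂_w φ, which the forcing kernel annihilates. -/
lemma sum_integral_lineDeriv_mul_nonlinear (hν : 0 < ν) {s : ℝ} (hs : 0 < s) {φ : 𝓢(SpaceTime, ℝ)}
    (hc : HasCompactSupport φ) (x' w : E3) (t : ℝ) :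
    ∑ i : Fin 3, ∫ x, (∂_{spaceDir i} φ) (x, t) *
      ⟪nonlinearTerm ν (x - x') s w, EuclideanSpace.single i 1⟫ = 0 := by
  have hw : HasCompactSupport (∂_{((w, 0) : SpaceTime)} φ : 𝓢(SpaceTime, ℝ)) :=
    hasCompactSupport_lineDeriv hc _
  rw [← sum_integral_fderiv_mul_forcing hν hs
    (contDiff_slice (n := 2) (∂_{((w, 0) : SpaceTime)} φ) t) (hasCompactSupport_slice hw t) x' w]
  refine Finset.sum_congr rfl fun i _ => ?_
  rw [integral_mul_nonlinear_eq_forcing hν hs (contDiff_slice (n := 1) (∂_{spaceDir i} φ) t)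
    (hasCompactSupport_slice (hasCompactSupport_lineDeriv hc _) t)]
  simp_rw [fderiv_slice]
  rw [lineDeriv_comm]
  rfl

end Momentum

section Solution

variable {ν : ℝ} {u₀ : E3 → E3} {g u : SpaceTime → E3}

lemma integral_velocity_mul (hν : 0 < ν) (hu₀ : LocallyIntegrable u₀)
    (hg : LocallyIntegrableOn g (halfSpace : Set SpaceTime)) (hu : LocallySquareIntegrable u)
    (heq : ∀ᵐ q : SpaceTime ∂(volume.restrict (halfSpace : Set SpaceTime)),
      IntegralEquationAt ν u₀ g u q.1 q.2)
    {φ : 𝓢(SpaceTime, ℝ)} (hφ : HasCompactSupport φ) (hs : tsupport φ ⊆ halfSpace) (i : Fin 3) :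
    ∫ q, u q i * φ q = (∫ q, φ q * ⟪caloric ν u₀ q, EuclideanSpace.single i 1⟫) +
      ((∫ q, φ q * ⟪duhamel (nonlinearTerm ν) u q, EuclideanSpace.single i 1⟫) +
        ∫ q, φ q * ⟪duhamel (forcingTerm ν) g q, EuclideanSpace.single i 1⟫) := by
  obtain ⟨R, a, b, hR0, ha, hb, hR⟩ := exists_box hφ hs
  obtain ⟨C, hC0, hC⟩ := exists_abs_le φ
  have hR' : ∀ q, φ q ≠ 0 → ‖q.1‖ ≤ R ∧ q.2 < b := fun q hq => ⟨(hR q hq).1, (hR q hq).2.2⟩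
  have h1 : Integrable fun q => φ q * ⟪caloric ν u₀ q, EuclideanSpace.single i 1⟫ :=
    (integral_mul_inner_caloric hν hu₀.aestronglyMeasurable (fun a ha => integrable_exp_mul_initial hν hu₀ heq ha) (μ := (volume : Measure SpaceTime))
    measurable_fst measurable_snd φ.integrable ha (fun q hq => ⟨(hR q hq).1, (hR q hq).2.1,
      (hR q hq).2.2.le⟩) hb (EuclideanSpace.single i 1)).1
  have h2 := (admissibleSource_nonlinear hν hu heq).integrable_mul_duhamel hν
    φ.continuous.measurable hR0 hC hR' (EuclideanSpace.single i 1)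
  have h3 := (admissibleSource_forcing hν hg heq).integrable_mul_duhamel hν
    φ.continuous.measurable hR0 hC hR' (EuclideanSpace.single i 1)
  have h4 := integral_add h1 (h2.add h3)
  have h5 := integral_add h2 h3
  simp only [Pi.add_apply] at h4
  rw [h5] at h4
  rw [← h4]
  refine integral_congr_ae ?_
  filter_upwards [(ae_restrict_iff' isOpen_halfSpace.measurableSet).1 heq] with q hq
  by_cases h0 : φ q = 0
  · simp [h0]
  · have hq0 : 0 < q.2 := ha.trans_le (hR q h0).2.1
    have e := (hq (mem_halfSpace.2 hq0)).eq_add hq0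
    have e1 : u q i = ⟪u q, EuclideanSpace.single i 1⟫ := by simp [EuclideanSpace.inner_single_right]
    rw [e1]
    change ⟪u (q.1, q.2), _⟫ * _ = _
    rw [e, inner_add_left, inner_add_left]
    simp only [caloric, duhamel]
    ring

lemma exists_common_bound (φ : Fin 3 → 𝓢(SpaceTime, ℝ)) (hφ : ∀ i, HasCompactSupport (φ i)) :
    ∃ C R b, 0 ≤ R ∧ (∀ i q, |φ i q| ≤ C) ∧ ∀ i q, φ i q ≠ 0 → ‖q.1‖ ≤ R ∧ q.2 < b := by
  choose C hC0 hC using fun i => exists_abs_le (φ i)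
  choose R hR0 hR using fun i => exists_forall_norm_le_of_ne_zero (hφ i)
  have hle : ∀ (f : Fin 3 → ℝ), (∀ i, 0 ≤ f i) → ∀ i, f i ≤ ∑ j, f j := fun f hf i =>
    Finset.single_le_sum (fun j _ => hf j) (Finset.mem_univ i)
  refine ⟨∑ i, C i, ∑ i, R i, ∑ i, R i + 1, Finset.sum_nonneg fun i _ => (hR0 i).le,
    fun i q => (hC i q).trans (hle C hC0 i), fun i q hq => ?_⟩
  obtain ⟨h1, h2⟩ := hR i q.1 q.2 hq
  have := hle R (fun i => (hR0 i).le) i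
  exact ⟨h1.trans this, by linarith [le_abs_self q.2]⟩

/-- The three parts of the velocity are divergence-free separately: the caloric part because u₀ is,
the two potentials because their kernels annihilate gradients for each source point and lag. -/
lemma sum_integral_velocity_mul_lineDeriv (hν : 0 < ν) (hu₀ : LocallyIntegrable u₀)
    (hdiv : DivergenceFree₀ u₀)
    (hg : LocallyIntegrableOn g (halfSpace : Set SpaceTime)) (hu : LocallySquareIntegrable u)
    (heq : ∀ᵐ q : SpaceTime ∂(volume.restrict (halfSpace : Set SpaceTime)),
      IntegralEquationAt ν u₀ g u q.1 q.2)
    {φ : 𝓢(SpaceTime, ℝ)} (hφ : HasCompactSupport φ) (hs : tsupport φ ⊆ halfSpace) :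
    ∑ i : Fin 3, ∫ q, u q i * (∂_{spaceDir i} φ : 𝓢(SpaceTime, ℝ)) q = 0 := by
  have hint := fun a ha => integrable_exp_mul_initial hν hu₀ heq (a := a) ha
  have hc : ∀ i, HasCompactSupport (∂_{spaceDir i} φ : 𝓢(SpaceTime, ℝ)) := fun i =>
    hasCompactSupport_lineDeriv hφ _
  have hs' : ∀ i, tsupport (∂_{spaceDir i} φ : 𝓢(SpaceTime, ℝ)) ⊆ halfSpace := fun i =>
    (SchwartzMap.tsupport_lineDerivOp_subset _ φ).trans hs
  obtain ⟨C, R, b, hR0, hC, hR⟩ := exists_common_bound (fun i => ∂_{spaceDir i} φ) hc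
  simp_rw [fun i => integral_velocity_mul hν hu₀ hg hu heq (hc i) (hs' i) i]
  rw [Finset.sum_add_distrib, Finset.sum_add_distrib,
    (admissibleSource_nonlinear hν hu heq).sum_integral_mul_duhamel hν
      (fun i => (∂_{spaceDir i} φ : 𝓢(SpaceTime, ℝ)).continuous.measurable) hR0 hC hR,
    (admissibleSource_forcing hν hg heq).sum_integral_mul_duhamel hν
      (fun i => (∂_{spaceDir i} φ : 𝓢(SpaceTime, ℝ)).continuous.measurable) hR0 hC hR]
  have h1 : ∫ q' in (halfSpace : Set SpaceTime), ∫ s in Ioi (0 : ℝ),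
      ∑ i : Fin 3, ∫ x, (∂_{spaceDir i} φ : 𝓢(SpaceTime, ℝ)) (x, q'.2 + s) *
        ⟪nonlinearTerm ν (x - q'.1) s (u q'), EuclideanSpace.single i 1⟫ = 0 := by
    refine setIntegral_eq_zero_of_forall_eq_zero fun q' _ =>
      setIntegral_eq_zero_of_forall_eq_zero fun s hs => ?_
    exact sum_integral_lineDeriv_mul_nonlinear hν hs hφ _ _ _
  have h2 : ∫ q' in (halfSpace : Set SpaceTime), ∫ s in Ioi (0 : ℝ),
      ∑ i : Fin 3, ∫ x, (∂_{spaceDir i} φ : 𝓢(SpaceTime, ℝ)) (x, q'.2 + s) *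
        ⟪forcingTerm ν (x - q'.1) s (g q'), EuclideanSpace.single i 1⟫ = 0 := by
    refine setIntegral_eq_zero_of_forall_eq_zero fun q' _ =>
      setIntegral_eq_zero_of_forall_eq_zero fun s hs => ?_
    have := sum_integral_fderiv_mul_forcing hν (s := s) hs (contDiff_slice (n := 2) φ (q'.2 + s))
      (hasCompactSupport_slice hφ _) q'.1 (g q')
    simp_rw [fderiv_slice] at this
    exact this
  have h3 : ∑ i : Fin 3, ∫ q, (∂_{spaceDir i} φ : 𝓢(SpaceTime, ℝ)) q *
      ⟪caloric ν u₀ q, EuclideanSpace.single i 1⟫ = 0 := by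
    have hi : ∀ i : Fin 3, Integrable fun q => (∂_{spaceDir i} φ : 𝓢(SpaceTime, ℝ)) q *
        ⟪caloric ν u₀ q, EuclideanSpace.single i 1⟫ := by
      intro i
      obtain ⟨R, a, b, hR0, ha, hb, hR⟩ := exists_box (hc i) (hs' i)
      exact (integral_mul_inner_caloric hν hu₀.aestronglyMeasurable hint
        (μ := (volume : Measure SpaceTime)) measurable_fst measurable_snd
        (∂_{spaceDir i} φ : 𝓢(SpaceTime, ℝ)).integrable ha (fun q hq => ⟨(hR q hq).1, (hR q hq).2.1,
        (hR q hq).2.2.le⟩) hb (EuclideanSpace.single i 1)).1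
    have hz : ∀ (i : Fin 3) (q : SpaceTime), q.2 ≤ 0 →
        (∂_{spaceDir i} φ : 𝓢(SpaceTime, ℝ)) q * ⟪caloric ν u₀ q, EuclideanSpace.single i 1⟫ = 0 := by
      intro i q hq
      have : (∂_{spaceDir i} φ : 𝓢(SpaceTime, ℝ)) q = 0 :=
        image_eq_zero_of_notMem_tsupport fun h => not_lt.2 hq (mem_halfSpace.1 (hs' i h))
      rw [this, zero_mul]
    simp_rw [fun i => integral_spaceTime_eq (hi i) (hz i)]
    rw [← integral_finsetSum _ fun i _ => (hi i).integral_prod_right.restrict]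
    refine setIntegral_eq_zero_of_forall_eq_zero fun s hs => ?_
    have := sum_integral_fderiv_mul_inner_caloric hν hu₀ hint hdiv (contDiff_slice φ s (n := ⊤))
      (hasCompactSupport_slice hφ s) (t := s) hs
    simp_rw [fderiv_slice] at this
    exact this
  rw [h1, h2, h3]
  norm_num

lemma integrable_mul_test {h : SpaceTime → ℝ}
    (hh : LocallyIntegrableOn h (halfSpace : Set SpaceTime))
    {φ : 𝓢(SpaceTime, ℝ)} (hφ : HasCompactSupport φ) (hs : tsupport φ ⊆ halfSpace) :
    Integrable fun q => h q * φ q := by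
  have h1 : IntegrableOn (fun q => h q * φ q) (tsupport φ) :=
    (hh.integrableOn_compact_subset hs hφ.isCompact).mul_continuousOn φ.continuous.continuousOn
      hφ.isCompact
  refine (integrableOn_iff_integrable_of_support_subset fun q hq => ?_).1 h1
  exact subset_tsupport _ (right_ne_zero_of_mul hq)

lemma locallyIntegrableOn_apply {f : SpaceTime → E3} {s : Set SpaceTime}
    (hf : LocallyIntegrableOn f s) (i : Fin 3) : LocallyIntegrableOn (fun q => f q i) s := by
  intro q hq
  obtain ⟨t, ht, hft⟩ := hf q hq
  exact ⟨t, ht, ((EuclideanSpace.proj (𝕜 := ℝ) i).integrable_comp hft)⟩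

lemma locallyIntegrableOn_mul (hu : LocallySquareIntegrable u) (i j : Fin 3) :
    LocallyIntegrableOn (fun q => u q i * u q j) (halfSpace : Set SpaceTime) := by
  rw [locallyIntegrableOn_iff isOpen_halfSpace.isLocallyClosed]
  intro k hk hkc
  have h1 := hu k hkc hk
  have h2 : ∀ i : Fin 3, MemLp (fun q => u q i) 2 (volume.restrict k) := fun i =>
    (EuclideanSpace.proj (𝕜 := ℝ) i).comp_memLp' h1
  exact (h2 i).integrable_mul (h2 j)

/-- The integral equation implies the momentum equation tested against divergence-free fields. -/
lemma sum_integral_velocity_mul_backwardHeat (hν : 0 < ν) (hu₀ : LocallyIntegrable u₀)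
    (hg : LocallyIntegrableOn g (halfSpace : Set SpaceTime)) (hu : LocallySquareIntegrable u)
    (heq : ∀ᵐ q : SpaceTime ∂(volume.restrict (halfSpace : Set SpaceTime)),
      IntegralEquationAt ν u₀ g u q.1 q.2)
    {Φ : Fin 3 → 𝓢(SpaceTime, ℝ)} (hc : ∀ i, HasCompactSupport (Φ i))
    (hs : ∀ i, tsupport (Φ i) ⊆ halfSpace) (hdiv : ∑ i, ∂_{spaceDir i} (Φ i) = 0) :
    ∑ i : Fin 3, ∫ q, u q i * backwardHeat ν (Φ i) q =
      (∑ i : Fin 3, ∑ j : Fin 3, ∫ q, u q i * u q j * (∂_{spaceDir j} (Φ i)) q) +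
        ∑ i : Fin 3, ∫ q, g q i * Φ i q := by
  have hint := fun a ha => integrable_exp_mul_initial hν hu₀ heq (a := a) ha
  have hc' : ∀ i, HasCompactSupport (backwardHeat ν (Φ i)) := fun i =>
    hasCompactSupport_backwardHeat ν (hc i)
  have hs' : ∀ i, tsupport (backwardHeat ν (Φ i)) ⊆ halfSpace := fun i =>
    (tsupport_backwardHeat_subset ν (Φ i)).trans (hs i)
  obtain ⟨C, R, b, hR0, hC, hR⟩ := exists_common_bound (fun i => backwardHeat ν (Φ i)) hc'
  simp_rw [fun i => integral_velocity_mul hν hu₀ hg hu heq (hc' i) (hs' i) i,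
    fun i => integral_backwardHeat_mul_inner_caloric hν hu₀.aestronglyMeasurable hint (hc i) (hs i)
      (EuclideanSpace.single i 1), zero_add]
  rw [Finset.sum_add_distrib,
    (admissibleSource_nonlinear hν hu heq).sum_integral_mul_duhamel hν
      (fun i => (backwardHeat ν (Φ i)).continuous.measurable) hR0 hC hR,
    (admissibleSource_forcing hν hg heq).sum_integral_mul_duhamel hν
      (fun i => (backwardHeat ν (Φ i)).continuous.measurable) hR0 hC hR]
  have hzero : ∀ (φ : 𝓢(SpaceTime, ℝ)), tsupport φ ⊆ halfSpace → ∀ q, q ∉ (halfSpace : Set SpaceTime) →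
      φ q = 0 := fun φ h q hq => image_eq_zero_of_notMem_tsupport fun h' => hq (h h')
  have hsd : ∀ i v, tsupport (∂_{v} (Φ i) : 𝓢(SpaceTime, ℝ)) ⊆ halfSpace := fun i v =>
    (SchwartzMap.tsupport_lineDerivOp_subset _ _).trans (hs i)
  congr 1
  · have e : ∀ q' : SpaceTime, ∫ s in Ioi (0 : ℝ), ∑ i : Fin 3,
        ∫ x, backwardHeat ν (Φ i) (x, q'.2 + s) *
          ⟪nonlinearTerm ν (x - q'.1) s (u q'), EuclideanSpace.single i 1⟫ =
        ∑ i : Fin 3, ∑ j : Fin 3, u q' i * u q' j * (∂_{spaceDir j} (Φ i)) q' := by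
      intro q'
      -- At a fixed source point the quadratic kernel is the forcing kernel with a derivative in the
      -- direction u(q'). That derivative falls on Φ, and ∂_{u(q')} Φ is again divergence-free.
      have h1 := integral_sum_backwardHeat_mul_forcing hν
        (Φ := fun i => ∂_{((u q', 0) : SpaceTime)} (Φ i))
        (fun i => hasCompactSupport_lineDeriv (hc i) _) (by
          simp_rw [fun i => lineDeriv_comm (Φ i) (spaceDir i)]
          rw [← LineDeriv.lineDerivOp_sum, hdiv, LineDeriv.lineDerivOp_zero]) q'.1 (u q') q'.2
      have h2 : ∑ i : Fin 3, ∑ j : Fin 3, u q' i * u q' j * (∂_{spaceDir j} (Φ i)) q' =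
          ∑ i : Fin 3, u q' i * (∂_{((u q', 0) : SpaceTime)} (Φ i) : 𝓢(SpaceTime, ℝ)) (q'.1, q'.2) := by
        refine Finset.sum_congr rfl fun i _ => ?_
        rw [lineDeriv_space_eq_sum]
        simp [Fin.sum_univ_three]
        ring
      rw [h2, ← h1]
      refine setIntegral_congr_fun measurableSet_Ioi fun s hs => Finset.sum_congr rfl fun i _ => ?_
      rw [integral_mul_nonlinear_eq_forcing hν hs (contDiff_slice (n := 1) _ _)
        (hasCompactSupport_slice (hc' i) _)]
      simp_rw [fderiv_slice, backwardHeat_lineDeriv]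
    simp_rw [e]
    have hi : ∀ i j : Fin 3, Integrable fun q => u q i * u q j * (∂_{spaceDir j} (Φ i)) q := fun i j =>
      integrable_mul_test (locallyIntegrableOn_mul hu i j) (hasCompactSupport_lineDeriv (hc i) _)
        (hsd i _)
    rw [setIntegral_eq_integral_of_forall_compl_eq_zero, integral_finsetSum _ fun i _ =>
      integrable_finsetSum _ fun j _ => hi i j]
    · exact Finset.sum_congr rfl fun i _ => integral_finsetSum _ fun j _ => hi i j
    · intro q hq
      refine Finset.sum_eq_zero fun i _ => Finset.sum_eq_zero fun j _ => ?_
      rw [hzero _ (hsd i _) q hq, mul_zero]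
  · simp_rw [fun q' : SpaceTime => integral_sum_backwardHeat_mul_forcing hν hc hdiv q'.1 (g q') q'.2]
    have hi : ∀ i : Fin 3, Integrable fun q => g q i * Φ i q := fun i =>
      integrable_mul_test (locallyIntegrableOn_apply hg i) (hc i) (hs i)
    rw [setIntegral_eq_integral_of_forall_compl_eq_zero, integral_finsetSum _ fun i _ => hi i]
    intro q hq
    refine Finset.sum_eq_zero fun i _ => ?_
    rw [hzero _ (hs i) _ hq, mul_zero]

end Solution

end

section

/-! ### The initial velocity -/

section

variable {ν : ℝ} {N : E3 → ℝ → E3 → E3} {w : SpaceTime → E3} {m : SpaceTime → ℝ} {n : ℕ}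

/-- For |x'| ≤ 2R + 1 the weight is bounded below and the unweighted bound suffices. For larger |x'|
the support of φ stays at distance at least one from x', so the pointwise kernel bound carries no
singularity. The hypothesis `hnear` supplies the cancellation that the pointwise bound cannot give
as s tends to zero. -/
lemma AdmissibleSource.exists_weighted_bound (hN : AdmissibleSource ν N w m n) (hν : 0 < ν)
    {φ : E3 → ℝ} (hφ : Continuous φ) (hc : HasCompactSupport φ) {v : E3} {C₁ : ℝ} (hC₁ : 0 ≤ C₁)
    (hnear : ∀ x' s q, 0 < s → |∫ x, φ x * ⟪N (x - x') s (w q), v⟫| ≤ C₁ * m q) :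
    ∃ C, 0 ≤ C ∧ ∀ x' s q, 0 < s → |∫ x, φ x * ⟪N (x - x') s (w q), v⟫| ≤
      C * (m q * ((1 + ‖x'‖) ^ n)⁻¹) := by
  obtain ⟨D, hD0, hD⟩ := hN.bound
  obtain ⟨R', hR'⟩ := hc.isCompact.isBounded.exists_norm_le
  set R := max R' 0 with hRdef
  have hR0 : 0 ≤ R := le_max_right _ _
  have hR : ∀ x, φ x ≠ 0 → ‖x‖ ≤ R := fun x hx =>
    (hR' x (subset_tsupport _ hx)).trans (le_max_left _ _)
  have hφi : Integrable fun x => ‖φ x‖ := (hφ.integrable_of_hasCompactSupport hc).norm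
  set I := ∫ x, ‖φ x‖ with hI
  have hI0 : 0 ≤ I := integral_nonneg fun x => norm_nonneg _
  refine ⟨C₁ * (2 * R + 2) ^ n + I * (D * (4 * (2 * (1 + R)) ^ n) * ‖v‖), by positivity,
    fun x' s q hs => ?_⟩
  have hm0 := hN.nonneg q
  set W := m q * ((1 + ‖x'‖) ^ n)⁻¹ with hW
  have hW0 : 0 ≤ W := by positivity
  rcases le_or_gt ‖x'‖ (2 * R + 1) with h | h
  · have h1 : C₁ * m q ≤ C₁ * (2 * R + 2) ^ n * W := by
      have : (1 + ‖x'‖) ^ n ≤ (2 * R + 2) ^ n := pow_le_pow_left₀ (by positivity) (by linarith) n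
      have h2 : 1 ≤ (2 * R + 2) ^ n * ((1 + ‖x'‖) ^ n)⁻¹ := by
        rw [← div_eq_mul_inv, le_div_iff₀ (by positivity), one_mul]
        exact this
      calc C₁ * m q = C₁ * m q * 1 := (mul_one _).symm
        _ ≤ C₁ * m q * ((2 * R + 2) ^ n * ((1 + ‖x'‖) ^ n)⁻¹) := by gcongr
        _ = _ := by rw [hW]; ring
    have h2 : 0 ≤ I * (D * (4 * (2 * (1 + R)) ^ n) * ‖v‖) * W := by positivity
    rw [add_mul]
    linarith [hnear x' s q hs]
  · have h1 : ∀ x, ‖φ x * ⟪N (x - x') s (w q), v⟫‖ ≤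
        ‖φ x‖ * ((D * (4 * (2 * (1 + R)) ^ n) * ‖v‖) * W) := by
      intro x
      by_cases hx : φ x = 0
      · simp [hx]
      · have hxR := hR x hx
        have hA := parDist_pos hν hs (x - x')
        have hz : 1 ≤ ‖x - x'‖ := by
          have := norm_sub_norm_le x' x
          rw [norm_sub_rev] at this
          linarith
        have hA1 : 1 ≤ parDist ν (x - x') s :=
          (one_le_pow₀ hz).trans (norm_sq_le_parDist hν hs (x - x'))
        have h2 : (parDist ν (x - x') s ^ 2)⁻¹ ≤ 1 := inv_le_one_of_one_le₀ (one_le_pow₀ hA1)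
        have h3 := parDist_rpow_le hν hs (x' := x') hxR hN.le_four
        rw [norm_mul]
        refine mul_le_mul_of_nonneg_left ?_ (norm_nonneg _)
        calc ‖⟪N (x - x') s (w q), v⟫‖ ≤ ‖N (x - x') s (w q)‖ * ‖v‖ := norm_inner_le_norm _ _
          _ ≤ (D * parDist ν (x - x') s ^ (-(n / 2) : ℝ) * m q) * ‖v‖ := by
              gcongr; exact hD _ _ _ hs
          _ ≤ (D * (2 * (2 * (1 + R)) ^ n * ((1 + ‖x'‖) ^ n)⁻¹ * (1 + 1)) * m q) * ‖v‖ := by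
              gcongr
              refine h3.trans ?_
              gcongr
          _ = _ := by rw [hW]; ring
    have h2 := norm_integral_le_of_norm_le (hφi.mul_const _) (Eventually.of_forall h1)
    rw [integral_mul_const, Real.norm_eq_abs] at h2
    refine h2.trans ?_
    have h3 : 0 ≤ C₁ * (2 * R + 2) ^ n * W := by positivity
    rw [add_mul, mul_assoc I]
    linarith

/-- On almost every slice the tested potential is at most a constant times the integral of an
integrable weight over the slab of height t, which tends to zero by dominated convergence. -/
lemma AdmissibleSource.tendsto_integral_slice_mul_duhamel (hN : AdmissibleSource ν N w m n)
    (hν : 0 < ν) {φ : E3 → ℝ} (hφ : Continuous φ) (hc : HasCompactSupport φ) {v : E3} {C₁ : ℝ}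
    (hC₁ : 0 ≤ C₁)
    (hnear : ∀ x' s q, 0 < s → |∫ x, φ x * ⟪N (x - x') s (w q), v⟫| ≤ C₁ * m q) :
    (∀ᵐ t : ℝ, t < 1 → Integrable fun x => φ x * ⟪duhamel N w (x, t), v⟫) ∧
      Tendsto (fun t : ℝ => ∫ x, φ x * ⟪duhamel N w (x, t), v⟫) (𝓝[>] 0 ⊓ ae volume) (𝓝 0) := by
  obtain ⟨C, hC0, hC⟩ := hN.exists_weighted_bound hν hφ hc hC₁ hnear
  obtain ⟨B, hB⟩ := hφ.bounded_above_of_compact_support hc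
  obtain ⟨R', hR'⟩ := hc.isCompact.isBounded.exists_norm_le
  have hslice := hN.ae_integral_slice_mul_duhamel hν hφ.measurable (le_max_right R' 0)
    (C := B) hB (fun x hx => (hR' x (subset_tsupport _ hx)).trans (le_max_left _ _)) v 1
  refine ⟨hslice.mono fun t ht h => (ht h).1, ?_⟩
  set h : SpaceTime → ℝ := fun q => m q * ((1 + ‖q.1‖) ^ n)⁻¹ with hh
  have hh0 : ∀ q, 0 ≤ h q := fun q => by have := hN.nonneg q; positivity
  have hhi : IntegrableOn h (univ ×ˢ Ioo 0 1) := hN.integrableOn_weight 1 one_pos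
  have hlim : Tendsto (fun t : ℝ => C * ∫ q in (univ ×ˢ Ioo 0 t : Set SpaceTime), h q) (𝓝[>] 0)
      (𝓝 0) := by
    suffices hlim' : Tendsto (fun t : ℝ => ∫ q in (univ ×ˢ Ioo 0 t : Set SpaceTime), h q) (𝓝[>] 0)
        (𝓝 0) by simpa using hlim'.const_mul C
    have e : ∀ t : ℝ, ∫ q in (univ ×ˢ Ioo 0 t : Set SpaceTime), h q =
        ∫ q, (univ ×ˢ Ioo 0 t : Set SpaceTime).indicator h q := fun t =>
      (integral_indicator (measurableSet_slab t)).symm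
    simp_rw [e]
    suffices hz : Tendsto (fun t : ℝ => ∫ q, (univ ×ˢ Ioo 0 t : Set SpaceTime).indicator h q) (𝓝[>] 0)
        (𝓝 (∫ _q : SpaceTime, (0 : ℝ))) by rwa [integral_zero] at hz
    refine tendsto_integral_filter_of_dominated_convergence
      ((univ ×ˢ Ioo 0 1 : Set SpaceTime).indicator h) ?_ ?_
      ((integrable_indicator_iff (measurableSet_slab _)).2 hhi) ?_
    · filter_upwards [Ioo_mem_nhdsGT (zero_lt_one' ℝ)] with t ht
      refine ((integrable_indicator_iff (measurableSet_slab _)).2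
        (hhi.mono_set ?_)).aestronglyMeasurable
      exact prod_mono subset_rfl (Ioo_subset_Ioo_right ht.2.le)
    · filter_upwards [Ioo_mem_nhdsGT (zero_lt_one' ℝ)] with t ht
      refine Eventually.of_forall fun q => ?_
      rw [Real.norm_of_nonneg (indicator_nonneg (fun q _ => hh0 q) _)]
      exact indicator_le_indicator_of_subset
        (prod_mono subset_rfl (Ioo_subset_Ioo_right ht.2.le)) (fun q => hh0 q) q
    · refine Eventually.of_forall fun q => tendsto_const_nhds.congr' ?_
      rcases le_or_gt q.2 0 with hq | hq
      · refine Eventually.of_forall fun t => (indicator_of_notMem (fun h => ?_) _).symm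
        exact not_lt.2 hq h.2.1
      · filter_upwards [Ioo_mem_nhdsGT hq] with t ht
        refine (indicator_of_notMem (fun h => ?_) _).symm
        exact lt_asymm ht.2 h.2.2
  refine squeeze_zero_norm' ?_ (hlim.mono_left inf_le_left)
  have h1 : ∀ᶠ t : ℝ in 𝓝[>] 0 ⊓ ae volume, t ∈ Ioo (0 : ℝ) 1 :=
    Eventually.filter_mono inf_le_left (Ioo_mem_nhdsGT (zero_lt_one' ℝ))
  have h2 := hslice.filter_mono (inf_le_right : 𝓝[>] (0 : ℝ) ⊓ ae volume ≤ ae volume)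
  filter_upwards [h1, h2] with t ht1 ht2
  rw [(ht2 ht1.2).2, ← integral_const_mul]
  refine norm_integral_le_of_norm_le
    ((hhi.mono_set (prod_mono subset_rfl (Ioo_subset_Ioo_right ht1.2.le))).const_mul C) ?_
  refine (ae_restrict_iff' (measurableSet_slab t)).2 (Eventually.of_forall fun q hq => ?_)
  exact hC q.1 (t - q.2) q (sub_pos.2 hq.2.2)

end

section Caloric

variable {ν : ℝ} {u₀ : E3 → E3}

lemma tendsto_integral_mul_K (hν : 0 < ν) {φ : E3 → ℝ} (hφ : Continuous φ)
    (hc : HasCompactSupport φ) (x' : E3) :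
    Tendsto (fun t : ℝ => ∫ x, φ x * K (x - x') (2 * ν * t)) (𝓝[>] 0) (𝓝 (φ x')) := by
  obtain ⟨B, hB⟩ := hφ.bounded_above_of_compact_support hc
  have h1 : ∀ t : ℝ, 0 < t → ∫ x, φ x * K (x - x') (2 * ν * t) =
      ∫ y, φ (x' + √(2 * ν * t) • y) * K y 1 := by
    intro t ht
    rw [integral_comp_sqrt_smul (by positivity) (fun y => φ (x' + y)),
      ← integral_add_left_eq_self _ x']
    simp
  have h2 : Tendsto (fun t : ℝ => ∫ y, φ (x' + √(2 * ν * t) • y) * K y 1) (𝓝[>] 0)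
      (𝓝 (∫ y, φ x' * K y 1)) := by
    refine tendsto_integral_filter_of_dominated_convergence (fun y => B * K y 1) ?_ ?_
      ((integrable_K one_pos).const_mul B) ?_
    · refine Eventually.of_forall fun t => Continuous.aestronglyMeasurable ?_
      exact (hφ.comp (by fun_prop)).mul (continuous_K_space 1)
    · refine Eventually.of_forall fun t => Eventually.of_forall fun y => ?_
      rw [norm_mul, Real.norm_of_nonneg (K_nonneg y zero_le_one)]
      exact mul_le_mul_of_nonneg_right (hB _) (K_nonneg y zero_le_one)
    · refine Eventually.of_forall fun y => Tendsto.mul_const _ ?_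
      have hcont : Continuous fun t : ℝ => φ (x' + √(2 * ν * t) • y) := hφ.comp (by fun_prop)
      have := hcont.tendsto 0
      simp only [mul_zero, Real.sqrt_zero, zero_smul, add_zero] at this
      exact this.mono_left nhdsWithin_le_nhds
  rw [integral_const_mul, integral_K one_pos, mul_one] at h2
  refine h2.congr' ?_
  filter_upwards [self_mem_nhdsWithin] with t ht using (h1 t ht).symm

/-- Half of the Gaussian exponent is kept to form the kernel at twice the variance, which has
integral one. The other half, with coefficient at least 1/(8ν) because t ≤ 1, gives decay in x'
through |x - x'|² ≥ |x'|²/2 - R². The majorant is uniform in t and integrable against u₀. -/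
lemma abs_integral_mul_K_le_exp (hν : 0 < ν) {φ : E3 → ℝ} {B R : ℝ}
    (hB : ∀ x, ‖φ x‖ ≤ B) (hR : ∀ x, φ x ≠ 0 → ‖x‖ ≤ R) {t : ℝ} (ht : 0 < t) (ht1 : t ≤ 1)
    (x' : E3) :
    |∫ x, φ x * K (x - x') (2 * ν * t)| ≤
      B * (2 ^ (3 / 2 : ℝ) * Real.exp ((8 * ν)⁻¹ * R ^ 2)) * Real.exp (-(16 * ν)⁻¹ * ‖x'‖ ^ 2) := by
  have hB0 : 0 ≤ B := (norm_nonneg _).trans (hB 0)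
  set M := B * (2 ^ (3 / 2 : ℝ) * Real.exp ((8 * ν)⁻¹ * R ^ 2)) * Real.exp (-(16 * ν)⁻¹ * ‖x'‖ ^ 2)
    with hM
  have hi : Integrable fun x => M * K (x - x') (2 * (2 * ν * t)) :=
    ((integrable_K (by positivity)).comp_sub_right x').const_mul M
  have hv : ∫ x, M * K (x - x') (2 * (2 * ν * t)) = M := by
    rw [integral_const_mul, integral_sub_right_eq_self (fun x => K x (2 * (2 * ν * t))),
      integral_K (by positivity), mul_one]
  rw [← hv, ← Real.norm_eq_abs]
  refine norm_integral_le_of_norm_le hi (Eventually.of_forall fun x => ?_)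
  by_cases hx : φ x = 0
  · rw [hx, zero_mul, norm_zero]
    have := K_nonneg (x - x') (t := 2 * (2 * ν * t)) (by positivity)
    positivity
  · have hxR := hR x hx
    rw [norm_mul, Real.norm_of_nonneg (K_nonneg _ (by positivity))]
    have hK : K (x - x') (2 * ν * t) ≤ 2 ^ (3 / 2 : ℝ) * Real.exp ((8 * ν)⁻¹ * R ^ 2) *
        Real.exp (-(16 * ν)⁻¹ * ‖x'‖ ^ 2) * K (x - x') (2 * (2 * ν * t)) := by
      rw [K_eq_const_mul_exp, K_eq_const_mul_exp]
      have e1 : (2 * Real.pi * (2 * (2 * ν * t))) ^ (-(3 / 2) : ℝ) =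
          (2 ^ (3 / 2 : ℝ))⁻¹ * (2 * Real.pi * (2 * ν * t)) ^ (-(3 / 2) : ℝ) := by
        have : 2 * Real.pi * (2 * (2 * ν * t)) = 2 * (2 * Real.pi * (2 * ν * t)) := by ring
        rw [this, Real.mul_rpow (by norm_num) (by positivity), Real.rpow_neg (by norm_num)]
      have e2 : Real.exp (-(2 * (2 * ν * t))⁻¹ * ‖x - x'‖ ^ 2) ≤ Real.exp ((8 * ν)⁻¹ * R ^ 2) *
          Real.exp (-(16 * ν)⁻¹ * ‖x'‖ ^ 2) *
            Real.exp (-(2 * (2 * (2 * ν * t)))⁻¹ * ‖x - x'‖ ^ 2) := by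
        rw [← Real.exp_add, ← Real.exp_add, Real.exp_le_exp]
        have h2 : ‖x'‖ ^ 2 ≤ 2 * ‖x - x'‖ ^ 2 + 2 * R ^ 2 := by
          have h3 : ‖x'‖ ≤ ‖x‖ + ‖x - x'‖ := by
            have e : x' = x - (x - x') := by abel
            conv_lhs => rw [e]
            exact norm_sub_le _ _
          nlinarith [norm_nonneg x', norm_nonneg x, norm_nonneg (x - x'), sq_nonneg (R - ‖x - x'‖)]
        have h4 : (2 * (2 * (2 * ν * t)))⁻¹ = (2 * (2 * ν * t))⁻¹ / 2 := by field_simp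
        have h5 : (8 * ν)⁻¹ ≤ (2 * (2 * ν * t))⁻¹ / 2 := by
          rw [← h4]
          exact inv_anti₀ (by positivity) (by nlinarith)
        have h6 : (16 * ν)⁻¹ = (8 * ν)⁻¹ / 2 := by field_simp; norm_num
        have h7 : 0 < (8 * ν)⁻¹ := by positivity
        rw [h4, h6]
        nlinarith [mul_le_mul_of_nonneg_right h5 (sq_nonneg ‖x - x'‖),
          mul_le_mul_of_nonneg_left h2 h7.le]
      rw [e1]
      set P := (2 * Real.pi * (2 * ν * t)) ^ (-(3 / 2) : ℝ) with hP
      have hP0 : 0 ≤ P := by positivity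
      calc _ ≤ P * (Real.exp ((8 * ν)⁻¹ * R ^ 2) *
          Real.exp (-(16 * ν)⁻¹ * ‖x'‖ ^ 2) *
            Real.exp (-(2 * (2 * (2 * ν * t)))⁻¹ * ‖x - x'‖ ^ 2)) := by gcongr
        _ = _ := by field_simp
    calc ‖φ x‖ * K (x - x') (2 * ν * t) ≤ B * (2 ^ (3 / 2 : ℝ) * Real.exp ((8 * ν)⁻¹ * R ^ 2) *
        Real.exp (-(16 * ν)⁻¹ * ‖x'‖ ^ 2) * K (x - x') (2 * (2 * ν * t))) :=
          mul_le_mul (hB x) hK (K_nonneg _ (by positivity)) hB0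
      _ = _ := by rw [hM]; ring

lemma tendsto_integral_mul_inner_caloric (hν : 0 < ν) (hm : AEStronglyMeasurable u₀)
    (hint : ∀ a : ℝ, 0 < a → Integrable fun x : E3 => Real.exp (-a * ‖x‖ ^ 2) * ‖u₀ x‖)
    {φ : E3 → ℝ} (hφ : Continuous φ) (hc : HasCompactSupport φ) (v : E3) :
    (∀ t : ℝ, 0 < t → Integrable fun x => φ x * ⟪caloric ν u₀ (x, t), v⟫) ∧
    Tendsto (fun t : ℝ => ∫ x, φ x * ⟪caloric ν u₀ (x, t), v⟫) (𝓝[>] 0)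
      (𝓝 (∫ x, ⟪u₀ x, v⟫ * φ x)) := by
  obtain ⟨B, hB⟩ := hφ.bounded_above_of_compact_support hc
  obtain ⟨R, hR'⟩ := hc.isCompact.isBounded.exists_norm_le
  have hR : ∀ x, φ x ≠ 0 → ‖x‖ ≤ R := fun x hx => hR' x (subset_tsupport _ hx)
  have hφi := hφ.integrable_of_hasCompactSupport (μ := volume) hc
  have h1 := fun (t : ℝ) (ht : 0 < t) => integral_mul_inner_caloric hν hm hint
    (μ := (volume : Measure E3)) measurable_id (measurable_const (a := t)) hφi ht
    (fun x hx => ⟨hR x hx, le_rfl, le_rfl⟩) ht v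
  refine ⟨fun t ht => (h1 t ht).1, ?_⟩
  have h2 : ∀ t : ℝ, 0 < t → ∫ x, φ x * ⟪caloric ν u₀ (x, t), v⟫ =
      ∫ x', ⟪u₀ x', v⟫ * ∫ x, φ x * K (x - x') (2 * ν * t) := by
    intro t ht
    refine (h1 t ht).2.trans (integral_congr_ae (Eventually.of_forall fun x' => ?_))
    simp only [id]
    simp_rw [← mul_assoc]
    rw [integral_mul_const, mul_comm]
  have h3 : Tendsto (fun t : ℝ => ∫ x', ⟪u₀ x', v⟫ * ∫ x, φ x * K (x - x') (2 * ν * t)) (𝓝[>] 0)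
      (𝓝 (∫ x, ⟪u₀ x, v⟫ * φ x)) := by
    refine tendsto_integral_filter_of_dominated_convergence
      (fun x' => (‖v‖ * (B * (2 ^ (3 / 2 : ℝ) * Real.exp ((8 * ν)⁻¹ * R ^ 2)))) *
        (Real.exp (-(16 * ν)⁻¹ * ‖x'‖ ^ 2) * ‖u₀ x'‖)) ?_ ?_
      ((hint (16 * ν)⁻¹ (by positivity)).const_mul _) ?_
    · filter_upwards [self_mem_nhdsWithin] with t ht
      have h4 := (integrable_mul_K_mul_inner hν hm hint
        (μ := (volume : Measure E3)) measurable_id (measurable_const (a := t)) hφi ht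
        (fun x hx => ⟨hR x hx, le_rfl, le_rfl⟩) ht v).integral_prod_right
      refine h4.aestronglyMeasurable.congr (Eventually.of_forall fun x' => ?_)
      simp only [id]
      simp_rw [← mul_assoc]
      rw [integral_mul_const, mul_comm]
    · filter_upwards [Ioo_mem_nhdsGT (zero_lt_one' ℝ)] with t ht
      refine Eventually.of_forall fun x' => ?_
      have h5 := abs_integral_mul_K_le_exp hν hB hR ht.1 ht.2.le x'
      rw [norm_mul, Real.norm_eq_abs (∫ x, φ x * K (x - x') (2 * ν * t))]
      calc _ ≤ (‖u₀ x'‖ * ‖v‖) * (B * (2 ^ (3 / 2 : ℝ) * Real.exp ((8 * ν)⁻¹ * R ^ 2)) *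
            Real.exp (-(16 * ν)⁻¹ * ‖x'‖ ^ 2)) :=
            mul_le_mul (norm_inner_le_norm _ _) h5 (abs_nonneg _) (by positivity)
        _ = _ := by ring
    · exact Eventually.of_forall fun x' => (tendsto_integral_mul_K hν hφ hc x').const_mul _
  refine h3.congr' ?_
  filter_upwards [self_mem_nhdsWithin] with t ht using (h2 t ht).symm

end Caloric

lemma integrable_mul_forcing {ν s : ℝ} (hν : 0 < ν) (hs : 0 < s) {f : E3 → ℝ} (hf : Continuous f)
    (hc : HasCompactSupport f) (x' w v : E3) :
    Integrable fun x => f x * ⟪forcingTerm ν (x - x') s w, v⟫ := by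
  have hm : Measurable fun x : E3 => forcingTerm ν (x - x') s w := by
    have h0 : Measurable fun x : E3 => (x - x', s, w) := by fun_prop
    simpa only [Function.comp_def] using (measurable_forcingTerm ν).comp h0
  refine (hf.integrable_of_hasCompactSupport hc).mul_bdd
    (c := 10 ^ 6 * (2 * ν * s) ^ (-(3 / 2) : ℝ) * ‖w‖ * ‖v‖) ?_ ?_
  · exact (Measurable.inner hm measurable_const).aestronglyMeasurable
  · filter_upwards [ae_sub_ne_zero x'] with x hx
    refine (norm_inner_le_norm _ _).trans ?_
    refine mul_le_mul_of_nonneg_right ((norm_forcingTerm_le hν hs hx w).trans ?_) (norm_nonneg _)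
    have h1 : parDist ν (x - x') s ^ (-(3 / 2) : ℝ) ≤ (2 * ν * s) ^ (-(3 / 2) : ℝ) := by
      refine Real.rpow_le_rpow_of_nonpos (by positivity) ?_ (by norm_num)
      unfold parDist
      nlinarith [sq_nonneg ‖x - x'‖]
    gcongr

lemma hasInitialVelocity_of_integralEquation {ν : ℝ} {u₀ : E3 → E3} {g u : SpaceTime → E3}
    (hν : 0 < ν) (hu₀ : LocallyIntegrable u₀)
    (hg : LocallyIntegrableOn g (halfSpace : Set SpaceTime)) (hu : LocallySquareIntegrable u)
    (heq : ∀ᵐ q : SpaceTime ∂(volume.restrict (halfSpace : Set SpaceTime)),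
      IntegralEquationAt ν u₀ g u q.1 q.2) : HasInitialVelocity u₀ u := by
  intro i φ
  have hint := fun a ha => integrable_exp_mul_initial hν hu₀ heq (a := a) ha
  -- Three derivatives: one is taken over from the quadratic kernel, and two more are needed for the
  -- uniform bound on the forcing kernel.
  have hφ2 : ContDiff ℝ 3 φ := mod_cast contDiff_infty.1 φ.contDiff 3
  have hφ : Continuous φ := φ.contDiff.continuous
  have hc : HasCompactSupport φ := φ.hasCompactSupport
  set e : E3 := EuclideanSpace.single i 1 with he
  have he1 : ‖e‖ = 1 := by simp [he]
  have hei : ∀ y : E3, ⟪y, e⟫ = y i := fun y => by simp [he, EuclideanSpace.inner_single_right]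
  obtain ⟨h1i, h1⟩ := tendsto_integral_mul_inner_caloric hν hu₀.aestronglyMeasurable hint hφ hc e
  obtain ⟨CF, hCF0, hCF⟩ := exists_bound_integral_mul_forcing hν (hφ2.of_le (by norm_num)) hc
  obtain ⟨h2i, h2⟩ := (admissibleSource_forcing hν hg heq).tendsto_integral_slice_mul_duhamel hν
    hφ hc (v := e) hCF0 (fun x' s q hs => by simpa [he1] using hCF x' (g q) e s hs)
  have hd : ∀ j : Fin 3, ∃ C, 0 ≤ C ∧ ∀ (x' w v : E3) (s : ℝ), 0 < s →
      |∫ x, fderiv ℝ φ x (EuclideanSpace.single j 1) * ⟪forcingTerm ν (x - x') s w, v⟫| ≤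
        C * ‖w‖ * ‖v‖ := fun j =>
    exists_bound_integral_mul_forcing hν
      ((hφ2.fderiv_right (m := 2) (by norm_num)).clm_apply contDiff_const) (hc.fderiv_apply ℝ _)
  choose CN hCN0 hCN using hd
  -- The derivative in the direction u(q) is moved onto φ and expanded in coordinates. Each
  -- coordinate of u(q) is bounded by its norm, and the forcing kernel contributes the second factor
  -- of the norm.
  have hnear : ∀ x' s q, 0 < s → |∫ x, φ x * ⟪nonlinearTerm ν (x - x') s (u q), e⟫| ≤
      (∑ j, CN j) * ‖u q‖ ^ 2 := by
    intro x' s q hs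
    rw [integral_mul_nonlinear_eq_forcing hν hs (hφ2.of_le (by norm_num)) hc]
    have e1 : ∀ x, fderiv ℝ φ x (u q) * ⟪forcingTerm ν (x - x') s (u q), e⟫ =
        ∑ j, u q j * (fderiv ℝ φ x (EuclideanSpace.single j 1) *
          ⟪forcingTerm ν (x - x') s (u q), e⟫) := by
      intro x
      have : u q = ∑ j : Fin 3, u q j • (EuclideanSpace.single j 1 : E3) := by
        ext k
        simp [Fin.sum_univ_three]
        fin_cases k <;> simp
      conv_lhs => rw [this, map_sum]
      rw [← this, Finset.sum_mul]
      refine Finset.sum_congr rfl fun j _ => ?_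
      rw [map_smul, smul_eq_mul, mul_assoc]
    simp_rw [e1]
    rw [integral_finsetSum _ fun j _ => ?_]
    · rw [Finset.sum_mul]
      refine (Finset.abs_sum_le_sum_abs _ _).trans (Finset.sum_le_sum fun j _ => ?_)
      rw [integral_const_mul, abs_mul]
      have h3 := hCN j x' (u q) e s hs
      rw [he1, mul_one] at h3
      have h4 : |u q j| ≤ ‖u q‖ := by
        simpa using PiLp.norm_apply_le (u q) j
      calc _ ≤ ‖u q‖ * (CN j * ‖u q‖) := mul_le_mul h4 h3 (abs_nonneg _) (norm_nonneg _)
        _ = _ := by ring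
    · refine Integrable.const_mul (integrable_mul_forcing hν hs ?_ ?_ x' (u q) e) _
      · exact ((hφ2.continuous_fderiv (by norm_num)).clm_apply continuous_const)
      · exact hc.fderiv_apply ℝ _
  obtain ⟨h3i, h3⟩ := (admissibleSource_nonlinear hν hu heq).tendsto_integral_slice_mul_duhamel hν
    hφ hc (v := e) (Finset.sum_nonneg fun j _ => hCN0 j) hnear
  have hlim := (h1.mono_left (inf_le_left (b := ae (volume : Measure ℝ)))).add (h3.add h2)
  simp only [hei, add_zero] at hlim
  refine hlim.congr' ?_
  -- An equation valid at almost every point holds, for almost every t, at almost every x; the limit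
  -- is therefore taken along almost every t.
  have hae : ∀ᵐ t : ℝ, ∀ᵐ x : E3, 0 < t → IntegralEquationAt ν u₀ g u x t := by
    have h4 : ∀ᵐ q : SpaceTime, 0 < q.2 → IntegralEquationAt ν u₀ g u q.1 q.2 :=
      ((ae_restrict_iff' isOpen_halfSpace.measurableSet).1 heq).mono fun q hq h =>
        hq (mem_halfSpace.2 h)
    have := (Measure.measurePreserving_swap (μ := (volume : Measure ℝ))
      (ν := (volume : Measure E3))).quasiMeasurePreserving.ae h4
    exact Measure.ae_ae_of_ae_prod this
  have g1 : ∀ᶠ t : ℝ in 𝓝[>] 0 ⊓ ae volume, t ∈ Ioo (0 : ℝ) 1 :=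
    Eventually.filter_mono inf_le_left (Ioo_mem_nhdsGT (zero_lt_one' ℝ))
  have g2 := (hae.and (h2i.and h3i)).filter_mono
    (inf_le_right : 𝓝[>] (0 : ℝ) ⊓ ae volume ≤ ae volume)
  filter_upwards [g1, g2] with t ht1 ⟨ht2, ht3, ht4⟩
  have a1 := h1i t ht1.1
  have a2 := ht3 ht1.2
  have a3 := ht4 ht1.2
  simp only [hei] at a1 a2 a3
  have a4 := integral_add a1 (a3.add a2)
  simp only [Pi.add_apply] at a4
  rw [← integral_add a3 a2, ← a4]
  refine integral_congr_ae (ht2.mono fun x hx => ?_)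
  have h5 := (hx ht1.1).eq_add ht1.1
  simp only [h5]
  simp only [caloric, duhamel, PiLp.add_apply]
  ring

end

section

/-! ### Integration along coordinate lines -/

/-- The `i`-th spatial coordinate on space-time. -/
def coord (i : Fin 3) : SpaceTime →L[ℝ] ℝ :=
  (EuclideanSpace.proj (𝕜 := ℝ) i).comp (ContinuousLinearMap.fst ℝ E3 ℝ)

lemma coord_apply (i : Fin 3) (q : SpaceTime) : coord i q = q.1 i := rfl

lemma coord_spaceDir_self (i : Fin 3) : coord i (spaceDir i) = 1 := by
  simp [coord_apply, spaceDir]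

lemma coord_spaceDir_of_ne {i j : Fin 3} (h : i ≠ j) : coord i (spaceDir j) = 0 := by
  simp [coord_apply, spaceDir, h]

lemma norm_spaceDir (i : Fin 3) : ‖spaceDir i‖ = 1 := by
  simp [spaceDir, Prod.norm_def]

lemma abs_coord_le (i : Fin 3) (q : SpaceTime) : |coord i q| ≤ ‖q‖ := by
  have h1 : ‖q.1 i‖ ≤ ‖q.1‖ := PiLp.norm_apply_le q.1 i
  exact h1.trans (norm_fst_le q)

/-- Motion in the direction `spaceDir i` away from the hyperplane xᵢ = 0 makes an acute angle with
the position vector. This lets integrals over outgoing half-lines inherit the decay of the integrand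
at the base point. -/
lemma norm_le_norm_add_smul (i : Fin 3) {q : SpaceTime} {s : ℝ} (h : 0 ≤ s * coord i q) :
    ‖q‖ ≤ ‖q + s • spaceDir i‖ := by
  have h1 : ‖q.1‖ ≤ ‖q.1 + s • (EuclideanSpace.single i 1 : E3)‖ := by
    refine abs_le_of_sq_le_sq' ?_ (norm_nonneg _) |>.2
    have e : ⟪q.1, s • (EuclideanSpace.single i 1 : E3)⟫ = s * coord i q := by
      simp [inner_smul_right, EuclideanSpace.inner_single_right, coord_apply]
    rw [norm_add_sq_real, e]
    nlinarith [sq_nonneg ‖s • (EuclideanSpace.single i 1 : E3)‖]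
  rw [Prod.norm_def, Prod.norm_def]
  refine max_le_max h1 ?_
  simp [spaceDir]

lemma abs_le_norm_add_smul (i : Fin 3) {q : SpaceTime} {s : ℝ} (h : 0 ≤ s * coord i q) :
    |s| ≤ ‖q + s • spaceDir i‖ := by
  refine le_trans ?_ (abs_coord_le i _)
  rw [map_add, map_smul, coord_spaceDir_self, smul_eq_mul, mul_one]
  refine sq_le_sq.1 ?_
  nlinarith [sq_nonneg (coord i q)]

lemma integrable_one_add_abs_sq_inv : Integrable fun s : ℝ => ((1 + |s|) ^ 2)⁻¹ := by
  have h := integrable_one_add_norm (E := ℝ) (μ := volume) (r := 2) (by simp)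
  refine h.congr (Eventually.of_forall fun s => ?_)
  simp only [Real.norm_eq_abs]
  rw [Real.rpow_neg (by positivity)]
  norm_cast

/-- Integration over a set of translates along the `i`-th coordinate direction. -/
def lineIntegral {F : Type} [NormedAddCommGroup F] [NormedSpace ℝ F] (i : Fin 3) (S : Set ℝ)
    (f : SpaceTime → F) (q : SpaceTime) : F :=
  ∫ s in S, f (q + s • spaceDir i)

section LineIntegral

variable {F : Type} [NormedAddCommGroup F] [NormedSpace ℝ F]

/-- The Schwartz norm controlling `(1 + ‖q‖) ^ k * ‖Dⁿ f q‖`. -/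
def decayNorm (k n : ℕ) (f : 𝓢(SpaceTime, F)) : ℝ :=
  2 ^ k * (Finset.Iic (k, n)).sup (fun m => SchwartzMap.seminorm ℝ m.1 m.2) f

lemma decayNorm_nonneg (k n : ℕ) (f : 𝓢(SpaceTime, F)) : 0 ≤ decayNorm k n f := by
  unfold decayNorm
  have := apply_nonneg ((Finset.Iic (k, n)).sup
    (fun m => SchwartzMap.seminorm ℝ (E := SpaceTime) (F := F) m.1 m.2)) f
  positivity

lemma decay_le (k n : ℕ) (f : 𝓢(SpaceTime, F)) (q : SpaceTime) :
    (1 + ‖q‖) ^ k * ‖iteratedFDeriv ℝ n f q‖ ≤ decayNorm k n f :=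
  SchwartzMap.one_add_le_sup_seminorm_apply (m := (k, n)) le_rfl le_rfl f q

lemma one_add_abs_le (i : Fin 3) (q : SpaceTime) (s : ℝ) :
    1 + |s| ≤ (1 + ‖q‖) * (1 + ‖q + s • spaceDir i‖) := by
  have h1 : |s| ≤ ‖q + s • spaceDir i‖ + ‖q‖ := by
    have e : s • spaceDir i = (q + s • spaceDir i) - q := by abel
    have h2 : ‖s • spaceDir i‖ = |s| := by rw [norm_smul, norm_spaceDir, mul_one, Real.norm_eq_abs]
    rw [← h2]
    conv_lhs => rw [e]
    exact norm_sub_le _ _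
  nlinarith [mul_nonneg (norm_nonneg q) (norm_nonneg (q + s • spaceDir i))]

lemma norm_line_le (f : 𝓢(SpaceTime, F)) (i : Fin 3) {R : ℝ} {q : SpaceTime} (hq : ‖q‖ ≤ R)
    (s : ℝ) : ‖f (q + s • spaceDir i)‖ ≤ decayNorm 2 0 f * (1 + R) ^ 2 * ((1 + |s|) ^ 2)⁻¹ := by
  have h1 := decay_le 2 0 f (q + s • spaceDir i)
  rw [norm_iteratedFDeriv_zero] at h1
  have h2 := one_add_abs_le i q s
  have h3 : (1 + |s|) ^ 2 ≤ (1 + R) ^ 2 * (1 + ‖q + s • spaceDir i‖) ^ 2 := by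
    rw [← mul_pow]
    refine pow_le_pow_left₀ (by positivity) (h2.trans ?_) 2
    gcongr
  rw [← div_eq_mul_inv, le_div_iff₀ (by positivity)]
  calc ‖f (q + s • spaceDir i)‖ * (1 + |s|) ^ 2
      ≤ ‖f (q + s • spaceDir i)‖ * ((1 + R) ^ 2 * (1 + ‖q + s • spaceDir i‖) ^ 2) := by gcongr
    _ = (1 + R) ^ 2 * ((1 + ‖q + s • spaceDir i‖) ^ 2 * ‖f (q + s • spaceDir i)‖) := by ring
    _ ≤ (1 + R) ^ 2 * decayNorm 2 0 f := by gcongr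
    _ = _ := by ring

lemma integrable_line (f : 𝓢(SpaceTime, F)) (i : Fin 3) (q : SpaceTime) :
    Integrable fun s : ℝ => f (q + s • spaceDir i) := by
  refine Integrable.mono' (integrable_one_add_abs_sq_inv.const_mul
    (decayNorm 2 0 f * (1 + ‖q‖) ^ 2)) ?_ (Eventually.of_forall fun s => norm_line_le f i le_rfl s)
  exact (f.continuous.comp (by fun_prop)).aestronglyMeasurable

lemma hasFDerivAt_lineIntegral (f : 𝓢(SpaceTime, F)) (i : Fin 3) (S : Set ℝ) (q : SpaceTime) :
    HasFDerivAt (lineIntegral i S f)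
      (lineIntegral i S (SchwartzMap.fderivCLM ℝ SpaceTime F f) q) q := by
  refine hasFDerivAt_integral_of_dominated_of_fderiv_le (s := Metric.ball q 1)
    (F' := fun q s => SchwartzMap.fderivCLM ℝ SpaceTime F f (q + s • spaceDir i))
    (bound := fun s => decayNorm 2 0 (SchwartzMap.fderivCLM ℝ SpaceTime F f) *
      (1 + (‖q‖ + 1)) ^ 2 * ((1 + |s|) ^ 2)⁻¹)
    (Metric.ball_mem_nhds q one_pos) ?_ ((integrable_line f i q).restrict) ?_ ?_
    (integrable_one_add_abs_sq_inv.const_mul _).restrict ?_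
  · exact Eventually.of_forall fun q => (integrable_line f i q).restrict.aestronglyMeasurable
  · exact (integrable_line _ i q).restrict.aestronglyMeasurable
  · refine Eventually.of_forall fun s q' hq' => norm_line_le _ i ?_ s
    have h1 : ‖q' - q‖ < 1 := by simpa [dist_eq_norm] using hq'
    have h2 := norm_sub_norm_le q' q
    linarith
  · refine Eventually.of_forall fun s q' _ => ?_
    have h1 := f.hasFDerivAt (q' + s • spaceDir i)
    simpa [Function.comp_def] using h1.comp q' ((hasFDerivAt_id q').add_const (s • spaceDir i))

lemma fderiv_lineIntegral (f : 𝓢(SpaceTime, F)) (i : Fin 3) (S : Set ℝ) :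
    fderiv ℝ (lineIntegral i S f) = lineIntegral i S (SchwartzMap.fderivCLM ℝ SpaceTime F f) := by
  ext1 q
  exact (hasFDerivAt_lineIntegral f i S q).fderiv

end LineIntegral

/-- The derivative of a line integral is the line integral of the derivative, again a Schwartz
function but with values in linear maps; hence the induction over all target spaces. -/
lemma contDiff_lineIntegral_nat (n : ℕ) {F : Type} [NormedAddCommGroup F] [NormedSpace ℝ F]
    (f : 𝓢(SpaceTime, F)) (i : Fin 3) (S : Set ℝ) : ContDiff ℝ n (lineIntegral i S f) := by
  induction n generalizing F with
  | zero =>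
    rw [Nat.cast_zero, contDiff_zero]
    exact continuous_iff_continuousAt.2 fun q => (hasFDerivAt_lineIntegral f i S q).continuousAt
  | succ n ih =>
    rw [Nat.cast_succ, contDiff_succ_iff_fderiv]
    refine ⟨fun q => (hasFDerivAt_lineIntegral f i S q).differentiableAt, by simp, ?_⟩
    rw [fderiv_lineIntegral]
    exact ih _

lemma contDiff_lineIntegral {F : Type} [NormedAddCommGroup F] [NormedSpace ℝ F]
    (f : 𝓢(SpaceTime, F)) (i : Fin 3) (S : Set ℝ) : ContDiff ℝ ∞ (lineIntegral i S f) :=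
  contDiff_infty.2 fun n => contDiff_lineIntegral_nat n f i S

lemma norm_iteratedFDeriv_lineIntegral_le (n : ℕ) {F : Type} [NormedAddCommGroup F]
    [NormedSpace ℝ F] (f : 𝓢(SpaceTime, F)) (i : Fin 3) (S : Set ℝ) (q : SpaceTime) :
    ‖iteratedFDeriv ℝ n (lineIntegral i S f) q‖ ≤
      ∫ s in S, ‖iteratedFDeriv ℝ n f (q + s • spaceDir i)‖ := by
  induction n generalizing F with
  | zero =>
    simp only [norm_iteratedFDeriv_zero]
    exact norm_integral_le_integral_norm _
  | succ n ih =>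
    rw [← norm_iteratedFDeriv_fderiv, fderiv_lineIntegral]
    refine (ih _).trans_eq ?_
    refine integral_congr_ae (Eventually.of_forall fun s => ?_)
    simp only
    rw [← norm_iteratedFDeriv_fderiv]
    rfl

/-- Decay of line integrals wherever the base point is controlled by the points of the line. -/
lemma norm_pow_mul_iteratedFDeriv_lineIntegral_le {F : Type} [NormedAddCommGroup F]
    [NormedSpace ℝ F] (f : 𝓢(SpaceTime, F)) (i : Fin 3) {S : Set ℝ} (hS : MeasurableSet S)
    {q : SpaceTime} {M : ℝ} (hM : 1 ≤ M)
    (h1 : ∀ s ∈ S, 1 + ‖q‖ ≤ M * (1 + ‖q + s • spaceDir i‖))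
    (h2 : ∀ s ∈ S, 1 + |s| ≤ M * (1 + ‖q + s • spaceDir i‖)) (k n : ℕ) :
    (1 + ‖q‖) ^ k * ‖iteratedFDeriv ℝ n (lineIntegral i S f) q‖ ≤
      M ^ (k + 2) * (∫ s : ℝ, ((1 + |s|) ^ 2)⁻¹) * decayNorm (k + 2) n f := by
  have hd0 := decayNorm_nonneg (k + 2) n f
  -- Of the k + 2 powers of decay, k are transferred to the base point and two make the integral in
  -- s converge.
  have h3 : ∀ s ∈ S, (1 + ‖q‖) ^ k * ‖iteratedFDeriv ℝ n f (q + s • spaceDir i)‖ ≤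
      M ^ (k + 2) * decayNorm (k + 2) n f * ((1 + |s|) ^ 2)⁻¹ := by
    intro s hs
    rw [← div_eq_mul_inv, le_div_iff₀ (by positivity)]
    have h4 := decay_le (k + 2) n f (q + s • spaceDir i)
    calc (1 + ‖q‖) ^ k * ‖iteratedFDeriv ℝ n f (q + s • spaceDir i)‖ * (1 + |s|) ^ 2
        ≤ (M * (1 + ‖q + s • spaceDir i‖)) ^ k * ‖iteratedFDeriv ℝ n f (q + s • spaceDir i)‖ *
          (M * (1 + ‖q + s • spaceDir i‖)) ^ 2 := by
          gcongr
          · exact h1 s hs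
          · exact h2 s hs
      _ = M ^ (k + 2) * ((1 + ‖q + s • spaceDir i‖) ^ (k + 2) *
          ‖iteratedFDeriv ℝ n f (q + s • spaceDir i)‖) := by
          generalize 1 + ‖q + s • spaceDir i‖ = X
          ring
      _ ≤ _ := by gcongr
  have hbi := (integrable_one_add_abs_sq_inv.const_mul
    (M ^ (k + 2) * decayNorm (k + 2) n f))
  calc (1 + ‖q‖) ^ k * ‖iteratedFDeriv ℝ n (lineIntegral i S f) q‖
      ≤ (1 + ‖q‖) ^ k * ∫ s in S, ‖iteratedFDeriv ℝ n f (q + s • spaceDir i)‖ := by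
        gcongr
        exact norm_iteratedFDeriv_lineIntegral_le n f i S q
    _ = ∫ s in S, (1 + ‖q‖) ^ k * ‖iteratedFDeriv ℝ n f (q + s • spaceDir i)‖ := by
        rw [integral_const_mul]
    _ ≤ ∫ s in S, M ^ (k + 2) * decayNorm (k + 2) n f * ((1 + |s|) ^ 2)⁻¹ := by
        refine integral_mono_of_nonneg (Eventually.of_forall fun s => by positivity) hbi.restrict ?_
        exact (ae_restrict_iff' hS).2 (Eventually.of_forall h3)
    _ ≤ ∫ s, M ^ (k + 2) * decayNorm (k + 2) n f * ((1 + |s|) ^ 2)⁻¹ :=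
        setIntegral_le_integral hbi (Eventually.of_forall fun s => by positivity)
    _ = _ := by rw [integral_const_mul]; ring

end

/-! ### Averages and primitives along coordinate lines -/

/-- A smooth bump on the line, supported in `[-1, 1]` and of integral one. -/
def cutoffBump : ContDiffBump (0 : ℝ) := ⟨1 / 2, 1, by norm_num, by norm_num⟩

/-- A smooth function on the line, supported in `[-1, 1]` and of integral one. -/
def cutoff : ℝ → ℝ := cutoffBump.normed volume

lemma contDiff_cutoff {n : ℕ∞} : ContDiff ℝ n cutoff := cutoffBump.contDiff_normed

lemma integral_cutoff : ∫ s, cutoff s = 1 := cutoffBump.integral_normed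

lemma tsupport_cutoff : tsupport cutoff = Metric.closedBall 0 1 := cutoffBump.tsupport_normed_eq

lemma hasCompactSupport_cutoff : HasCompactSupport cutoff := cutoffBump.hasCompactSupport_normed

lemma abs_le_one_of_cutoff_ne_zero {s : ℝ} (h : cutoff s ≠ 0) : |s| ≤ 1 := by
  have := subset_tsupport _ h
  rw [tsupport_cutoff] at this
  simpa using this

lemma decayNorm_mono {F : Type} [NormedAddCommGroup F] [NormedSpace ℝ F] (k : ℕ) {n n' : ℕ}
    (h : n' ≤ n) (f : 𝓢(SpaceTime, F)) : decayNorm k n' f ≤ decayNorm k n f := by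
  unfold decayNorm
  refine mul_le_mul_of_nonneg_left ?_ (by positivity)
  have h1 : Finset.Iic (k, n') ⊆ Finset.Iic (k, n) :=
    Finset.Iic_subset_Iic.2 (Prod.mk_le_mk.2 ⟨le_rfl, h⟩)
  have h2 : (Finset.Iic (k, n')).sup (fun m => SchwartzMap.seminorm ℝ (E := SpaceTime) (F := F) m.1 m.2) ≤
      (Finset.Iic (k, n)).sup (fun m => SchwartzMap.seminorm ℝ m.1 m.2) := Finset.sup_mono h1
  exact h2 f

lemma continuous_sup_schwartzSeminormFamily (s : Finset (ℕ × ℕ)) :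
    Continuous (s.sup (schwartzSeminormFamily ℝ SpaceTime ℝ) : Seminorm ℝ 𝓢(SpaceTime, ℝ)) := by
  classical
  induction s using Finset.induction_on with
  | empty =>
    rw [Finset.sup_empty, Seminorm.coe_bot]
    exact continuous_const
  | insert m s _ ih =>
    rw [Finset.sup_insert, Seminorm.coe_sup]
    exact ((schwartz_withSeminorms ℝ SpaceTime ℝ).continuous_seminorm m).sup ih

lemma exists_bound_iteratedFDeriv_cutoff (i : Fin 3) (n : ℕ) :
    ∃ B, 0 ≤ B ∧ ∀ q : SpaceTime, ‖iteratedFDeriv ℝ n (fun q => cutoff (coord i q)) q‖ ≤ B := by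
  have hc := (contDiff_cutoff (n := ⊤)).continuous_iteratedFDeriv (m := n) (by exact_mod_cast le_top)
  obtain ⟨B, hB⟩ := hc.bounded_above_of_compact_support (hasCompactSupport_cutoff.iteratedFDeriv n)
  refine ⟨B * ∏ _j : Fin n, ‖coord i‖, by
    have := (norm_nonneg _).trans (hB 0)
    positivity, fun q => ?_⟩
  have e := (coord i).iteratedFDeriv_comp_right (contDiff_cutoff (n := n)) q (i := n) le_rfl
  have e2 : (fun q => cutoff (coord i q)) = cutoff ∘ coord i := rfl
  rw [e2, e]
  refine (ContinuousMultilinearMap.norm_compContinuousLinearMap_le _ _).trans ?_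
  gcongr
  exact hB _

lemma iteratedFDeriv_cutoff_eq_zero (i : Fin 3) (n : ℕ) {q : SpaceTime} (hq : 1 < |coord i q|) :
    iteratedFDeriv ℝ n (fun q => cutoff (coord i q)) q = 0 := by
  by_contra h
  have h1 := support_iteratedFDeriv_subset (𝕜 := ℝ) n (f := fun q : SpaceTime => cutoff (coord i q)) h
  have h2 : tsupport (fun q : SpaceTime => cutoff (coord i q)) ⊆ {q | |coord i q| ≤ 1} :=
    closure_minimal (fun q hq => abs_le_one_of_cutoff_ne_zero hq)
      (isClosed_le (by fun_prop) continuous_const)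
  exact absurd (h2 h1) (not_le.2 hq)

lemma lineIntegral_add (i : Fin 3) (S : Set ℝ) (f g : 𝓢(SpaceTime, ℝ)) (q : SpaceTime) :
    lineIntegral i S (f + g : 𝓢(SpaceTime, ℝ)) q = lineIntegral i S f q + lineIntegral i S g q :=
  integral_add (integrable_line f i q).restrict (integrable_line g i q).restrict

lemma lineIntegral_smul (i : Fin 3) (S : Set ℝ) (c : ℝ) (f : 𝓢(SpaceTime, ℝ)) (q : SpaceTime) :
    lineIntegral i S (c • f : 𝓢(SpaceTime, ℝ)) q = c * lineIntegral i S f q :=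
  integral_const_mul c _

/-- In the slab |xᵢ| ≤ 1, where the cutoff lives, the base point is within distance one of the
closest point of its line to the hyperplane xᵢ = 0, so whole lines satisfy the decay hypotheses up
to the factor 2. -/
lemma line_bounds_of_abs_coord_le (i : Fin 3) {q : SpaceTime} (hq : |coord i q| ≤ 1) (s : ℝ) :
    1 + ‖q‖ ≤ 2 * (1 + ‖q + s • spaceDir i‖) ∧ 1 + |s| ≤ 2 * (1 + ‖q + s • spaceDir i‖) := by
  have h0 := norm_nonneg (q + s • spaceDir i)
  constructor
  · have h1 := norm_le_norm_add_smul i (q := q - coord i q • spaceDir i) (s := s + coord i q) (by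
      rw [map_sub, map_smul, coord_spaceDir_self]; simp)
    have e : q - coord i q • spaceDir i + (s + coord i q) • spaceDir i = q + s • spaceDir i := by
      rw [add_smul]; abel
    rw [e] at h1
    have h2 : ‖q‖ ≤ ‖q - coord i q • spaceDir i‖ + ‖coord i q • spaceDir i‖ := by
      conv_lhs => rw [← sub_add_cancel q (coord i q • spaceDir i)]
      exact norm_add_le _ _
    rw [norm_smul, norm_spaceDir, mul_one, Real.norm_eq_abs] at h2
    linarith
  · have h1 := abs_coord_le i (q + s • spaceDir i)
    rw [map_add, map_smul, coord_spaceDir_self, smul_eq_mul, mul_one] at h1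
    have h2 : |s| ≤ |coord i q + s| + |coord i q| := by
      have := abs_sub (coord i q + s) (coord i q)
      simpa using this
    linarith

/-- `f ↦ h(xᵢ) ∫ f dxᵢ` on Schwartz space. -/
def avg (i : Fin 3) : 𝓢(SpaceTime, ℝ) →L[ℝ] 𝓢(SpaceTime, ℝ) :=
  SchwartzMap.mkCLM (σ := RingHom.id ℝ)
    (fun f q => cutoff (coord i q) * lineIntegral i univ f q)
    (fun f g q => by rw [lineIntegral_add, mul_add])
    (fun c f q => by rw [lineIntegral_smul, RingHom.id_apply, smul_eq_mul]; ring)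
    (fun f => ((contDiff_cutoff (n := ⊤)).comp (coord i).contDiff).mul (contDiff_lineIntegral f i univ))
    (by
      rintro ⟨k, n⟩
      choose B hB0 hB using exists_bound_iteratedFDeriv_cutoff i
      set I := ∫ s : ℝ, ((1 + |s|) ^ 2)⁻¹ with hI
      have hI0 : 0 ≤ I := integral_nonneg fun s => by positivity
      refine ⟨Finset.Iic (k + 2, n), (∑ j ∈ Finset.range (n + 1), (n.choose j : ℝ) * B j *
        (2 ^ (k + 2) * I)) * 2 ^ (k + 2), ?_, fun f q => ?_⟩
      · refine mul_nonneg (Finset.sum_nonneg fun j _ => ?_) (by positivity)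
        have := hB0 j
        positivity
      have hD0 := decayNorm_nonneg (k + 2) n f
      have e : (∑ j ∈ Finset.range (n + 1), (n.choose j : ℝ) * B j * (2 ^ (k + 2) * I)) *
          2 ^ (k + 2) * (Finset.Iic (k + 2, n)).sup (schwartzSeminormFamily ℝ SpaceTime ℝ) f =
          ∑ j ∈ Finset.range (n + 1), (n.choose j : ℝ) * B j *
            (2 ^ (k + 2) * I * decayNorm (k + 2) n f) := by
        rw [mul_assoc, Finset.sum_mul]
        refine Finset.sum_congr rfl fun j _ => ?_
        unfold decayNorm schwartzSeminormFamily
        ring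
      rw [e]
      simp only
      have hL := norm_iteratedFDeriv_mul_le
        (((contDiff_cutoff (n := ⊤)).comp (coord i).contDiff : ContDiff ℝ ∞ fun q => cutoff (coord i q)))
        (contDiff_lineIntegral f i univ) q (n := n) (by exact_mod_cast le_top)
      refine (mul_le_mul_of_nonneg_left hL (by positivity)).trans ?_
      rw [Finset.mul_sum]
      refine Finset.sum_le_sum fun j _ => ?_
      -- Full-line integrals do not decay in the direction i. The cutoff compensates: outside |xᵢ| ≤
      -- 1 all its derivatives vanish.
      rcases le_or_gt |coord i q| 1 with hq | hq
      · have h1 := norm_pow_mul_iteratedFDeriv_lineIntegral_le f i MeasurableSet.univ (q := q)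
          one_le_two (fun s _ => (line_bounds_of_abs_coord_le i hq s).1)
          (fun s _ => (line_bounds_of_abs_coord_le i hq s).2) k (n - j)
        have h2 := decayNorm_mono (k + 2) (Nat.sub_le n j) f
        have h3 : ‖q‖ ^ k ≤ (1 + ‖q‖) ^ k := pow_le_pow_left₀ (norm_nonneg _) (by linarith) k
        have hBj := hB0 j
        calc ‖q‖ ^ k * ((n.choose j : ℝ) * ‖iteratedFDeriv ℝ j (fun q => cutoff (coord i q)) q‖ *
              ‖iteratedFDeriv ℝ (n - j) (lineIntegral i univ f) q‖)
            ≤ (1 + ‖q‖) ^ k * ((n.choose j : ℝ) * B j *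
              ‖iteratedFDeriv ℝ (n - j) (lineIntegral i univ f) q‖) := by
              gcongr
              exact hB j q
          _ = (n.choose j : ℝ) * B j * ((1 + ‖q‖) ^ k *
              ‖iteratedFDeriv ℝ (n - j) (lineIntegral i univ f) q‖) := by ring
          _ ≤ (n.choose j : ℝ) * B j * (2 ^ (k + 2) * I * decayNorm (k + 2) (n - j) f) := by
              gcongr
          _ ≤ _ := by gcongr
      · have hz : iteratedFDeriv ℝ j (cutoff ∘ coord i) q = 0 := iteratedFDeriv_cutoff_eq_zero i j hq
        rw [hz, norm_zero]
        have hBj := hB0 j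
        simp only [mul_zero, zero_mul]
        positivity)

lemma avg_apply (i : Fin 3) (f : 𝓢(SpaceTime, ℝ)) (q : SpaceTime) :
    avg i f q = cutoff (coord i q) * lineIntegral i univ f q := rfl

lemma lineIntegral_univ_add_smul (i : Fin 3) (f : SpaceTime → ℝ) (q : SpaceTime) (s : ℝ) :
    lineIntegral i univ f (q + s • spaceDir i) = lineIntegral i univ f q := by
  simp only [lineIntegral, Measure.restrict_univ]
  rw [← integral_add_left_eq_self (fun r : ℝ => f (q + r • spaceDir i)) s]
  simp [add_smul, add_assoc]

/-- The full-line integral is constant along the line and the cutoff has integral one. Hence a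
function minus its average has zero integral over every line, so that its primitive can decay at
both ends. -/
lemma lineIntegral_univ_avg (i : Fin 3) (f : 𝓢(SpaceTime, ℝ)) (q : SpaceTime) :
    lineIntegral i univ (avg i f) q = lineIntegral i univ f q := by
  have h1 : lineIntegral i univ (avg i f) q =
      ∫ s : ℝ, cutoff (coord i q + s) * lineIntegral i univ f q := by
    simp only [lineIntegral, Measure.restrict_univ]
    refine integral_congr_ae (Eventually.of_forall fun s => ?_)
    have h2 := lineIntegral_univ_add_smul i f q s
    simp only [avg_apply, h2, map_add, map_smul, coord_spaceDir_self, smul_eq_mul, mul_one]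
    simp [lineIntegral]
  rw [h1, integral_mul_const, integral_add_left_eq_self cutoff, integral_cutoff, one_mul]

lemma lineIntegral_univ_sub_avg (i : Fin 3) (f : 𝓢(SpaceTime, ℝ)) (q : SpaceTime) :
    lineIntegral i univ (f - avg i f : 𝓢(SpaceTime, ℝ)) q = 0 := by
  have h : lineIntegral i univ (f - avg i f : 𝓢(SpaceTime, ℝ)) q =
      lineIntegral i univ f q - lineIntegral i univ (avg i f) q :=
    integral_sub (integrable_line f i q).restrict (integrable_line (avg i f) i q).restrict
  rw [h, lineIntegral_univ_avg, sub_self]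

lemma lineIntegral_Iic_eq_neg_Ioi (i : Fin 3) {f : 𝓢(SpaceTime, ℝ)}
    (hf : ∀ q, lineIntegral i univ f q = 0) (q : SpaceTime) :
    lineIntegral i (Iic 0) f q = -lineIntegral i (Ioi 0) f q := by
  have h := integral_add_compl (measurableSet_Iic (a := (0 : ℝ))) (integrable_line f i q)
  have h2 := hf q
  simp only [lineIntegral, Measure.restrict_univ] at h2 ⊢
  rw [compl_Iic, h2] at h
  linarith

/-- Zero total integral allows the primitive to be computed from either end. The half-line that
leads away from the hyperplane xᵢ = 0 is chosen, since norms do not decrease along it. -/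
lemma norm_pow_mul_iteratedFDeriv_primitive_le (i : Fin 3) {f : 𝓢(SpaceTime, ℝ)}
    (hf : ∀ q, lineIntegral i univ f q = 0) (k n : ℕ) (q : SpaceTime) :
    (1 + ‖q‖) ^ k * ‖iteratedFDeriv ℝ n (lineIntegral i (Iic 0) f) q‖ ≤
      (∫ s : ℝ, ((1 + |s|) ^ 2)⁻¹) * decayNorm (k + 2) n f := by
  rcases le_total (coord i q) 0 with hq | hq
  · have h := norm_pow_mul_iteratedFDeriv_lineIntegral_le f i (measurableSet_Iic (a := (0 : ℝ)))
      (q := q) (le_refl (1 : ℝ)) (fun s hs => by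
        have := norm_le_norm_add_smul i (mul_nonneg_of_nonpos_of_nonpos hs hq)
        linarith) (fun s hs => by
        have := abs_le_norm_add_smul i (mul_nonneg_of_nonpos_of_nonpos hs hq)
        linarith) k n
    simpa using h
  · have h := norm_pow_mul_iteratedFDeriv_lineIntegral_le f i (measurableSet_Ioi (a := (0 : ℝ)))
      (q := q) (le_refl (1 : ℝ)) (fun s hs => by
        have := norm_le_norm_add_smul i (mul_nonneg (le_of_lt hs) hq)
        linarith) (fun s hs => by
        have := abs_le_norm_add_smul i (mul_nonneg (le_of_lt hs) hq)
        linarith) k n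
    have e : lineIntegral i (Iic 0) f = -lineIntegral i (Ioi 0) f := by
      ext q; exact lineIntegral_Iic_eq_neg_Ioi i hf q
    rw [e, iteratedFDeriv_neg_apply, norm_neg]
    simpa using h

/-- The primitive along the `i`-th coordinate of a Schwartz function minus its average. -/
def prim (i : Fin 3) : 𝓢(SpaceTime, ℝ) →L[ℝ] 𝓢(SpaceTime, ℝ) :=
  SchwartzMap.mkCLM (σ := RingHom.id ℝ)
    (fun f q => lineIntegral i (Iic 0) (f - avg i f : 𝓢(SpaceTime, ℝ)) q)
    (fun f g q => by
      rw [map_add, add_sub_add_comm, lineIntegral_add])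
    (fun c f q => by
      rw [map_smul, ← smul_sub, lineIntegral_smul, RingHom.id_apply, smul_eq_mul])
    (fun f => contDiff_lineIntegral _ i _)
    (by
      rintro ⟨k, n⟩
      set I := ∫ s : ℝ, ((1 + |s|) ^ 2)⁻¹ with hI
      have hI0 : 0 ≤ I := integral_nonneg fun s => by positivity
      -- The seminorm of f minus its average is a continuous seminorm of f, because averaging is
      -- continuous; it is therefore bounded by finitely many Schwartz seminorms.
      set P : Seminorm ℝ 𝓢(SpaceTime, ℝ) := ((Finset.Iic (k + 2, n)).sup
        (schwartzSeminormFamily ℝ SpaceTime ℝ)).comp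
          ((ContinuousLinearMap.id ℝ _ - avg i : 𝓢(SpaceTime, ℝ) →L[ℝ] 𝓢(SpaceTime, ℝ)) :
            𝓢(SpaceTime, ℝ) →ₗ[ℝ] 𝓢(SpaceTime, ℝ)) with hP
      have hPc : Continuous P := by
        exact (continuous_sup_schwartzSeminormFamily _).comp (ContinuousLinearMap.id ℝ _ - avg i).continuous
      obtain ⟨s, C, -, hC⟩ := Seminorm.bound_of_continuous (schwartz_withSeminorms ℝ SpaceTime ℝ) P hPc
      refine ⟨s, I * 2 ^ (k + 2) * C, by positivity, fun f q => ?_⟩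
      have h1 := norm_pow_mul_iteratedFDeriv_primitive_le i (lineIntegral_univ_sub_avg i f) k n q
      have h2 : ‖q‖ ^ k ≤ (1 + ‖q‖) ^ k := pow_le_pow_left₀ (norm_nonneg _) (by linarith) k
      have h3 : decayNorm (k + 2) n (f - avg i f) = 2 ^ (k + 2) * P f := rfl
      have h4 : P f ≤ C * s.sup (schwartzSeminormFamily ℝ SpaceTime ℝ) f := hC f
      calc _ ≤ (1 + ‖q‖) ^ k * ‖iteratedFDeriv ℝ n
            (lineIntegral i (Iic 0) (f - avg i f : 𝓢(SpaceTime, ℝ))) q‖ := by gcongr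
        _ ≤ I * decayNorm (k + 2) n (f - avg i f) := h1
        _ = I * 2 ^ (k + 2) * P f := by rw [h3]; ring
        _ ≤ I * 2 ^ (k + 2) * (C * s.sup (schwartzSeminormFamily ℝ SpaceTime ℝ) f) := by gcongr
        _ = _ := by ring)

lemma prim_apply (i : Fin 3) (f : 𝓢(SpaceTime, ℝ)) (q : SpaceTime) :
    prim i f q = lineIntegral i (Iic 0) (f - avg i f : 𝓢(SpaceTime, ℝ)) q := rfl

/-! ### Derivatives of averages and primitives -/

lemma fderiv_lineIntegral_apply (f : 𝓢(SpaceTime, ℝ)) (i : Fin 3) (S : Set ℝ) (q w : SpaceTime) :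
    fderiv ℝ (lineIntegral i S f) q w = lineIntegral i S (∂_{w} f : 𝓢(SpaceTime, ℝ)) q := by
  rw [fderiv_lineIntegral, lineIntegral, ContinuousLinearMap.integral_apply
    (integrable_line (SchwartzMap.fderivCLM ℝ SpaceTime ℝ f) i q).restrict]
  refine integral_congr_ae (Eventually.of_forall fun s => ?_)
  exact (SchwartzMap.lineDerivOp_apply_eq_fderiv w f _).symm

lemma hasDerivAt_line (f : 𝓢(SpaceTime, ℝ)) (i : Fin 3) (q : SpaceTime) (s : ℝ) :
    HasDerivAt (fun s : ℝ => f (q + s • spaceDir i))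
      ((∂_{spaceDir i} f : 𝓢(SpaceTime, ℝ)) (q + s • spaceDir i)) s := by
  rw [SchwartzMap.lineDerivOp_apply_eq_fderiv]
  have h1 : HasDerivAt (fun s : ℝ => q + s • spaceDir i) (spaceDir i) s := by
    simpa using ((hasDerivAt_id s).smul_const (spaceDir i)).const_add q
  exact (f.hasFDerivAt (q + s • spaceDir i)).comp_hasDerivAt s h1

lemma tendsto_line (f : 𝓢(SpaceTime, ℝ)) (i : Fin 3) (q : SpaceTime) :
    Tendsto (fun s : ℝ => f (q + s • spaceDir i)) (cocompact ℝ) (𝓝 0) := by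
  refine squeeze_zero_norm (fun s => norm_line_le f i le_rfl s) ?_
  have h1 : Tendsto (fun s : ℝ => |s|) (cocompact ℝ) atTop := tendsto_norm_cocompact_atTop
  have h2 : Tendsto (fun s : ℝ => ((1 + |s|) ^ 2)⁻¹) (cocompact ℝ) (𝓝 0) :=
    tendsto_inv_atTop_zero.comp
      ((tendsto_pow_atTop two_ne_zero).comp (tendsto_atTop_add_const_left _ 1 h1))
  have h3 := h2.const_mul (decayNorm 2 0 f * (1 + ‖q‖) ^ 2)
  rw [mul_zero] at h3
  exact h3

lemma lineIntegral_Iic_lineDeriv (f : 𝓢(SpaceTime, ℝ)) (i : Fin 3) (q : SpaceTime) :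
    lineIntegral i (Iic 0) (∂_{spaceDir i} f : 𝓢(SpaceTime, ℝ)) q = f q := by
  have h := integral_Iic_of_hasDerivAt_of_tendsto' (a := (0 : ℝ))
    (fun s _ => hasDerivAt_line f i q s) (integrable_line _ i q).integrableOn
    ((tendsto_line f i q).mono_left atBot_le_cocompact)
  simpa [lineIntegral] using h

lemma lineIntegral_univ_lineDeriv (f : 𝓢(SpaceTime, ℝ)) (i : Fin 3) (q : SpaceTime) :
    lineIntegral i univ (∂_{spaceDir i} f : 𝓢(SpaceTime, ℝ)) q = 0 := by
  have h := integral_of_hasDerivAt_of_tendsto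
    (fun s => hasDerivAt_line f i q s) (integrable_line _ i q)
    ((tendsto_line f i q).mono_left atBot_le_cocompact)
    ((tendsto_line f i q).mono_left atTop_le_cocompact)
  simpa [lineIntegral] using h

/-- Differentiation passes under the integral and the fundamental theorem of calculus applies. Used
once for each coordinate, this writes a function as a divergence plus its triple average. -/
lemma lineDeriv_prim (i : Fin 3) (f : 𝓢(SpaceTime, ℝ)) :
    (∂_{spaceDir i} (prim i f) : 𝓢(SpaceTime, ℝ)) = f - avg i f := by
  ext q
  rw [SchwartzMap.lineDerivOp_apply_eq_fderiv]
  have e : (⇑(prim i f) : SpaceTime → ℝ) = lineIntegral i (Iic 0) (f - avg i f : 𝓢(SpaceTime, ℝ)) := rfl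
  rw [e, fderiv_lineIntegral_apply, lineIntegral_Iic_lineDeriv]

lemma avg_lineDeriv_self (i : Fin 3) (f : 𝓢(SpaceTime, ℝ)) :
    avg i (∂_{spaceDir i} f) = 0 := by
  ext q
  rw [avg_apply, lineIntegral_univ_lineDeriv, mul_zero]
  rfl

lemma avg_lineDeriv_of_ne {i j : Fin 3} (h : i ≠ j) (f : 𝓢(SpaceTime, ℝ)) :
    avg i (∂_{spaceDir j} f) = ∂_{spaceDir j} (avg i f) := by
  ext q
  rw [SchwartzMap.lineDerivOp_apply_eq_fderiv, avg_apply]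
  have e : (⇑(avg i f) : SpaceTime → ℝ) =
      fun q => cutoff (coord i q) * lineIntegral i univ f q := rfl
  have h1 : HasFDerivAt (fun q => cutoff (coord i q)) (deriv cutoff (coord i q) • coord i) q :=
    (((contDiff_cutoff (n := 1)).differentiable (by norm_num)) _).hasDerivAt.comp_hasFDerivAt q
      (coord i).hasFDerivAt
  have h2 := (hasFDerivAt_lineIntegral f i univ q).differentiableAt.hasFDerivAt
  have h3 : HasFDerivAt (fun q => cutoff (coord i q) * lineIntegral i univ f q) _ q := h1.mul h2
  rw [e, h3.fderiv]
  simp [coord_spaceDir_of_ne h, fderiv_lineIntegral_apply]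

/-! ### Supports -/

/-- `f` vanishes outside a box. -/
def SupportedInBox (R a b : ℝ) (f : SpaceTime → ℝ) : Prop :=
  ∀ q, f q ≠ 0 → (∀ k, |q.1 k| ≤ R) ∧ a ≤ q.2 ∧ q.2 ≤ b

/-- The closed box. -/
def box (R a b : ℝ) : Set SpaceTime :=
  {q | (∀ k, |q.1 k| ≤ R) ∧ a ≤ q.2 ∧ q.2 ≤ b}

lemma isCompact_box (R a b : ℝ) : IsCompact (box R a b) := by
  refine Metric.isCompact_of_isClosed_isBounded ?_ ?_
  · have e : box R a b = (⋂ k, {q : SpaceTime | |q.1 k| ≤ R}) ∩ ({q | a ≤ q.2} ∩ {q | q.2 ≤ b}) := by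
      ext q; simp [box]
    rw [e]
    refine (isClosed_iInter fun k => isClosed_le (by fun_prop) continuous_const).inter
      ((isClosed_le continuous_const continuous_snd).inter
        (isClosed_le continuous_snd continuous_const))
  · refine isBounded_iff_forall_norm_le.2 ⟨max (3 * R) (max |a| |b|), fun q hq => ?_⟩
    obtain ⟨h1, h2, h3⟩ := hq
    rw [Prod.norm_def]
    refine max_le_max ?_ ?_
    · have hR : 0 ≤ R := (abs_nonneg _).trans (h1 0)
      refine abs_le_of_sq_le_sq' ?_ (by positivity) |>.2
      rw [EuclideanSpace.norm_sq_eq, Fin.sum_univ_three]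
      have h4 : ∀ k, ‖q.1 k‖ ^ 2 ≤ R ^ 2 := fun k => pow_le_pow_left₀ (norm_nonneg _) (h1 k) 2
      nlinarith [h4 0, h4 1, h4 2]
    · exact abs_le_max_abs_abs h2 h3

lemma SupportedInBox.hasCompactSupport {R a b : ℝ} {f : SpaceTime → ℝ} (h : SupportedInBox R a b f) :
    HasCompactSupport f :=
  HasCompactSupport.of_support_subset_isCompact (isCompact_box R a b) fun q hq => h q hq

lemma SupportedInBox.tsupport_subset {R a b : ℝ} {f : SpaceTime → ℝ} (h : SupportedInBox R a b f) :
    tsupport f ⊆ box R a b :=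
  closure_minimal (fun q hq => h q hq) (isCompact_box R a b).isClosed

lemma box_subset_halfSpace {R a b : ℝ} (ha : 0 < a) : box R a b ⊆ halfSpace :=
  fun _ hq => mem_halfSpace.2 (ha.trans_le hq.2.1)

lemma exists_supportedInBox_of_isCompact {k : Set SpaceTime} (hk : IsCompact k)
    (hs : k ⊆ halfSpace) : ∃ R a b, 1 ≤ R ∧ 0 < a ∧ k ⊆ box R a b := by
  rcases k.eq_empty_or_nonempty with rfl | hne
  · exact ⟨1, 1, 1, le_rfl, one_pos, empty_subset _⟩
  · obtain ⟨M, hM⟩ := hk.isBounded.exists_norm_le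
    obtain ⟨q₀, hq₀, hmin⟩ := hk.exists_isMinOn hne continuous_snd.continuousOn
    refine ⟨max M 1, q₀.2, M, le_max_right _ _, mem_halfSpace.1 (hs hq₀), fun q hq => ⟨fun j => ?_,
      hmin hq, ?_⟩⟩
    · exact ((abs_coord_le j q).trans (hM q hq)).trans (le_max_left _ _)
    · exact (le_abs_self _).trans ((norm_snd_le q).trans (hM q hq))

lemma exists_ne_zero_of_lineIntegral_ne_zero {i : Fin 3} {S : Set ℝ}
    {f : SpaceTime → ℝ} {q : SpaceTime} (h : lineIntegral i S f q ≠ 0) :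
    ∃ s ∈ S, f (q + s • spaceDir i) ≠ 0 := by
  by_contra hcon
  push Not at hcon
  exact h (setIntegral_eq_zero_of_forall_eq_zero hcon)

lemma add_smul_spaceDir_fst_of_ne {i k : Fin 3} (h : k ≠ i) (q : SpaceTime) (s : ℝ) :
    (q + s • spaceDir i).1 k = q.1 k := by
  simp [spaceDir, h]

lemma add_smul_spaceDir_fst_self (i : Fin 3) (q : SpaceTime) (s : ℝ) :
    (q + s • spaceDir i).1 i = q.1 i + s := by
  simp [spaceDir]

lemma add_smul_spaceDir_snd (i : Fin 3) (q : SpaceTime) (s : ℝ) :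
    (q + s • spaceDir i).2 = q.2 := by
  simp [spaceDir]

/-- In the direction i the support is that of the cutoff, contained in [-1, 1]; hence R ≥ 1. -/
lemma SupportedInBox.avg {R a b : ℝ} (hR : 1 ≤ R) {f : 𝓢(SpaceTime, ℝ)}
    (h : SupportedInBox R a b f) (i : Fin 3) : SupportedInBox R a b (avg i f) := by
  intro q hq
  rw [avg_apply] at hq
  obtain ⟨s, -, hs⟩ := exists_ne_zero_of_lineIntegral_ne_zero
    (right_ne_zero_of_mul hq)
  obtain ⟨h1, h2⟩ := h _ hs
  rw [add_smul_spaceDir_snd] at h2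
  refine ⟨fun k => ?_, h2⟩
  by_cases hk : k = i
  · subst hk
    exact (abs_le_one_of_cutoff_ne_zero (left_ne_zero_of_mul hq)).trans hR
  · simpa only [add_smul_spaceDir_fst_of_ne hk] using h1 k

lemma SupportedInBox.sub {R a b : ℝ} {f g : 𝓢(SpaceTime, ℝ)}
    (hf : SupportedInBox R a b f) (hg : SupportedInBox R a b g) :
    SupportedInBox R a b (f - g : 𝓢(SpaceTime, ℝ)) := by
  intro q hq
  by_cases h : f q = 0
  · refine hg q fun h' => hq ?_
    simp [h, h']
  · exact hf q h

/-- The primitive from below is minus the integral from above. If it is nonzero at q, the integrand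
is nonzero on both sides of q along the line, and q lies in the box by convexity. -/
lemma SupportedInBox.prim {R a b : ℝ} (hR : 1 ≤ R) {f : 𝓢(SpaceTime, ℝ)}
    (h : SupportedInBox R a b f) (i : Fin 3) : SupportedInBox R a b (prim i f) := by
  have hg := h.sub (h.avg hR i)
  intro q hq
  rw [prim_apply] at hq
  obtain ⟨s, hs0, hs⟩ := exists_ne_zero_of_lineIntegral_ne_zero hq
  rw [lineIntegral_Iic_eq_neg_Ioi i (lineIntegral_univ_sub_avg i f), neg_ne_zero] at hq
  obtain ⟨s', hs0', hs'⟩ := exists_ne_zero_of_lineIntegral_ne_zero hq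
  obtain ⟨h1, h2⟩ := hg _ hs
  obtain ⟨h1', -⟩ := hg _ hs'
  rw [add_smul_spaceDir_snd] at h2
  refine ⟨fun k => ?_, h2⟩
  by_cases hk : k = i
  · subst hk
    have h3 := h1 k
    have h4 := h1' k
    rw [add_smul_spaceDir_fst_self, abs_le] at h3 h4
    have h5 : s ≤ 0 := hs0
    have h6 : 0 < s' := hs0'
    exact abs_le.2 ⟨by linarith, by linarith⟩
  · simpa only [add_smul_spaceDir_fst_of_ne hk] using h1 k

section

/-! ### Integration against functions of polynomial growth -/

/-- `h` grows at most polynomially in the mean with respect to `μ`. -/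
def GrowsPolynomially (μ : Measure SpaceTime) (h : SpaceTime → ℝ) : Prop :=
  ∃ N : ℕ, Integrable (fun q => h q / (1 + ‖q‖) ^ N) μ

lemma GrowsPolynomially.mono {μ : Measure SpaceTime} {f h : SpaceTime → ℝ}
    (hf : GrowsPolynomially μ f) (hm : AEStronglyMeasurable h μ) (hle : ∀ q, |h q| ≤ |f q|) :
    GrowsPolynomially μ h := by
  obtain ⟨N, hN⟩ := hf
  refine ⟨N, hN.mono (hm.div₀ (g := fun q => (1 + ‖q‖) ^ N) ?_) (Eventually.of_forall fun q => ?_)⟩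
  · exact (by fun_prop : Continuous fun q : SpaceTime => (1 + ‖q‖) ^ N).aestronglyMeasurable
  · rw [norm_div, norm_div]
    exact div_le_div_of_nonneg_right (hle q) (norm_nonneg _)

lemma GrowsPolynomially.add {μ : Measure SpaceTime} {f h : SpaceTime → ℝ}
    (hf : GrowsPolynomially μ f) (hh : GrowsPolynomially μ h) :
    GrowsPolynomially μ fun q => f q + h q := by
  obtain ⟨N, hN⟩ := hf
  obtain ⟨M, hM⟩ := hh
  have key : ∀ {f : SpaceTime → ℝ} {N : ℕ} (M : ℕ),
      Integrable (fun q => f q / (1 + ‖q‖) ^ N) μ →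
        Integrable (fun q => f q / (1 + ‖q‖) ^ (N + M)) μ := by
    intro f N M h
    have hc : Continuous fun q : SpaceTime => ((1 + ‖q‖) ^ M)⁻¹ :=
      Continuous.inv₀ (by fun_prop) fun q => by positivity
    refine (h.mul_bdd (c := 1) hc.aestronglyMeasurable
      (Eventually.of_forall fun q => ?_)).congr (Eventually.of_forall fun q => ?_)
    · rw [norm_inv, norm_pow, Real.norm_of_nonneg (by positivity)]
      exact inv_le_one_of_one_le₀ (one_le_pow₀ (by linarith [norm_nonneg q]))
    · simp only [pow_add]
      field_simp
  refine ⟨N + M, ((key M hN).add (by simpa only [add_comm] using key N hM)).congr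
    (Eventually.of_forall fun q => ?_)⟩
  simp only [Pi.add_apply]
  rw [add_comm N M]
  ring

lemma growsPolynomially_one (μ : Measure SpaceTime) (hμ : μ ≤ volume) :
    GrowsPolynomially μ fun _ => 1 := by
  -- The exponent 5 exceeds the dimension 4 of space-time.
  refine ⟨5, Integrable.mono_measure ?_ hμ⟩
  have h := integrable_one_add_norm (E := SpaceTime) (μ := volume) (r := 5) (by simp; norm_num)
  refine h.congr (Eventually.of_forall fun q => ?_)
  simp only
  rw [Real.rpow_neg (by positivity), one_div]
  norm_cast

lemma integrable_mul_schwartz {μ : Measure SpaceTime} {h : SpaceTime → ℝ} {N : ℕ}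
    (hN : Integrable (fun q => h q / (1 + ‖q‖) ^ N) μ) (ψ : 𝓢(SpaceTime, ℝ)) :
    Integrable (fun q => h q * ψ q) μ := by
  have hc : Continuous fun q : SpaceTime => (1 + ‖q‖) ^ N * ψ q := by
    have := ψ.continuous
    fun_prop
  refine (hN.mul_bdd (c := decayNorm N 0 ψ) hc.aestronglyMeasurable
    (Eventually.of_forall fun q => ?_)).congr (Eventually.of_forall fun q => ?_)
  · have h1 := decay_le N 0 ψ q
    rw [norm_iteratedFDeriv_zero] at h1
    rwa [norm_mul, norm_pow, Real.norm_of_nonneg (by positivity)]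
  · have : (1 + ‖q‖) ^ N ≠ 0 := by positivity
    simp only
    field_simp

/-- Integration against a function of polynomial growth is a tempered distribution. -/
lemma GrowsPolynomially.exists_clm {μ : Measure SpaceTime} {h : SpaceTime → ℝ}
    (hh : GrowsPolynomially μ h) :
    ∃ T : 𝓢(SpaceTime, ℝ) →L[ℝ] ℝ, ∀ ψ, T ψ = ∫ q, h q * ψ q ∂μ := by
  obtain ⟨N, hN⟩ := hh
  refine ⟨SchwartzMap.mkCLMtoNormedSpace (σ := RingHom.id ℝ) (fun ψ => ∫ q, h q * ψ q ∂μ)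
    (fun f g => ?_) (fun c f => ?_)
    ⟨Finset.Iic (N, 0), (∫ q, |h q / (1 + ‖q‖) ^ N| ∂μ) * 2 ^ N, ?_, fun f => ?_⟩, fun ψ => rfl⟩
  · rw [← integral_add (integrable_mul_schwartz hN f) (integrable_mul_schwartz hN g)]
    simp [mul_add]
  · rw [RingHom.id_apply, smul_eq_mul, ← integral_const_mul]
    refine integral_congr_ae (Eventually.of_forall fun q => ?_)
    simp only [smul_apply, smul_eq_mul]
    ring
  · have : 0 ≤ ∫ q, |h q / (1 + ‖q‖) ^ N| ∂μ := integral_nonneg fun q => abs_nonneg _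
    positivity
  · refine (norm_integral_le_of_norm_le (hN.abs.mul_const (decayNorm N 0 f))
      (Eventually.of_forall fun q => ?_)).trans_eq ?_
    · have h1 := decay_le N 0 f q
      rw [norm_iteratedFDeriv_zero] at h1
      have h2 : (1 + ‖q‖) ^ N ≠ 0 := by positivity
      have h3 : 0 ≤ (1 + ‖q‖) ^ N := by positivity
      calc ‖h q * f q‖ = |h q / (1 + ‖q‖) ^ N| * ((1 + ‖q‖) ^ N * ‖f q‖) := by
            rw [norm_mul, abs_div, abs_of_nonneg h3, Real.norm_eq_abs]
            field_simp
        _ ≤ _ := by gcongr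
    · rw [integral_mul_const, mul_assoc]
      rfl

/-! ### The momentum functional -/

/-- The action of `∂u/∂t + ∇ · (u ⊗ u) - νΔu - g` in the direction `k` on a test function, as an
integral with respect to `μ`. -/
def momentum (ν : ℝ) (g u : SpaceTime → E3) (μ : Measure SpaceTime) (k : Fin 3)
    (Ψ : 𝓢(SpaceTime, ℝ)) : ℝ :=
  (∫ q, u q k * backwardHeat ν Ψ q ∂μ) -
    (∑ j : Fin 3, ∫ q, u q k * u q j * (∂_{spaceDir j} Ψ : 𝓢(SpaceTime, ℝ)) q ∂μ) -
      ∫ q, g q k * Ψ q ∂μ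

/-- The pressure as a functional on test functions: `momentum` applied to a vector field whose
divergence is `ψ` minus its iterated average. -/
def pressure (ν : ℝ) (g u : SpaceTime → E3) (μ : Measure SpaceTime) (ψ : 𝓢(SpaceTime, ℝ)) : ℝ :=
  momentum ν g u μ 0 (prim 0 ψ) + momentum ν g u μ 1 (prim 1 (avg 0 ψ)) +
    momentum ν g u μ 2 (prim 2 (avg 1 (avg 0 ψ)))

variable {ν : ℝ} {u₀ : E3 → E3} {g u : SpaceTime → E3} {μ : Measure SpaceTime}

lemma exists_momentum_clm (h1 : ∀ k, GrowsPolynomially μ fun q => u q k)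
    (h2 : ∀ k j, GrowsPolynomially μ fun q => u q k * u q j)
    (h3 : ∀ k, GrowsPolynomially μ fun q => g q k) (ν : ℝ) (k : Fin 3) :
    ∃ T : 𝓢(SpaceTime, ℝ) →L[ℝ] ℝ, ∀ Ψ, T Ψ = momentum ν g u μ k Ψ := by
  obtain ⟨A, hA⟩ := (h1 k).exists_clm
  choose B hB using fun j => (h2 k j).exists_clm
  obtain ⟨D, hD⟩ := (h3 k).exists_clm
  let d : SpaceTime → 𝓢(SpaceTime, ℝ) →L[ℝ] 𝓢(SpaceTime, ℝ) := fun v =>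
    LineDeriv.lineDerivOpCLM ℝ 𝓢(SpaceTime, ℝ) v
  refine ⟨A.comp (-(d timeDir) - ν • ∑ j : Fin 3, (d (spaceDir j)).comp (d (spaceDir j))) -
    (∑ j : Fin 3, (B j).comp (d (spaceDir j))) - D, fun Ψ => ?_⟩
  have e : (-(d timeDir) - ν • ∑ j : Fin 3, (d (spaceDir j)).comp (d (spaceDir j))) Ψ =
      backwardHeat ν Ψ := by
    simp [d, backwardHeat, LineDeriv.lineDerivOpCLM_apply]
  rw [sub_apply, sub_apply, ContinuousLinearMap.comp_apply,
    e, hA, hD, momentum, sum_apply]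
  simp only [ContinuousLinearMap.comp_apply, hB]
  rfl

/-- The measure is a parameter so that one statement serves twice: restricted to a compact box,
local integrability yields a distribution; restricted to the half-space, polynomial growth yields a
tempered one. -/
lemma exists_pressure_clm (h1 : ∀ k, GrowsPolynomially μ fun q => u q k)
    (h2 : ∀ k j, GrowsPolynomially μ fun q => u q k * u q j)
    (h3 : ∀ k, GrowsPolynomially μ fun q => g q k) (ν : ℝ) :
    ∃ T : 𝓢(SpaceTime, ℝ) →L[ℝ] ℝ, ∀ ψ, T ψ = pressure ν g u μ ψ := by
  choose S hS using exists_momentum_clm h1 h2 h3 ν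
  refine ⟨(S 0).comp (prim 0) + (S 1).comp ((prim 1).comp (avg 0)) +
    (S 2).comp ((prim 2).comp ((avg 1).comp (avg 0))), fun ψ => ?_⟩
  simp [pressure, hS]

lemma momentum_restrict {M : Set SpaceTime} (k : Fin 3) {Ψ : 𝓢(SpaceTime, ℝ)}
    (h : tsupport Ψ ⊆ M) :
    momentum ν g u (volume.restrict M) k Ψ = momentum ν g u volume k Ψ := by
  have key : ∀ (f : SpaceTime → ℝ) (ψ : 𝓢(SpaceTime, ℝ)), tsupport ψ ⊆ tsupport Ψ →
      ∫ q in M, f q * ψ q = ∫ q, f q * ψ q := fun f ψ hψ =>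
    setIntegral_eq_integral_of_forall_compl_eq_zero fun q hq => by
      rw [image_eq_zero_of_notMem_tsupport (fun h' => hq (h (hψ h'))), mul_zero]
  unfold momentum
  rw [key _ _ (tsupport_backwardHeat_subset ν Ψ), key _ _ subset_rfl]
  simp_rw [key (fun q => u q k * u q _) _ (SchwartzMap.tsupport_lineDerivOp_subset _ Ψ)]

lemma pressure_restrict {M : Set SpaceTime} {R a b : ℝ} (hR : 1 ≤ R) (hM : box R a b ⊆ M)
    {ψ : 𝓢(SpaceTime, ℝ)} (h : SupportedInBox R a b ψ) :
    pressure ν g u (volume.restrict M) ψ = pressure ν g u volume ψ := by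
  unfold pressure
  rw [momentum_restrict, momentum_restrict, momentum_restrict]
  · exact ((((h.avg hR 0).avg hR 1).prim hR 2).tsupport_subset).trans hM
  · exact (((h.avg hR 0).prim hR 1).tsupport_subset).trans hM
  · exact ((h.prim hR 0).tsupport_subset).trans hM

lemma growsPolynomially_of_isCompact {h : SpaceTime → ℝ} {M : Set SpaceTime}
    (hh : LocallyIntegrableOn h (halfSpace : Set SpaceTime)) (hM : IsCompact M)
    (hs : M ⊆ halfSpace) : GrowsPolynomially (volume.restrict M) h :=
  ⟨0, by simpa [IntegrableOn] using hh.integrableOn_compact_subset hs hM⟩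

/-- Averaging in a direction kills the derivative in that direction and commutes with the others.
Derivatives of test functions therefore have no triple average and are exact divergences. -/
lemma avg_avg_avg_lineDeriv (j : Fin 3) (φ : 𝓢(SpaceTime, ℝ)) :
    avg 2 (avg 1 (avg 0 (∂_{spaceDir j} φ))) = 0 := by
  fin_cases j
  · simp only [Fin.zero_eta, avg_lineDeriv_self, map_zero]
  · simp only [Fin.mk_one]
    rw [avg_lineDeriv_of_ne (by decide), avg_lineDeriv_self, map_zero]
  · simp only [Fin.reduceFinMk]
    rw [avg_lineDeriv_of_ne (by decide), avg_lineDeriv_of_ne (by decide), avg_lineDeriv_self]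

lemma SupportedInBox.lineDeriv {R a b : ℝ} {φ : 𝓢(SpaceTime, ℝ)} (h : SupportedInBox R a b φ)
    (v : SpaceTime) : SupportedInBox R a b (∂_{v} φ : 𝓢(SpaceTime, ℝ)) := fun _ hq =>
  h.tsupport_subset (SchwartzMap.tsupport_lineDerivOp_subset v φ (subset_tsupport _ hq))

/-- The gradient of the pressure balances the momentum. -/
lemma pressure_lineDeriv (hν : 0 < ν) (hu₀ : LocallyIntegrable u₀)
    (hg : LocallyIntegrableOn g (halfSpace : Set SpaceTime)) (hu : LocallySquareIntegrable u)
    (heq : ∀ᵐ q : SpaceTime ∂(volume.restrict (halfSpace : Set SpaceTime)),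
      IntegralEquationAt ν u₀ g u q.1 q.2)
    {R a b : ℝ} (hR : 1 ≤ R) (ha : 0 < a) {φ : 𝓢(SpaceTime, ℝ)} (hφ : SupportedInBox R a b φ)
    (j : Fin 3) :
    pressure ν g u volume (∂_{spaceDir j} φ) = momentum ν g u volume j φ := by
  have hc := isCompact_box R a b
  have hs := box_subset_halfSpace (R := R) (b := b) ha
  have hul := locallyIntegrableOn_velocity hu
  -- On functions supported in the box, the momentum agrees with a continuous linear functional,
  -- from which its additivity is read off.
  obtain ⟨S, hS⟩ := Classical.axiomOfChoice (exists_momentum_clm (μ := volume.restrict (box R a b))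
    (fun k => growsPolynomially_of_isCompact (locallyIntegrableOn_apply hul k) hc hs)
    (fun k j => growsPolynomially_of_isCompact (locallyIntegrableOn_mul hu k j) hc hs)
    (fun k => growsPolynomially_of_isCompact (locallyIntegrableOn_apply hg k) hc hs) ν)
  set ψ : 𝓢(SpaceTime, ℝ) := ∂_{spaceDir j} φ with hψ
  have hψs : SupportedInBox R a b ψ := hφ.lineDeriv _
  -- The divergence of V telescopes: ψ minus its first average, plus the first average minus the
  -- second, plus the second minus the third, and the third is zero.
  set V : Fin 3 → 𝓢(SpaceTime, ℝ) :=
    ![prim 0 ψ, prim 1 (avg 0 ψ), prim 2 (avg 1 (avg 0 ψ))] with hV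
  have hVs : ∀ k, SupportedInBox R a b (V k) := by
    intro k
    fin_cases k
    · exact hψs.prim hR 0
    · exact (hψs.avg hR 0).prim hR 1
    · exact ((hψs.avg hR 0).avg hR 1).prim hR 2
  have hδ : ∀ k, SupportedInBox R a b (Pi.single (M := fun _ => 𝓢(SpaceTime, ℝ)) j φ k) := by
    intro k
    by_cases h : k = j
    · subst h; simpa using hφ
    · intro q hq
      rw [Pi.single_eq_of_ne h] at hq
      exact absurd rfl hq
  -- Both V and φ eⱼ have divergence ∂ⱼφ and are supported in the box. Their difference is an
  -- admissible divergence-free field, on which the momentum vanishes.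
  set Φ : Fin 3 → 𝓢(SpaceTime, ℝ) := fun k =>
    V k - Pi.single (M := fun _ => 𝓢(SpaceTime, ℝ)) j φ k with hΦ
  have hΦs : ∀ k, SupportedInBox R a b (Φ k) := fun k => (hVs k).sub (hδ k)
  have hdivV : ∑ k, ∂_{spaceDir k} (V k) = ψ := by
    rw [Fin.sum_univ_three]
    simp only [hV, Matrix.cons_val_zero, Matrix.cons_val_one, Matrix.cons_val]
    rw [lineDeriv_prim, lineDeriv_prim, lineDeriv_prim, avg_avg_avg_lineDeriv]
    abel
  have hdivδ : ∑ k, (∂_{spaceDir k} (Pi.single (M := fun _ => 𝓢(SpaceTime, ℝ)) j φ k) :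
      𝓢(SpaceTime, ℝ)) = ψ := by
    rw [Finset.sum_eq_single j (fun k _ hk => by
      rw [Pi.single_eq_of_ne hk]; exact (LineDeriv.lineDerivOpCLM ℝ 𝓢(SpaceTime, ℝ) (spaceDir k)).map_zero)
      (by simp), Pi.single_eq_same]
  have hdiv : ∑ k, ∂_{spaceDir k} (Φ k) = 0 := by
    have e : ∀ k, (∂_{spaceDir k} (Φ k) : 𝓢(SpaceTime, ℝ)) = ∂_{spaceDir k} (V k) -
        ∂_{spaceDir k} (Pi.single (M := fun _ => 𝓢(SpaceTime, ℝ)) j φ k) := fun k =>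
      (LineDeriv.lineDerivOpCLM ℝ 𝓢(SpaceTime, ℝ) (spaceDir k)).map_sub _ _
    simp_rw [e]
    rw [Finset.sum_sub_distrib, hdivV, hdivδ, sub_self]
  have hmain := sum_integral_velocity_mul_backwardHeat hν hu₀ hg hu heq
    (fun k => (hΦs k).hasCompactSupport) (fun k => (hΦs k).tsupport_subset.trans hs) hdiv
  have hzero : ∑ k, momentum ν g u volume k (Φ k) = 0 := by
    simp only [momentum, Finset.sum_sub_distrib]
    rw [hmain]
    ring
  have hS' : ∀ k {Ψ : 𝓢(SpaceTime, ℝ)}, SupportedInBox R a b Ψ →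
      S k Ψ = momentum ν g u volume k Ψ := fun k Ψ h => by
    rw [hS, momentum_restrict k h.tsupport_subset]
  have h1 : ∑ k, S k (V k) = ∑ k, S k (Pi.single (M := fun _ => 𝓢(SpaceTime, ℝ)) j φ k) := by
    rw [← sub_eq_zero, ← Finset.sum_sub_distrib, ← hzero]
    refine Finset.sum_congr rfl fun k _ => ?_
    rw [← map_sub, ← hS' k (hΦs k)]
  rw [Finset.sum_eq_single (a := j) (f := fun k => S k (Pi.single (M := fun _ => 𝓢(SpaceTime, ℝ)) j φ k)) (fun k _ hk => by
      rw [Pi.single_eq_of_ne hk, map_zero]) (by simp), Pi.single_eq_same, hS' j hφ] at h1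
  rw [← h1]
  simp_rw [fun k => hS' k (hVs k)]
  rw [Fin.sum_univ_three]
  rfl

/-! ### The pressure as a distribution -/

/-- Test functions supported in a compact set are Schwartz functions. -/
def toSchwartzCLM (K : Compacts SpaceTime) : 𝓓_{K}(SpaceTime, ℝ) →L[ℝ] 𝓢(SpaceTime, ℝ) where
  toFun φ := φ.compact_supp.toSchwartzMap φ.contDiff
  map_add' _ _ := rfl
  map_smul' _ _ := rfl
  cont := by
    refine WithSeminorms.continuous_of_isBounded (τ₁₂ := RingHom.id ℝ)
      (ContDiffMapSupportedIn.withSeminorms ℝ SpaceTime ℝ ⊤ K)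
      (schwartz_withSeminorms ℝ SpaceTime ℝ)
      (⟨⟨fun φ => φ.compact_supp.toSchwartzMap φ.contDiff, fun _ _ => rfl⟩, fun _ _ => rfl⟩ :
        𝓓_{K}(SpaceTime, ℝ) →ₗ[ℝ] 𝓢(SpaceTime, ℝ)) ?_
    rintro ⟨k, n⟩
    obtain ⟨C, hC⟩ := K.isCompact.isBounded.exists_norm_le
    refine ⟨{n}, (max C 0).toNNReal ^ k, fun φ => ?_⟩
    have hn := apply_nonneg (ContDiffMapSupportedIn.seminorm ℝ SpaceTime ℝ ⊤ K n) φ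
    rw [Finset.sup_singleton, smul_apply, NNReal.smul_def, NNReal.coe_pow,
      Real.coe_toNNReal _ (le_max_right _ _), smul_eq_mul]
    refine SchwartzMap.seminorm_le_bound ℝ k n _ (by positivity) fun q => ?_
    by_cases hq : q ∈ (K : Set SpaceTime)
    · exact mul_le_mul (pow_le_pow_left₀ (norm_nonneg _) ((hC q hq).trans (le_max_left _ _)) k)
        (ContDiffMapSupportedIn.norm_iteratedFDeriv_apply_le_seminorm_top ℝ (f := φ))
        (norm_nonneg _) (by positivity)
    · have h0 := φ.iteratedFDeriv_zero_on_compl (i := n) hq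
      have h1 : iteratedFDeriv ℝ n (φ.compact_supp.toSchwartzMap φ.contDiff) q = 0 := h0
      refine le_trans (le_of_eq ?_) (by positivity : (0 : ℝ) ≤ _)
      exact mul_eq_zero_of_right _ (norm_eq_zero.2 h1)

/-- A test function as a Schwartz function. -/
abbrev toSchwartz (φ : 𝓓(halfSpace, ℝ)) : 𝓢(SpaceTime, ℝ) :=
  φ.hasCompactSupport.toSchwartzMap φ.contDiff

lemma exists_supportedInBox (φ : 𝓓(halfSpace, ℝ)) :
    ∃ R a b, 1 ≤ R ∧ 0 < a ∧ SupportedInBox R a b (toSchwartz φ) := by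
  obtain ⟨R, a, b, hR, ha, h⟩ := exists_supportedInBox_of_isCompact φ.hasCompactSupport
    φ.tsupport_subset
  exact ⟨R, a, b, hR, ha, fun q hq => h (subset_tsupport _ hq)⟩

/-- Continuity on test functions may be checked for each compact support separately. Enclosing that
support in a box of positive times reduces the claim to integrals over the box, where the data are
integrable. -/
lemma exists_pressure_distribution (hg : LocallyIntegrableOn g (halfSpace : Set SpaceTime))
    (hu : LocallySquareIntegrable u) (ν : ℝ) :
    ∃ p : 𝓓'(halfSpace, ℝ), ∀ φ, p φ = pressure ν g u volume (toSchwartz φ) := by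
  have hul := locallyIntegrableOn_velocity hu
  have key : ∀ K : Compacts SpaceTime, (K : Set SpaceTime) ⊆ halfSpace →
      ∃ T : 𝓓_{K}(SpaceTime, ℝ) →L[ℝ] ℝ, ∀ φ, T φ = pressure ν g u volume (toSchwartzCLM K φ) := by
    intro K hK
    obtain ⟨R, a, b, hR, ha, hKb⟩ := exists_supportedInBox_of_isCompact K.isCompact hK
    have hc := isCompact_box R a b
    have hs := box_subset_halfSpace (R := R) (b := b) ha
    obtain ⟨S, hS⟩ := exists_pressure_clm (μ := volume.restrict (box R a b))
      (fun k => growsPolynomially_of_isCompact (locallyIntegrableOn_apply hul k) hc hs)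
      (fun k j => growsPolynomially_of_isCompact (locallyIntegrableOn_mul hu k j) hc hs)
      (fun k => growsPolynomially_of_isCompact (locallyIntegrableOn_apply hg k) hc hs) ν
    refine ⟨S.comp (toSchwartzCLM K), fun φ => ?_⟩
    rw [ContinuousLinearMap.comp_apply, hS]
    exact pressure_restrict hR subset_rfl fun q hq => hKb (φ.support_subset hq)
  choose T hT using key
  exact ⟨TestFunction.limitCLM ℝ (fun φ => pressure ν g u volume (toSchwartz φ)) T
    fun K hK φ => (hT K hK φ).symm, fun φ => rfl⟩

lemma toSchwartz_lineDeriv (φ : 𝓓(halfSpace, ℝ)) (v : SpaceTime) :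
    toSchwartz (∂_{v} φ) = ∂_{v} (toSchwartz φ) := by
  ext q
  rw [SchwartzMap.lineDerivOp_apply_eq_fderiv]
  rfl

lemma momentum_toSchwartz (hu : LocallySquareIntegrable u) (i : Fin 3) (φ : 𝓓(halfSpace, ℝ)) :
    momentum ν g u volume i (toSchwartz φ) =
      -(∫ q : SpaceTime, u q i * (∂_{timeDir} φ) q) -
        ν * (∑ j : Fin 3, ∫ q : SpaceTime, u q i * (∂_{spaceDir j} (∂_{spaceDir j} φ)) q) -
        (∑ j : Fin 3, ∫ q : SpaceTime, u q i * u q j * (∂_{spaceDir j} φ) q) -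
          ∫ q : SpaceTime, g q i * φ q := by
  have hul := locallyIntegrableOn_apply (locallyIntegrableOn_velocity hu) i
  have hI : ∀ φ : 𝓓(halfSpace, ℝ), Integrable fun q => u q i * φ q := fun φ =>
    integrable_mul_test hul (φ := toSchwartz φ) φ.hasCompactSupport φ.tsupport_subset
  have e : (∫ q, u q i * backwardHeat ν (toSchwartz φ) q) =
      -(∫ q : SpaceTime, u q i * (∂_{timeDir} φ) q) -
        ν * (∑ j : Fin 3, ∫ q : SpaceTime, u q i * (∂_{spaceDir j} (∂_{spaceDir j} φ)) q) := by
    have h1 : Integrable fun q => -(u q i * (∂_{timeDir} φ) q) := (hI (∂_{timeDir} φ)).neg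
    rw [← integral_finsetSum _ fun j _ => hI _, ← integral_const_mul, ← integral_neg,
      ← integral_sub h1 ((integrable_finsetSum _ fun j _ => hI _).const_mul ν)]
    refine integral_congr_ae (Eventually.of_forall fun q => ?_)
    simp only [backwardHeat_apply, ← toSchwartz_lineDeriv]
    rw [← Finset.mul_sum]
    change u q i * (-(∂_{timeDir} φ) q -
      ν * ∑ j : Fin 3, (∂_{spaceDir j} (∂_{spaceDir j} φ)) q) = _
    ring
  rw [momentum, e]
  simp_rw [← toSchwartz_lineDeriv]
  rfl

end

section

/-! ### The weak formulation -/

variable {ν : ℝ} {u₀ : E3 → E3} {g u : SpaceTime → E3}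

lemma divergenceFree_of_integralEquation (hν : 0 < ν) (hu₀ : LocallyIntegrable u₀)
    (hdiv : DivergenceFree₀ u₀)
    (hg : LocallyIntegrableOn g (halfSpace : Set SpaceTime)) (hu : LocallySquareIntegrable u)
    (heq : ∀ᵐ q : SpaceTime ∂(volume.restrict (halfSpace : Set SpaceTime)),
      IntegralEquationAt ν u₀ g u q.1 q.2) : DivergenceFree u := by
  intro φ
  have h := sum_integral_velocity_mul_lineDeriv hν hu₀ hdiv hg hu heq (φ := toSchwartz φ)
    φ.hasCompactSupport φ.tsupport_subset
  simp_rw [← toSchwartz_lineDeriv] at h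
  exact h

lemma momentumEquation_of_integralEquation (hν : 0 < ν) (hu₀ : LocallyIntegrable u₀)
    (hg : LocallyIntegrableOn g (halfSpace : Set SpaceTime)) (hu : LocallySquareIntegrable u)
    (heq : ∀ᵐ q : SpaceTime ∂(volume.restrict (halfSpace : Set SpaceTime)),
      IntegralEquationAt ν u₀ g u q.1 q.2) {p : 𝓓'(halfSpace, ℝ)}
    (hp : ∀ φ, p φ = pressure ν g u volume (toSchwartz φ)) : MomentumEquation ν g u p := by
  intro i φ
  obtain ⟨R, a, b, hR, ha, h⟩ := exists_supportedInBox φ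
  rw [hp, toSchwartz_lineDeriv, pressure_lineDeriv hν hu₀ hg hu heq hR ha h i,
    momentum_toSchwartz hu]
  ring

lemma isTempered_pressure (h1 : ∀ k, GrowsPolynomially (volume.restrict halfSpace) fun q => u q k)
    (h2 : ∀ k j, GrowsPolynomially (volume.restrict halfSpace) fun q => u q k * u q j)
    (h3 : ∀ k, GrowsPolynomially (volume.restrict halfSpace) fun q => g q k)
    {p : 𝓓'(halfSpace, ℝ)} (hp : ∀ φ, p φ = pressure ν g u volume (toSchwartz φ)) :
    IsTempered p := by
  obtain ⟨S, hS⟩ := exists_pressure_clm h1 h2 h3 ν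
  refine ⟨S, fun φ => ?_⟩
  obtain ⟨R, a, b, hR, ha, h⟩ := exists_supportedInBox φ
  rw [hS, hp]
  exact pressure_restrict hR (box_subset_halfSpace ha) h

lemma isTempered_integral {h : SpaceTime → ℝ}
    (hh : GrowsPolynomially (volume.restrict halfSpace) h) :
    IsTempered fun φ => ∫ q : SpaceTime, h q * φ q := by
  obtain ⟨S, hS⟩ := hh.exists_clm
  refine ⟨S, fun φ => ?_⟩
  rw [hS]
  refine setIntegral_eq_integral_of_forall_compl_eq_zero fun q hq => ?_
  exact mul_eq_zero_of_right _
    (image_eq_zero_of_notMem_tsupport (f := φ) fun h' => hq (φ.tsupport_subset h'))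

lemma abs_apply_le_norm (w : E3) (i : Fin 3) : |w i| ≤ ‖w‖ := PiLp.norm_apply_le w i

/-- The two growth hypotheses control every coefficient that occurs, since |uₖ| ≤ 1 + |u|² and
|uₖuⱼ| ≤ |u|². The pressure is the one already constructed. -/
lemma isWeakSolution_of_polynomialGrowth (hg : LocallyIntegrableOn g (halfSpace : Set SpaceTime))
    (hsol : IsDistributionalSolution ν u₀ g u)
    (hmom : ∀ p : 𝓓'(halfSpace, ℝ), (∀ φ, p φ = pressure ν g u volume (toSchwartz φ)) →
      MomentumEquation ν g u p)
    (hgu : PolynomialGrowth fun q => ‖u q‖ ^ 2) (hgg : PolynomialGrowth fun q => ‖g q‖) :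
    IsWeakSolution ν u₀ g u := by
  have hu := hsol.locallySquareIntegrable
  have hul := locallyIntegrableOn_velocity hu
  have hgu' : GrowsPolynomially (volume.restrict halfSpace) fun q => ‖u q‖ ^ 2 := hgu
  have hgg' : GrowsPolynomially (volume.restrict halfSpace) fun q => ‖g q‖ := hgg
  have h1 : ∀ k, GrowsPolynomially (volume.restrict halfSpace) fun q => u q k := fun k => by
    refine ((growsPolynomially_one _ Measure.restrict_le_self).add hgu').mono
      (locallyIntegrableOn_apply hul k).aestronglyMeasurable fun q => ?_
    rw [abs_of_nonneg (a := 1 + ‖u q‖ ^ 2) (by positivity)]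
    nlinarith [abs_apply_le_norm (u q) k, sq_nonneg (‖u q‖ - 1), norm_nonneg (u q)]
  have h2 : ∀ k j, GrowsPolynomially (volume.restrict halfSpace) fun q => u q k * u q j :=
    fun k j => by
      refine hgu'.mono (locallyIntegrableOn_mul hu k j).aestronglyMeasurable fun q => ?_
      rw [abs_of_nonneg (a := ‖u q‖ ^ 2) (by positivity), abs_mul, sq]
      exact mul_le_mul (abs_apply_le_norm _ k) (abs_apply_le_norm _ j) (abs_nonneg _)
        (norm_nonneg _)
  have h3 : ∀ k, GrowsPolynomially (volume.restrict halfSpace) fun q => g q k := fun k => by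
    refine hgg'.mono (locallyIntegrableOn_apply hg k).aestronglyMeasurable fun q => ?_
    rw [abs_norm]
    exact abs_apply_le_norm _ k
  obtain ⟨p, hp⟩ := exists_pressure_distribution hg hu ν
  exact ⟨fun i => isTempered_integral (h1 i), hu, hsol.divergenceFree,
    ⟨p, isTempered_pressure h1 h2 h3 hp, hmom p hp⟩, hsol.initial⟩

end

end NavierStokes

end

/-! ### From the integral equation to weak solutions. -/

theorem mainTheorem2 (ν : ℝ) (hν : 0 < ν) (u₀ : NavierStokes.E3 → NavierStokes.E3)
    (g u : NavierStokes.SpaceTime → NavierStokes.E3)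
    (hu₀ : LocallyIntegrable u₀) (hdiv : NavierStokes.DivergenceFree₀ u₀)
    (hg : LocallyIntegrableOn g (NavierStokes.halfSpace : Set NavierStokes.SpaceTime))
    (hu : NavierStokes.LocallySquareIntegrable u)
    (heq : ∀ᵐ q : NavierStokes.SpaceTime
        ∂(volume.restrict (NavierStokes.halfSpace : Set NavierStokes.SpaceTime)),
      NavierStokes.IntegralEquationAt ν u₀ g u q.1 q.2) :
    NavierStokes.IsDistributionalSolution ν u₀ g u ∧
      (NavierStokes.PolynomialGrowth (fun q => ‖u q‖ ^ 2) →
        NavierStokes.PolynomialGrowth (fun q => ‖g q‖) →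
          NavierStokes.IsWeakSolution ν u₀ g u) := by
  have hmom := fun p hp =>
    NavierStokes.momentumEquation_of_integralEquation (p := p) hν hu₀ hg hu heq hp
  obtain ⟨p, hp⟩ := NavierStokes.exists_pressure_distribution hg hu ν
  have hsol : NavierStokes.IsDistributionalSolution ν u₀ g u :=
    ⟨hu, NavierStokes.divergenceFree_of_integralEquation hν hu₀ hdiv hg hu heq, ⟨p, hmom p hp⟩,
      NavierStokes.hasInitialVelocity_of_integralEquation hν hu₀ hg hu heq⟩
  exact ⟨hsol, NavierStokes.isWeakSolution_of_polynomialGrowth hg hsol hmom⟩
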